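/- Let $\Omega(n)$ denote the number of prime factors of $n$ counted with multiplicity, $\lambda(n)=(-1)^{\Omega(n)}$ the Liouville function, and $P^-(n)$ the smallest prime factor of $n$. Say that a real number $\vartheta$ satisfies $(D)$ if for all $\varepsilon>0$, $A>0$ one has, for integers $N\ge 2$, $$\sum_{q\le N^{\vartheta-\varepsilon}}\ \max_{(a,q)=1}\Bigl|\sum_{\substack{p\le N\\ p\equiv a\,(q)}}\log p-\frac{N}{\varphi(q)}\Bigr|\ll_{\varepsilon,A}\frac{N}{(\log N)^A}$$ ($p$ running over primes) and $$\sum_{q\le N^{\vartheta-\varepsilon}}\ \max_{y\le N}\ \max_{a}\Bigl|\sum_{\substack{n\le y\\ n\equiv a\,(q)}}\lambda(n)\Bigr|\ll_{\varepsilon,A}\frac{N}{(\log N)^A}.$$ Put $C_2(0.924)=3$, $C_2(0.739)=4$, $C_2(0.643)=5$, $C_2(0.584)=6$, $C_2(0.544)=7$, $C_2(0.516)=8$. There exist absolute constants $C$ and $c>0$ with the following property. Let $\vartheta_0$ be one of the six listed values, $k=C_2(\vartheta_0)$, and suppose that some $\vartheta\ge\vartheta_0$ satisfies $(D)$. Let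 $\mathcal H=\{h_1<\dots<h_k\}$, $h_i\in\mathbb Z$, $h_1\ge 0$, be admissible, i.e. $\mathcal H$ does not occupy all residue classes modulo any prime. (a) For every $j\in[1,k]$ there is an odd $b\le C$ such that for infinitely many positive integers $n$ we have $P^-(n+h_i)>n^c$ and $\Omega(n+h_i)\le C$ for all $1\le i\le k$, and moreover either (i) at least two of the numbers $n+h_\nu$ with $\nu\ne j$ are primes, or (ii) $\Omega(n+h_j)=b$ and $n+h_\nu$ is prime for some $\nu\neq j$. (b) In particular, for some $j\in[1,k]$ there is an odd $b\le C$ such that for infinitely many positive integers $n$ we have $P^-(n+h_i)>n^c$ and $\Omega(n+h_i)\le C$ for all $1\le i\le k$, $\Omega(n+h_j)=b$, and $n+h_\nu$ is prime for some $\nu\ne j$. -/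

import Mathlib

/-- The error term `∑_{p ≤ N, p ≡ a (mod q)} log p - N / φ(q)`
for a reduced residue class `a` modulo `q`. -/
noncomputable def primeError (N q : ℕ) (a : (ZMod q)ˣ) : ℝ :=
  (∑ p ∈ (Finset.Icc 1 N).filter (fun p : ℕ => p.Prime ∧ (p : ZMod q) = (a : ZMod q)),
    Real.log (p : ℝ)) - (N : ℝ) / (q.totient : ℝ)

/-- `∑_{n ≤ y, n ≡ a (mod q)} lambda(n)`, with `lambda` the Liouville function
(`n` runs over positive integers, `a` over all residue classes modulo `q`). -/
noncomputable def liouvilleSum (y q : ℕ) (a : ZMod q) : ℝ :=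
  ∑ n ∈ (Finset.Icc 1 y).filter (fun n : ℕ => (n : ZMod q) = a),
    (ArithmeticFunction.liouville n : ℝ)

/-- `ϑ` is an admissible level of distribution of the primes: for all `ε, A > 0`,
`∑_{q ≤ N^(ϑ-ε)} max_{(a,q)=1} |∑_{p ≤ N, p ≡ a (q)} log p - N/φ(q)| ≪_{ε,A} N / log^A N`.
The suprema are over finite non-empty sets, so they are maxima. -/
def IsPrimeLevel (ϑ : ℝ) : Prop :=
  ∀ ε : ℝ, 0 < ε → ∀ A : ℝ, 0 < A → ∃ K : ℝ, ∀ N : ℕ, 2 ≤ N →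
    ∑ q ∈ Finset.Icc 1 ⌊(N : ℝ) ^ (ϑ - ε)⌋₊, (⨆ a : (ZMod q)ˣ, |primeError N q a|)
      ≤ K * ((N : ℝ) / Real.log (N : ℝ) ^ A)

/-- `ϑ` is an admissible level of distribution of the Liouville function:
for all `ε, A > 0`,
`∑_{q ≤ N^(ϑ-ε)} max_{y ≤ N} max_a |∑_{n ≤ y, n ≡ a (q)} lambda(n)| ≪_{ε,A} N / log^A N`.
The suprema are over finite non-empty sets, so they are maxima. -/
def IsLiouvilleLevel (ϑ : ℝ) : Prop :=
  ∀ ε : ℝ, 0 < ε → ∀ A : ℝ, 0 < A → ∃ K : ℝ, ∀ N : ℕ, 2 ≤ N →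
    ∑ q ∈ Finset.Icc 1 ⌊(N : ℝ) ^ (ϑ - ε)⌋₊,
        (⨆ y : Fin (N + 1), ⨆ a : ZMod q, |liouvilleSum (y : ℕ) q a|)
      ≤ K * ((N : ℝ) / Real.log (N : ℝ) ^ A)

/-- A `k`-tuple `0 ≤ h_1 < ⋯ < h_k` of integers is admissible if it does not
occupy all residue classes modulo any prime. -/
def IsAdmissibleTuple {k : ℕ} (h : Fin k → ℕ) : Prop :=
  StrictMono h ∧ ∀ p : ℕ, p.Prime → ∃ r : ZMod p, ∀ i : Fin k, (h i : ZMod p) ≠ r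

/-- All components `n + h_i` are almost primes: the smallest prime factor of `n + h_i`
exceeds `n^c`, and `n + h_i` has at most `C` prime factors counted with multiplicity. -/
def AlmostPrimeComponents {k : ℕ} (h : Fin k → ℕ) (c : ℝ) (C n : ℕ) : Prop :=
  ∀ i : Fin k, (n : ℝ) ^ c < ((n + h i).minFac : ℝ) ∧
    ArithmeticFunction.cardFactors (n + h i) ≤ C

/-- The pairs `(ϑ, k)` with `k = C₂(ϑ)`. -/
def levelTable : Set (ℝ × ℕ) :=
  {(0.924, 3), (0.739, 4), (0.643, 5), (0.584, 6), (0.544, 7), (0.516, 8)}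

/-! The proof is a Goldston–Pintz–Yıldırım sieve in which the Liouville function handles the
component `n + h j`. Let w(n) ≥ 0 be the square of a Selberg weight of level R = N^β with 2β < ϑ,
for n in (N, 2N] lying in a class modulo W = ∏_{p ≤ D} p in which every n + h_i is coprime to W. If
no large n had the desired property, then pointwise (`sum_prime_indicator_le`) #{ν ≠ j : n + h_ν
prime} ≤ (1 + λ(n + h_j))/2 + k · Σ_i #{q ≤ (2N)^c prime : q ∣ n + h_i}, because a rough n has at
most one prime off j, and when it has one, Ω(n + h_j) is even. Sum this against w. The level of
distribution of λ makes its sum negligible, so the first term on the right costs only half of the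
total mass. The last term is O(c/β) times the mass. The primes on the left contribute (k −
1)·β·`primeConstant` against `massConstant`. A contradiction follows, for small c and β near ϑ₀/2,
as soon as `massConstant` < ϑ₀·(k − 1)·`primeConstant`; a suitable b is exhibited for each table
entry in `eventually_levelTable`.

In the diagonal variables of the Selberg form the weights have the linear profile y = 1 + b·x, with
x = log(R/n)/log R. The two constants are therefore ∫₀¹ (1 + bx)² (1 − x)^(k−1)/(k−1)! dx and ∫₀¹ (x
+ bx²/2)² (1 − x)^(k−2)/(k−2)! dx, the inner function of the second being the primitive of the
profile.

Only one-sided estimates are needed: `selbergForm_natural_le` for the mass, `le_selbergForm_prime`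
for the primes, and `selbergForm_update_le` when a prime q is forced to divide one component. They
come from `selberg_diagonalisation` and `sum_supersets_weights`, together with elementary sums over
sets of primes obtained by induction on the dimension. Presieving by the primes up to a large fixed
D replaces a singular series by a factor exp(2k/D)^k, which is as close to 1 as desired.

Uniformity holds because c is fixed from the table alone, while D and N are chosen after the tuple.
Roughness bounds Ω by a constant, and a pigeonhole over the finitely many odd b gives (a). For (b),
when two components are prime, one of them takes the role of `n + h j` with b = 1. -/

section sieve

open Finset

/-! ### Sums over sets of primes: convolution and monotonicity. -/

/-- The product of the elements of a finite set of natural numbers. -/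
def primeProd (S : Finset ℕ) : ℕ := ∏ p ∈ S, p

theorem primeProd_pos {S : Finset ℕ} (hS : ∀ p ∈ S, 1 ≤ p) : 1 ≤ primeProd S :=
  Finset.one_le_prod' hS

theorem primeProd_insert {S : Finset ℕ} {p : ℕ} (hp : p ∉ S) :
    primeProd (insert p S) = p * primeProd S := by
  simp [primeProd, Finset.prod_insert hp]

theorem primeProd_union {S T : Finset ℕ} (h : Disjoint S T) :
    primeProd (S ∪ T) = primeProd S * primeProd T := by
  simp [primeProd, Finset.prod_union h]

theorem primeProd_le_of_subset {S T : Finset ℕ} (h : S ⊆ T) (hT : ∀ p ∈ T, 1 ≤ p) :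
    primeProd S ≤ primeProd T :=
  Finset.prod_le_prod_of_subset_of_one_le' h (fun p hp _ => hT p hp)

theorem primeProd_union_le {S T : Finset ℕ} (hS : ∀ p ∈ S, 1 ≤ p) :
    primeProd (S ∪ T) ≤ primeProd S * primeProd T := by
  rw [← Finset.sdiff_union_self_eq_union, primeProd_union Finset.sdiff_disjoint]
  exact Nat.mul_le_mul_right _ (primeProd_le_of_subset Finset.sdiff_subset hS)

/-- Double sums over pairs of subsets of a function of the union. -/
theorem sum_sum_union (P : Finset ℕ) (g₁ g₂ : ℕ → ℝ) (G : Finset ℕ → ℝ) :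
    ∑ U ∈ P.powerset, ∑ V ∈ P.powerset, (∏ p ∈ U, g₁ p) * (∏ p ∈ V, g₂ p) * G (U ∪ V) =
      ∑ S ∈ P.powerset, (∏ p ∈ S, (g₁ p + g₂ p + g₁ p * g₂ p)) * G S := by
  induction P using Finset.induction_on generalizing G with
  | empty => simp
  | insert p P hp ih =>
    have hn : ∀ U ∈ P.powerset, p ∉ U := fun U hU h => hp (Finset.mem_powerset.1 hU h)
    simp only [Finset.sum_powerset_insert hp]
    rw [← Finset.sum_add_distrib, ← Finset.sum_add_distrib]
    have h1 := ih G
    have h2 := ih (fun S => G (insert p S))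
    have hR : ∑ S ∈ P.powerset, ((∏ q ∈ S, (g₁ q + g₂ q + g₁ q * g₂ q)) * G S +
        (∏ q ∈ insert p S, (g₁ q + g₂ q + g₁ q * g₂ q)) * G (insert p S)) =
        ∑ S ∈ P.powerset, ((∏ q ∈ S, (g₁ q + g₂ q + g₁ q * g₂ q)) * G S) +
        (g₁ p + g₂ p + g₁ p * g₂ p) *
          ∑ S ∈ P.powerset, ((∏ q ∈ S, (g₁ q + g₂ q + g₁ q * g₂ q)) * G (insert p S)) := by
      rw [Finset.sum_add_distrib, Finset.mul_sum]
      congr 1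
      refine Finset.sum_congr rfl fun S hS => ?_
      rw [Finset.prod_insert (hn S hS)]; ring
    rw [hR, ← h1, ← h2, Finset.mul_sum, ← Finset.sum_add_distrib]
    refine Finset.sum_congr rfl fun U hU => ?_
    rw [Finset.mul_sum, ← Finset.sum_add_distrib, ← Finset.sum_add_distrib,
      ← Finset.sum_add_distrib, ← Finset.sum_add_distrib]
    refine Finset.sum_congr rfl fun V hV => ?_
    rw [Finset.prod_insert (hn U hU), Finset.prod_insert (hn V hV), Finset.insert_union,
      Finset.insert_union, Finset.union_insert, Finset.insert_idem]
    ring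

/-- Dropping a coprimality condition: upper bound for a sum over squarefree numbers by a
double sum. -/
theorem sum_prod_add_le (P : Finset ℕ) (g₁ g₂ : ℕ → ℝ) (h₁ : ∀ p ∈ P, 0 ≤ g₁ p)
    (h₂ : ∀ p ∈ P, 0 ≤ g₂ p) (F : ℕ → ℝ) (hF : ∀ n, 0 ≤ F n) :
    ∑ S ∈ P.powerset, (∏ p ∈ S, (g₁ p + g₂ p)) * F (primeProd S) ≤
      ∑ U ∈ P.powerset, ∑ V ∈ P.powerset,
        (∏ p ∈ U, g₁ p) * (∏ p ∈ V, g₂ p) * F (primeProd U * primeProd V) := by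
  induction P using Finset.induction_on generalizing F with
  | empty => simp [primeProd]
  | insert p P hp ih =>
    have hn : ∀ U ∈ P.powerset, p ∉ U := fun U hU h => hp (Finset.mem_powerset.1 hU h)
    have h₁' : ∀ q ∈ P, 0 ≤ g₁ q := fun q hq => h₁ q (Finset.mem_insert_of_mem hq)
    have h₂' : ∀ q ∈ P, 0 ≤ g₂ q := fun q hq => h₂ q (Finset.mem_insert_of_mem hq)
    have hp1 := h₁ p (Finset.mem_insert_self _ _)
    have hp2 := h₂ p (Finset.mem_insert_self _ _)
    simp only [Finset.sum_powerset_insert hp]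
    have i1 := ih h₁' h₂' F hF
    have i2 := mul_le_mul_of_nonneg_left (ih h₁' h₂' (fun n => F (p * n)) (fun n => hF _))
      (add_nonneg hp1 hp2)
    have hL : ∑ S ∈ P.powerset, (∏ q ∈ insert p S, (g₁ q + g₂ q)) * F (primeProd (insert p S)) =
        (g₁ p + g₂ p) * ∑ S ∈ P.powerset, (∏ q ∈ S, (g₁ q + g₂ q)) * F (p * primeProd S) := by
      rw [Finset.mul_sum]
      refine Finset.sum_congr rfl fun S hS => ?_
      rw [Finset.prod_insert (hn S hS), primeProd_insert (hn S hS)]; ring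
    rw [hL]
    refine (add_le_add i1 i2).trans ?_
    rw [Finset.mul_sum, ← Finset.sum_add_distrib, ← Finset.sum_add_distrib]
    refine Finset.sum_le_sum fun U hU => ?_
    rw [Finset.mul_sum, ← Finset.sum_add_distrib, ← Finset.sum_add_distrib,
      ← Finset.sum_add_distrib, ← Finset.sum_add_distrib]
    refine Finset.sum_le_sum fun V hV => ?_
    rw [Finset.prod_insert (hn U hU), Finset.prod_insert (hn V hV), primeProd_insert (hn U hU),
      primeProd_insert (hn V hV)]
    have e1 : p * primeProd U * primeProd V = p * (primeProd U * primeProd V) := by ring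
    have e2 : primeProd U * (p * primeProd V) = p * (primeProd U * primeProd V) := by ring
    rw [e1, e2]
    have hU0 : 0 ≤ ∏ q ∈ U, g₁ q := Finset.prod_nonneg fun q hq => h₁' q (Finset.mem_powerset.1 hU hq)
    have hV0 : 0 ≤ ∏ q ∈ V, g₂ q := Finset.prod_nonneg fun q hq => h₂' q (Finset.mem_powerset.1 hV hq)
    have := mul_nonneg (mul_nonneg (mul_nonneg hp1 hU0) (mul_nonneg hp2 hV0))
      (hF (p * primeProd U * (p * primeProd V)))
    linarith

/-- Lower bound for a sum over squarefree numbers by a double sum, for decreasing functions. -/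
theorem sum_sum_le_sum_prod (P : Finset ℕ) (hP : ∀ p ∈ P, 1 ≤ p) (g₁ g₂ : ℕ → ℝ)
    (h₁ : ∀ p ∈ P, 0 ≤ g₁ p) (h₂ : ∀ p ∈ P, 0 ≤ g₂ p) (F : ℕ → ℝ)
    (hF : ∀ m n, 1 ≤ m → m ≤ n → F n ≤ F m) :
    ∑ U ∈ P.powerset, ∑ V ∈ P.powerset,
        (∏ p ∈ U, g₁ p) * (∏ p ∈ V, g₂ p) * F (primeProd U * primeProd V) ≤
      ∑ S ∈ P.powerset, (∏ p ∈ S, (g₁ p + g₂ p + g₁ p * g₂ p)) * F (primeProd S) := by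
  rw [← sum_sum_union]
  refine Finset.sum_le_sum fun U hU => Finset.sum_le_sum fun V hV => ?_
  rw [Finset.mem_powerset] at hU hV
  have hU0 : 0 ≤ ∏ q ∈ U, g₁ q := Finset.prod_nonneg fun q hq => h₁ q (hU hq)
  have hV0 : 0 ≤ ∏ q ∈ V, g₂ q := Finset.prod_nonneg fun q hq => h₂ q (hV hq)
  have hU1 : ∀ q ∈ U, 1 ≤ q := fun q hq => hP q (hU hq)
  have hV1 : ∀ q ∈ V, 1 ≤ q := fun q hq => hP q (hV hq)
  refine mul_le_mul_of_nonneg_left (hF _ _ (primeProd_pos ?_) (primeProd_union_le hU1))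
    (mul_nonneg hU0 hV0)
  intro q hq
  rcases Finset.mem_union.1 hq with h | h
  exacts [hU1 q h, hV1 q h]

theorem sum_supersets {P S : Finset ℕ} (h : S ⊆ P) (f : Finset ℕ → ℝ) :
    ∑ T ∈ P.powerset with S ⊆ T, f T = ∑ V ∈ (P \ S).powerset, f (S ∪ V) := by
  have : P.powerset.filter (S ⊆ ·) = (P \ S).powerset.image (S ∪ ·) := by
    rw [← Finset.Icc_eq_image_powerset h]; ext T; simp [and_comm]
  rw [this, Finset.sum_image]
  intro U hU V hV hUV
  simp only [Finset.coe_powerset, Set.mem_preimage, Set.mem_powerset_iff, Finset.coe_subset] at hU hV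
  have dU : Disjoint S U := (Finset.disjoint_sdiff).mono_right hU
  have dV : Disjoint S V := (Finset.disjoint_sdiff).mono_right hV
  have : (S ∪ U) \ S = (S ∪ V) \ S := by rw [show S ∪ U = S ∪ V from hUV]
  rwa [Finset.union_sdiff_cancel_left dU, Finset.union_sdiff_cancel_left dV] at this

theorem sum_powerset_split {P D : Finset ℕ} (h : D ⊆ P) (g : ℕ → ℝ) (F : Finset ℕ → ℝ) :
    ∑ S ∈ P.powerset, (∏ p ∈ S, g p) * F S =
      ∑ U ∈ D.powerset, ∑ V ∈ (P \ D).powerset, (∏ p ∈ U, g p) * (∏ p ∈ V, g p) * F (U ∪ V) := by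
  rw [← Finset.sum_product']
  refine Finset.sum_nbij' (fun S => (S ∩ D, S \ D)) (fun x => x.1 ∪ x.2) ?_ ?_ ?_ ?_ ?_
  · intro S hS
    simp only [Finset.mem_product, Finset.mem_powerset] at hS ⊢
    exact ⟨Finset.inter_subset_right, Finset.sdiff_subset_sdiff hS le_rfl⟩
  · rintro ⟨U, V⟩ hx
    simp only [Finset.mem_product, Finset.mem_powerset] at hx ⊢
    exact Finset.union_subset (hx.1.trans h) (hx.2.trans Finset.sdiff_subset)
  · intro S _
    ext a; simp; tauto
  · rintro ⟨U, V⟩ hx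
    simp only [Finset.mem_product, Finset.mem_powerset] at hx
    have hd : ∀ a ∈ V, a ∉ D := fun a ha => (Finset.mem_sdiff.1 (hx.2 ha)).2
    ext a
    · simp only [Finset.mem_inter, Finset.mem_union]
      constructor
      · rintro ⟨h1 | h1, h2⟩
        · exact h1
        · exact absurd h2 (hd a h1)
      · exact fun h1 => ⟨Or.inl h1, hx.1 h1⟩
    · simp only [Finset.mem_sdiff, Finset.mem_union]
      constructor
      · rintro ⟨h1 | h1, h2⟩
        · exact absurd (hx.1 h1) h2
        · exact h1
      · exact fun h1 => ⟨Or.inr h1, hd a h1⟩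
  · intro S _
    have e : S ∩ D ∪ S \ D = S := by ext a; simp; tauto
    dsimp only
    rw [e, ← Finset.prod_union, e]
    exact (Finset.disjoint_sdiff).mono_left Finset.inter_subset_right

/-- Split each set into its part U inside `D` and its part V outside. As `F` decreases, replacing U
by all of `D` in its argument only lowers the value, and the sum over U becomes the product. This
yields a bound for the Selberg weights uniform in the index. -/
theorem prod_one_add_mul_sum_le {P D : Finset ℕ} (hD : D ⊆ P) (hP : ∀ p ∈ P, 1 ≤ p) (g : ℕ → ℝ)
    (hg : ∀ p ∈ P, 0 ≤ g p) (F : ℕ → ℝ) (hF : ∀ m n, 1 ≤ m → m ≤ n → F n ≤ F m) :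
    (∏ p ∈ D, (1 + g p)) * ∑ V ∈ (P \ D).powerset, (∏ p ∈ V, g p) * F (primeProd D * primeProd V) ≤
      ∑ S ∈ P.powerset, (∏ p ∈ S, g p) * F (primeProd S) := by
  rw [sum_powerset_split hD, Finset.prod_one_add, Finset.sum_mul]
  refine Finset.sum_le_sum fun U hU => ?_
  rw [Finset.mul_sum]
  refine Finset.sum_le_sum fun V hV => ?_
  rw [Finset.mem_powerset] at hU hV
  have hV' := hV.trans Finset.sdiff_subset
  have hU0 : 0 ≤ ∏ q ∈ U, g q := Finset.prod_nonneg fun q hq => hg q (hD (hU hq))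
  have hV0 : 0 ≤ ∏ q ∈ V, g q := Finset.prod_nonneg fun q hq => hg q (hV' hq)
  rw [← mul_assoc]
  refine mul_le_mul_of_nonneg_left (hF _ _ (primeProd_pos fun q hq => ?_) ?_) (mul_nonneg hU0 hV0)
  · rcases Finset.mem_union.1 hq with h | h
    exacts [hP q (hD (hU h)), hP q (hV' h)]
  · refine (primeProd_union_le (fun q hq => hP q (hD (hU hq)))).trans ?_
    exact Nat.mul_le_mul_right _ (primeProd_le_of_subset hU (fun q hq => hP q (hD hq)))

/-- The opposite move: here the part U inside `D` is deleted from the argument of the decreasing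
`F`. It removes the small primes from a sum, and it lifts a coprimality condition in the prime form.
-/
theorem sum_le_prod_one_add_mul_sum {P D : Finset ℕ} (hD : D ⊆ P) (hP : ∀ p ∈ P, 1 ≤ p) (g : ℕ → ℝ)
    (hg : ∀ p ∈ P, 0 ≤ g p) (F : ℕ → ℝ) (hF : ∀ m n, 1 ≤ m → m ≤ n → F n ≤ F m) :
    ∑ S ∈ P.powerset, (∏ p ∈ S, g p) * F (primeProd S) ≤
      (∏ p ∈ D, (1 + g p)) * ∑ V ∈ (P \ D).powerset, (∏ p ∈ V, g p) * F (primeProd V) := by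
  rw [sum_powerset_split hD, Finset.prod_one_add, Finset.sum_mul]
  refine Finset.sum_le_sum fun U hU => ?_
  rw [Finset.mul_sum]
  refine Finset.sum_le_sum fun V hV => ?_
  rw [Finset.mem_powerset] at hU hV
  have hV' := hV.trans Finset.sdiff_subset
  have hU0 : 0 ≤ ∏ q ∈ U, g q := Finset.prod_nonneg fun q hq => hg q (hD (hU hq))
  have hV0 : 0 ≤ ∏ q ∈ V, g q := Finset.prod_nonneg fun q hq => hg q (hV' hq)
  rw [← mul_assoc]
  refine mul_le_mul_of_nonneg_left (hF _ _ (primeProd_pos fun q hq => hP q (hV' hq)) ?_)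
    (mul_nonneg hU0 hV0)
  refine primeProd_le_of_subset Finset.subset_union_right fun q hq => ?_
  rcases Finset.mem_union.1 hq with h | h
  exacts [hP q (hD (hU h)), hP q (hV' h)]

/-! ### Diagonalisation of the quadratic form. -/

/-- Diagonalisation of the Selberg quadratic form. -/
theorem selberg_diagonalisation (P : Finset ℕ) (γ : ℕ → ℝ) (hγ : ∀ p ∈ P, γ p ≠ 0)
    (l : Finset ℕ → ℝ) :
    ∑ D ∈ P.powerset, ∑ E ∈ P.powerset, l D * l E * ∏ p ∈ D ∪ E, γ p =
      ∑ S ∈ P.powerset, (∏ p ∈ S, ((γ p)⁻¹ - 1)) *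
        (∑ D ∈ P.powerset with S ⊆ D, l D * ∏ p ∈ D, γ p) ^ 2 := by
  have key : ∀ D ∈ P.powerset, ∀ E ∈ P.powerset, ∏ p ∈ D ∪ E, γ p =
      ∑ S ∈ P.powerset, (if S ⊆ D then (if S ⊆ E then
        (∏ p ∈ S, ((γ p)⁻¹ - 1)) * ((∏ p ∈ D, γ p) * ∏ p ∈ E, γ p) else 0) else 0) := by
    intro D hD E hE
    rw [Finset.mem_powerset] at hD hE
    -- The density of a union is the product of the two densities divided by that of the
    -- intersection. Writing 1/γ = 1 + (1/γ − 1) expands this divisor over common subsets S, which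
    -- separates `D` from `E`.
    have h1 : (∏ p ∈ D ∩ E, (γ p)⁻¹) = ∑ S ∈ (D ∩ E).powerset, ∏ p ∈ S, ((γ p)⁻¹ - 1) := by
      rw [← Finset.prod_one_add]; exact Finset.prod_congr rfl fun p _ => by ring
    have h2 := Finset.prod_union_inter (s₁ := D) (s₂ := E) (f := γ)
    have h3 : (∏ p ∈ D ∩ E, (γ p)⁻¹) * ∏ p ∈ D ∩ E, γ p = 1 := by
      rw [← Finset.prod_mul_distrib]
      exact Finset.prod_eq_one fun p hp =>
        inv_mul_cancel₀ (hγ p (hD (Finset.mem_inter.1 hp).1))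
    have h4 : ∏ p ∈ D ∪ E, γ p = (∏ p ∈ D ∩ E, (γ p)⁻¹) * ((∏ p ∈ D, γ p) * ∏ p ∈ E, γ p) := by
      rw [← h2, mul_comm (∏ p ∈ D ∪ E, γ p), ← mul_assoc, h3, one_mul]
    rw [h4, h1, Finset.sum_mul]
    have h5 : (D ∩ E).powerset = P.powerset.filter (fun S => S ⊆ D ∧ S ⊆ E) := by
      ext S
      simp only [Finset.mem_powerset, Finset.mem_filter, Finset.subset_inter_iff]
      exact ⟨fun h => ⟨h.1.trans hD, h⟩, fun h => h.2⟩
    rw [h5, Finset.sum_filter]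
    refine Finset.sum_congr rfl fun S _ => ?_
    by_cases a : S ⊆ D <;> by_cases b : S ⊆ E <;> simp [a, b]
  have h6 : ∀ D ∈ P.powerset, ∑ E ∈ P.powerset, l D * l E * ∏ p ∈ D ∪ E, γ p =
      ∑ S ∈ P.powerset, ∑ E ∈ P.powerset, l D * l E * (if S ⊆ D then (if S ⊆ E then
        (∏ p ∈ S, ((γ p)⁻¹ - 1)) * ((∏ p ∈ D, γ p) * ∏ p ∈ E, γ p) else 0) else 0) := by
    intro D hD
    rw [Finset.sum_comm]
    refine Finset.sum_congr rfl fun E hE => ?_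
    rw [key D hD E hE, Finset.mul_sum]
  rw [Finset.sum_congr rfl h6, Finset.sum_comm]
  refine Finset.sum_congr rfl fun S _ => ?_
  rw [sq, Finset.sum_mul_sum, Finset.mul_sum, Finset.sum_filter]
  refine Finset.sum_congr rfl fun D _ => ?_
  split_ifs with a
  · rw [Finset.mul_sum, Finset.sum_filter]
    refine Finset.sum_congr rfl fun E _ => ?_
    split_ifs with b
    · ring
    · simp
  · simp

/-- Exchange the sums: for fixed T the sets D between S and T form a Boolean interval, and the
binomial expansion produces the factors 1 − aγ. If aγ = 1 only T = S survives, so weights built from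
`t` have diagonal variables `t` themselves, up to local factors. For other densities the factors
measure the deviation. -/
theorem sum_supersets_weights (P : Finset ℕ) (a γ : ℕ → ℝ) (t : Finset ℕ → ℝ) {S : Finset ℕ} :
    ∑ D ∈ P.powerset with S ⊆ D,
        ((∏ p ∈ D, (- a p)) * ∑ T ∈ P.powerset with D ⊆ T, t T) * ∏ p ∈ D, γ p =
      (∏ p ∈ S, (- (a p * γ p))) *
        ∑ T ∈ P.powerset with S ⊆ T, t T * ∏ p ∈ T \ S, (1 - a p * γ p) := by
  have h1 : ∀ T ∈ P.powerset.filter (S ⊆ ·),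
      (∏ p ∈ S, (- (a p * γ p))) * (t T * ∏ p ∈ T \ S, (1 - a p * γ p)) =
      ∑ D ∈ P.powerset, if S ⊆ D ∧ D ⊆ T then t T * ∏ p ∈ D, (-(a p * γ p)) else 0 := by
    intro T hT
    rw [Finset.mem_filter, Finset.mem_powerset] at hT
    have h2 : P.powerset.filter (fun D => S ⊆ D ∧ D ⊆ T) = T.powerset.filter (S ⊆ ·) := by
      ext D
      simp only [Finset.mem_powerset, Finset.mem_filter]
      exact ⟨fun h => ⟨h.2.2, h.2.1⟩, fun h => ⟨h.1.trans hT.1, h.2, h.1⟩⟩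
    rw [← Finset.sum_filter, h2, sum_supersets hT.2]
    have h3 : ∏ p ∈ T \ S, (1 - a p * γ p) = ∑ V ∈ (T \ S).powerset, ∏ p ∈ V, (-(a p * γ p)) := by
      rw [← Finset.prod_one_add]; exact Finset.prod_congr rfl fun p _ => by ring
    rw [h3, Finset.mul_sum, Finset.mul_sum]
    refine Finset.sum_congr rfl fun V hV => ?_
    rw [Finset.prod_union ((Finset.disjoint_sdiff).mono_right (Finset.mem_powerset.1 hV))]
    ring
  rw [Finset.mul_sum, Finset.sum_congr rfl h1, Finset.sum_comm, Finset.sum_filter]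
  refine Finset.sum_congr rfl fun D _ => ?_
  split_ifs with hSD
  · rw [Finset.mul_sum, Finset.sum_mul, Finset.sum_filter, Finset.sum_filter]
    refine Finset.sum_congr rfl fun T _ => ?_
    by_cases hDT : D ⊆ T
    · have e : ∏ p ∈ D, (-(a p * γ p)) = (∏ p ∈ D, (-a p)) * ∏ p ∈ D, γ p := by
        rw [← Finset.prod_mul_distrib]; exact Finset.prod_congr rfl fun p _ => by ring
      simp only [hDT, hSD, hSD.trans hDT, if_true, and_self, e]
      ring
    · simp [hDT]
  · simp [hSD]

/-! ### Partial summation and logarithmic growth. -/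

/-- Abel summation against the powers of a logarithm. -/
theorem abel_sum_log_pow_le {ι : Type*} (s : Finset ι) (g : ι → ℝ) (a : ι → ℕ)
    (ha : ∀ i ∈ s, 1 ≤ a i) (κ C C₁ Y : ℝ) (hC₁ : 0 ≤ C₁) (hY : 1 ≤ Y) (j : ℕ)
    (hA : ∀ t, 1 ≤ t → t ≤ Y → ∑ i ∈ s with (a i : ℝ) ≤ t, g i ≤ κ * (Real.log t + C)) :
    ∑ i ∈ s with (a i : ℝ) ≤ Y, g i * (Real.log (Y / a i) + C₁) ^ j ≤
      κ * (((Real.log Y + C₁) ^ (j + 1) - C₁ ^ (j + 1)) / (j + 1)) +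
        κ * C * (Real.log Y + C₁) ^ j := by
  classical
  set c : ℕ → ℝ := fun n => ∑ i ∈ s with a i = n, g i with hc
  set f : ℝ → ℝ := fun t => (Real.log Y - Real.log t + C₁) ^ j with hf
  have c0 : c 0 = 0 := by
    refine Finset.sum_eq_zero fun i hi => ?_
    rw [Finset.mem_filter] at hi
    have := ha i hi.1; omega
  have hsum : ∀ (F : ℕ → ℝ) (t : ℝ), 0 ≤ t →
      ∑ n ∈ Icc 0 ⌊t⌋₊, F n * c n = ∑ i ∈ s with (a i : ℝ) ≤ t, g i * F (a i) := by
    intro F t ht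
    have hmaps : ∀ i ∈ s.filter (fun i => (a i : ℝ) ≤ t), a i ∈ Icc 0 ⌊t⌋₊ := by
      intro i hi
      rw [Finset.mem_filter] at hi
      exact Finset.mem_Icc.2 ⟨Nat.zero_le _, Nat.le_floor hi.2⟩
    rw [← Finset.sum_fiberwise_of_maps_to hmaps]
    refine Finset.sum_congr rfl fun n hn => ?_
    rw [hc, Finset.mul_sum]
    have : (s.filter (fun i => (a i : ℝ) ≤ t)).filter (fun i => a i = n) =
        s.filter (fun i => a i = n) := by
      ext i
      simp only [Finset.mem_filter]
      refine ⟨fun h => ⟨h.1.1, h.2⟩, fun h => ⟨⟨h.1, ?_⟩, h.2⟩⟩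
      rw [h.2]
      exact (Nat.le_floor_iff ht).1 (Finset.mem_Icc.1 hn).2
    rw [this]
    refine Finset.sum_congr rfl fun i hi => ?_
    rw [(Finset.mem_filter.1 hi).2]; ring
  have hsum1 : ∀ t, 0 ≤ t → ∑ n ∈ Icc 0 ⌊t⌋₊, c n = ∑ i ∈ s with (a i : ℝ) ≤ t, g i := by
    intro t ht
    have := hsum (fun _ => 1) t ht
    simpa using this
  have hder : ∀ t, 1 ≤ t → HasDerivAt f
      ((j : ℝ) * (Real.log Y - Real.log t + C₁) ^ (j - 1) * (-t⁻¹)) t := by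
    intro t ht
    have h1 : HasDerivAt (fun t => Real.log Y - Real.log t + C₁) (-t⁻¹) t := by
      have := ((Real.hasDerivAt_log (by positivity : t ≠ 0)).const_sub (Real.log Y)).add_const C₁
      simpa using this
    exact h1.pow j
  have hderiv : ∀ t ∈ Set.Icc (1 : ℝ) Y, deriv f t =
      (j : ℝ) * (Real.log Y - Real.log t + C₁) ^ (j - 1) * (-t⁻¹) := fun t ht => (hder t ht.1).deriv
  have hcl : ContinuousOn Real.log (Set.Icc 1 Y) :=
    Real.continuousOn_log.mono fun t ht => by
      have := ht.1; simp; linarith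
  have hcont : ContinuousOn (fun t => (j : ℝ) * (Real.log Y - Real.log t + C₁) ^ (j - 1) * (-t⁻¹))
      (Set.Icc 1 Y) := by
    have hci : ContinuousOn (fun t : ℝ => t⁻¹) (Set.Icc 1 Y) :=
      continuousOn_inv₀.mono fun t ht => by have := ht.1; simp; linarith
    fun_prop
  have hint : MeasureTheory.IntegrableOn (deriv f) (Set.Icc 1 Y) := by
    refine (hcont.integrableOn_compact isCompact_Icc).congr_fun (fun t ht => (hderiv t ht).symm)
      measurableSet_Icc
  have habel := sum_mul_eq_sub_integral_mul₀ (f := f) c c0 Y (fun t ht => (hder t ht.1).differentiableAt) hint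
  have hY0 : (0 : ℝ) ≤ Y := by linarith
  rw [hsum (fun n => f n) Y hY0, hsum1 Y hY0] at habel
  have hlhs : ∑ i ∈ s with (a i : ℝ) ≤ Y, g i * (Real.log (Y / a i) + C₁) ^ j =
      ∑ i ∈ s with (a i : ℝ) ≤ Y, g i * f (a i) := by
    refine Finset.sum_congr rfl fun i hi => ?_
    have h1 := ha i (Finset.mem_filter.1 hi).1
    rw [hf, Real.log_div (by positivity) (by positivity)]
  rw [hlhs, habel]
  have hint2 : MeasureTheory.IntegrableOn
      (fun t => deriv f t * ∑ k ∈ Icc 0 ⌊t⌋₊, c k) (Set.Ioc 1 Y) :=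
    (integrableOn_mul_sum_Icc c (m := 0) zero_le_one hint).mono_set Set.Ioc_subset_Icc_self
  set G : ℝ → ℝ := fun t => ((j : ℝ) * (Real.log Y - Real.log t + C₁) ^ (j - 1) * (-t⁻¹)) *
    (κ * (Real.log t + C)) with hG
  have hGc : ContinuousOn G (Set.Icc 1 Y) := by
    refine hcont.mul ?_
    fun_prop
  -- The weight function decreases, so its derivative is nonpositive and the upper bound for the
  -- partial sums becomes a lower bound for the integral that Abel summation subtracts. No sign of
  -- `κ` is used.
  have hle : ∫ t in Set.Ioc 1 Y, G t ≤ ∫ t in Set.Ioc 1 Y, deriv f t * ∑ k ∈ Icc 0 ⌊t⌋₊, c k := by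
    refine MeasureTheory.setIntegral_mono_on
      ((hGc.integrableOn_compact isCompact_Icc).mono_set Set.Ioc_subset_Icc_self) hint2
      measurableSet_Ioc fun t ht => ?_
    have ht' := Set.Ioc_subset_Icc_self ht
    rw [hderiv t ht', hsum1 t (by linarith [ht.1])]
    refine mul_le_mul_of_nonpos_left (hA t ht'.1 ht'.2) ?_
    have h1 : Real.log t ≤ Real.log Y := Real.log_le_log (by linarith [ht.1]) ht.2
    have h2 : 0 ≤ (j : ℝ) * (Real.log Y - Real.log t + C₁) ^ (j - 1) := by
      have : 0 ≤ Real.log Y - Real.log t + C₁ := by linarith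
      positivity
    have h3 : 0 < t⁻¹ := by have := ht.1; positivity
    nlinarith
  have hGint : ∫ t in Set.Ioc 1 Y, G t =
      (C₁ ^ j * (κ * (Real.log Y + C)) + κ * C₁ ^ (j + 1) / (j + 1)) -
      ((Real.log Y + C₁) ^ j * (κ * C) + κ * (Real.log Y + C₁) ^ (j + 1) / (j + 1)) := by
    rw [← intervalIntegral.integral_of_le hY]
    -- The primitive of the majorised integrand is found by parts; its second summand integrates `κ
    -- * t⁻¹` against the power of the logarithm.
    have hH : ∀ t ∈ Set.uIcc 1 Y, HasDerivAt (fun t => f t * (κ * (Real.log t + C)) +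
        κ * (Real.log Y - Real.log t + C₁) ^ (j + 1) / (j + 1)) (G t) t := by
      intro t ht
      rw [Set.uIcc_of_le hY] at ht
      have h0 : t ≠ 0 := by have := ht.1; positivity
      have h1 : HasDerivAt (fun t => Real.log Y - Real.log t + C₁) (-t⁻¹) t := by
        have := ((Real.hasDerivAt_log h0).const_sub (Real.log Y)).add_const C₁
        simpa using this
      have h2 : HasDerivAt (fun t => κ * (Real.log t + C)) (κ * t⁻¹) t :=
        ((Real.hasDerivAt_log h0).add_const C).const_mul κ
      have h3 := ((h1.pow (j + 1)).const_mul κ).div_const ((j : ℝ) + 1)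
      have h4 := ((hder t ht.1).mul h2).add h3
      refine h4.congr_deriv ?_
      have h5 : (j : ℝ) + 1 ≠ 0 := by positivity
      simp only [hG, hf]
      push_cast
      field_simp
      ring
    rw [intervalIntegral.integral_eq_sub_of_hasDerivAt hH
      (by apply ContinuousOn.intervalIntegrable; rwa [Set.uIcc_of_le hY])]
    simp [hf]
  have hfY : f Y = C₁ ^ j := by simp [hf]
  have hAY := mul_le_mul_of_nonneg_left (hA Y hY le_rfl) (pow_nonneg hC₁ j)
  rw [hfY]
  have : κ * (((Real.log Y + C₁) ^ (j + 1) - C₁ ^ (j + 1)) / (j + 1)) =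
    κ * (Real.log Y + C₁) ^ (j + 1) / (j + 1) - κ * C₁ ^ (j + 1) / (j + 1) := by ring
  rw [this]
  linarith

/-- Division by p sends the integers with prime set V ∪ {p} injectively to integers whose prime set
is V ∪ {p} or V. Hence A ≤ (A + B)/p for the two sums, that is A ≤ B/(p − 1), without any infinite
geometric series. -/
theorem sum_inv_primeFactors_eq_le (V : Finset ℕ) (hV : ∀ p ∈ V, p.Prime) (N : ℕ) :
    ∑ n ∈ Icc 1 N with n.primeFactors = V, (1 : ℝ) / n ≤ ∏ p ∈ V, (1 : ℝ) / (p - 1) := by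
  induction V using Finset.induction_on with
  | empty =>
    have : (Icc 1 N).filter (fun n => n.primeFactors = ∅) ⊆ {1} := by
      intro n hn
      rw [Finset.mem_filter, Finset.mem_Icc, Nat.primeFactors_eq_empty] at hn
      simp; omega
    refine (Finset.sum_le_sum_of_subset_of_nonneg this fun _ _ _ => by positivity).trans ?_
    simp
  | insert p V hp ih =>
    have hpp := hV p (Finset.mem_insert_self _ _)
    have ih := ih fun q hq => hV q (Finset.mem_insert_of_mem hq)
    rw [Finset.prod_insert hp]
    set A := ∑ n ∈ Icc 1 N with n.primeFactors = insert p V, (1 : ℝ) / n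
    set B := ∑ n ∈ Icc 1 N with n.primeFactors = V, (1 : ℝ) / n
    have hp1 : (1 : ℝ) < p := by exact_mod_cast hpp.one_lt
    have hB0 : 0 ≤ B := Finset.sum_nonneg fun _ _ => by positivity
    have hmain : A ≤ (1 / p) * (A + B) := by
      have hdisj : Disjoint ((Icc 1 N).filter (fun n => n.primeFactors = insert p V))
          ((Icc 1 N).filter (fun n => n.primeFactors = V)) := by
        rw [Finset.disjoint_filter]
        intro n _ h1 h2
        exact hp (by rw [← h2, h1]; exact Finset.mem_insert_self _ _)
      rw [← Finset.sum_union hdisj, Finset.mul_sum]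
      have hdvd : ∀ n ∈ (Icc 1 N).filter (fun n => n.primeFactors = insert p V), p ∣ n := by
        intro n hn
        have : p ∈ n.primeFactors := by
          rw [(Finset.mem_filter.1 hn).2]; exact Finset.mem_insert_self _ _
        exact Nat.dvd_of_mem_primeFactors this
      have hinj : Set.InjOn (fun n => n / p)
          ((Icc 1 N).filter (fun n => n.primeFactors = insert p V) : Set ℕ) := by
        intro m hm n hn h
        have h1 := Nat.div_mul_cancel (hdvd m hm)
        have h2 := Nat.div_mul_cancel (hdvd n hn)
        simp only at h
        rw [← h1, ← h2, h]
      have : A = ∑ m ∈ ((Icc 1 N).filter (fun n => n.primeFactors = insert p V)).image (· / p),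
          1 / (p : ℝ) * (1 / m) := by
        rw [Finset.sum_image hinj]
        refine Finset.sum_congr rfl fun n hn => ?_
        obtain ⟨m, rfl⟩ := hdvd n hn
        rw [Nat.mul_div_cancel_left m hpp.pos]
        push_cast
        rw [one_div_mul_one_div]
      rw [this]
      refine Finset.sum_le_sum_of_subset_of_nonneg ?_ fun _ _ _ => by positivity
      intro m hm
      obtain ⟨n, hn, rfl⟩ := Finset.mem_image.1 hm
      have hd := hdvd n hn
      obtain ⟨m, rfl⟩ := hd
      rw [Finset.mem_filter, Finset.mem_Icc] at hn
      rw [Nat.mul_div_cancel_left m hpp.pos]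
      have hm0 : m ≠ 0 := by rintro rfl; omega
      have hmN : m ∈ Icc 1 N := by
        rw [Finset.mem_Icc]
        exact ⟨Nat.one_le_iff_ne_zero.2 hm0, (Nat.le_mul_of_pos_left m hpp.pos).trans hn.1.2⟩
      have hpf := hn.2
      rw [Nat.primeFactors_mul hpp.ne_zero hm0, hpp.primeFactors] at hpf
      rw [Finset.mem_union, Finset.mem_filter, Finset.mem_filter]
      by_cases hpm : p ∈ m.primeFactors
      · left
        refine ⟨hmN, ?_⟩
        rw [← hpf, Finset.union_eq_right.2 (Finset.singleton_subset_iff.2 hpm)]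
      · right
        refine ⟨hmN, ?_⟩
        have := congrArg (fun s => s.erase p) hpf
        simp only [Finset.erase_insert hp] at this
        rw [← this, ← Finset.insert_eq, Finset.erase_insert hpm]
    have h1 : A * (p - 1) ≤ B := by
      have := mul_le_mul_of_nonneg_left hmain (by linarith : (0 : ℝ) ≤ p)
      rw [← mul_assoc, mul_one_div_cancel (by linarith)] at this
      linarith
    have h2 : A ≤ 1 / (p - 1) * B := by
      rw [one_div, inv_mul_eq_div, le_div_iff₀ (by linarith)]; exact h1
    exact h2.trans (mul_le_mul_of_nonneg_left ih (by
      have : (0 : ℝ) < p - 1 := by linarith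
      positivity))

theorem primeFactors_primeProd {S : Finset ℕ} (hS : ∀ p ∈ S, p.Prime) :
    (primeProd S).primeFactors = S := Nat.primeFactors_prod hS

/-- The harmonic sum up to `Y` is at least log Y; group its integers by their sets of prime factors.
-/
theorem log_le_sum_primes_subsets (R Y : ℝ) (hY : 1 ≤ Y) (hYR : Y ≤ R) :
    Real.log Y ≤ ∑ V ∈ ((Icc 1 ⌊R⌋₊).filter Nat.Prime).powerset with (primeProd V : ℝ) ≤ Y,
      ∏ p ∈ V, (1 : ℝ) / (p - 1) := by
  have h1 : Real.log Y ≤ ∑ n ∈ Icc 1 ⌊Y⌋₊, (1 : ℝ) / n := by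
    have := log_le_harmonic_floor Y (by linarith)
    rw [harmonic_eq_sum_Icc] at this
    push_cast at this
    simpa [one_div] using this
  refine h1.trans ?_
  have hmaps : ∀ n ∈ Icc 1 ⌊Y⌋₊, n.primeFactors ∈
      ((Icc 1 ⌊R⌋₊).filter Nat.Prime).powerset.filter (fun V => (primeProd V : ℝ) ≤ Y) := by
    intro n hn
    rw [Finset.mem_Icc] at hn
    have hn0 : 0 < n := hn.1
    rw [Finset.mem_filter, Finset.mem_powerset]
    constructor
    · intro p hp
      rw [Finset.mem_filter, Finset.mem_Icc]
      have hp' := Nat.prime_of_mem_primeFactors hp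
      exact ⟨⟨hp'.one_lt.le, (Nat.le_of_dvd hn0 (Nat.dvd_of_mem_primeFactors hp)).trans
        (hn.2.trans (Nat.floor_le_floor hYR))⟩, hp'⟩
    · have : primeProd n.primeFactors ≤ n := Nat.le_of_dvd hn0 (Nat.prod_primeFactors_dvd n)
      exact (Nat.cast_le.2 (this.trans hn.2)).trans (Nat.floor_le (by linarith))
  rw [← Finset.sum_fiberwise_of_maps_to hmaps]
  refine Finset.sum_le_sum fun V hV => ?_
  refine sum_inv_primeFactors_eq_le V (fun p hp => ?_) _
  rw [Finset.mem_filter, Finset.mem_powerset] at hV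
  exact (Finset.mem_filter.1 (hV.1 hp)).2

/-! ### Lower bounds over primes above `D`, in every dimension. -/

/-- The primes up to `D`. -/
def smallPrimes (D : ℕ) : Finset ℕ := (Icc 1 D).filter Nat.Prime

/-- The primes in `(D, R]`. -/
noncomputable def sievePrimes (D : ℕ) (R : ℝ) : Finset ℕ := (Ioc D ⌊R⌋₊).filter Nat.Prime

/-- The density of the integers without prime factors up to `D`. -/
noncomputable def sieveDensity (D : ℕ) : ℝ := ∏ p ∈ smallPrimes D, (1 - 1 / (p : ℝ))

/-- The shifted power of the logarithm, cut off below `1`. -/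
noncomputable def logPow (C : ℝ) (j : ℕ) (Y : ℝ) : ℝ := if 1 ≤ Y then (Real.log Y + C) ^ j else 0

theorem mem_smallPrimes {D p : ℕ} : p ∈ smallPrimes D ↔ p.Prime ∧ p ≤ D := by
  rw [smallPrimes, Finset.mem_filter, Finset.mem_Icc]
  exact ⟨fun h => ⟨h.2, h.1.2⟩, fun h => ⟨⟨h.1.one_lt.le, h.2⟩, h.1⟩⟩

theorem mem_sievePrimes {D p : ℕ} {R : ℝ} : p ∈ sievePrimes D R ↔ p.Prime ∧ D < p ∧ p ≤ ⌊R⌋₊ := by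
  rw [sievePrimes, Finset.mem_filter, Finset.mem_Ioc]; tauto

theorem one_sub_one_div_prime_pos {p : ℕ} (hp : p.Prime) : (0 : ℝ) < 1 - 1 / p := by
  have : (1 : ℝ) < p := by exact_mod_cast hp.one_lt
  rw [sub_pos, div_lt_one (by linarith)]; exact this

theorem sieveDensity_pos (D : ℕ) : 0 < sieveDensity D :=
  Finset.prod_pos fun _ hp => one_sub_one_div_prime_pos (mem_smallPrimes.1 hp).1

theorem logPow_nonneg {C : ℝ} (hC : 0 ≤ C) (j : ℕ) (Y : ℝ) : 0 ≤ logPow C j Y := by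
  rw [logPow]; split_ifs with h
  · have := Real.log_nonneg h; positivity
  · exact le_rfl

theorem logPow_mono {C : ℝ} (hC : 0 ≤ C) (j : ℕ) {X Y : ℝ} (h : X ≤ Y) :
    logPow C j X ≤ logPow C j Y := by
  rw [logPow]; split_ifs with hX
  · rw [logPow, if_pos (hX.trans h)]
    have h1 := Real.log_nonneg hX
    have h2 := Real.log_le_log (by linarith) h
    exact pow_le_pow_left₀ (by linarith) (by linarith) _
  · exact logPow_nonneg hC _ _

theorem logPow_div_antitone {C : ℝ} (hC : 0 ≤ C) (j : ℕ) {Y : ℝ} (hY : 0 ≤ Y) (m n : ℕ) (hm : 1 ≤ m)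
    (hmn : m ≤ n) : logPow C j (Y / n) ≤ logPow C j (Y / m) := by
  refine logPow_mono hC j (div_le_div_of_nonneg_left hY ?_ ?_)
  · exact_mod_cast hm
  · exact_mod_cast hmn

theorem one_le_of_mem_subset_sievePrimes {D : ℕ} {R : ℝ} {V : Finset ℕ}
    (hV : V ⊆ sievePrimes D R) : ∀ p ∈ V, 1 ≤ p := fun _ hp =>
  (mem_sievePrimes.1 (hV hp)).1.one_lt.le

theorem sum_logPow_eq_filter (P : Finset ℕ) (hP : ∀ p ∈ P, 1 ≤ p) (g : Finset ℕ → ℝ) (C Y : ℝ)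
    (j : ℕ) :
    ∑ V ∈ P.powerset, g V * logPow C j (Y / primeProd V) =
      ∑ V ∈ P.powerset with (primeProd V : ℝ) ≤ Y, g V * (Real.log (Y / primeProd V) + C) ^ j := by
  rw [Finset.sum_filter]
  refine Finset.sum_congr rfl fun V hV => ?_
  have h1 : (0 : ℝ) < primeProd V := by
    exact_mod_cast primeProd_pos fun p hp => hP p (Finset.mem_powerset.1 hV hp)
  rw [logPow]
  by_cases h : (primeProd V : ℝ) ≤ Y
  · rw [if_pos h, if_pos ((one_le_div h1).2 h)]
  · rw [if_neg h, if_neg (fun h' => h ((one_le_div h1).1 h')), mul_zero]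

theorem sum_logPow_eq_zero (P : Finset ℕ) (hP : ∀ p ∈ P, 1 ≤ p) (g : Finset ℕ → ℝ) (C : ℝ) {Y : ℝ}
    (hY : Y < 1) (j : ℕ) :
    ∑ V ∈ P.powerset, g V * logPow C j (Y / primeProd V) = 0 := by
  rw [sum_logPow_eq_filter P hP, Finset.sum_eq_zero]
  intro V hV
  rw [Finset.mem_filter, Finset.mem_powerset] at hV
  have h1 : (1 : ℝ) ≤ primeProd V := by exact_mod_cast primeProd_pos fun p hp => hP p (hV.1 hp)
  linarith [hV.2]

/-- Deleting the primes up to `D` from the full sum costs at most ∏ (1 + 1/(p − 1)), which is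
exactly the inverse of the sieve density. -/
theorem mul_log_le_sum_subsets {D : ℕ} {R Y : ℝ} (hD : (D : ℝ) ≤ R) (hY : 1 ≤ Y) (hYR : Y ≤ R) :
    sieveDensity D * Real.log Y ≤ ∑ V ∈ (sievePrimes D R).powerset with (primeProd V : ℝ) ≤ Y,
      ∏ p ∈ V, (1 : ℝ) / (p - 1) := by
  set Q := (Icc 1 ⌊R⌋₊).filter Nat.Prime with hQ
  have hQ1 : ∀ p ∈ Q, p.Prime := fun p hp => (Finset.mem_filter.1 hp).2
  have hDR : D ≤ ⌊R⌋₊ := Nat.le_floor hD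
  have hsub : smallPrimes D ⊆ Q := by
    intro p hp
    rw [smallPrimes, Finset.mem_filter, Finset.mem_Icc] at hp
    rw [hQ, Finset.mem_filter, Finset.mem_Icc]
    exact ⟨⟨hp.1.1, hp.1.2.trans hDR⟩, hp.2⟩
  have hdiff : Q \ smallPrimes D = sievePrimes D R := by
    ext p
    rw [Finset.mem_sdiff, mem_smallPrimes, mem_sievePrimes, hQ, Finset.mem_filter, Finset.mem_Icc]
    constructor
    · rintro ⟨⟨⟨_, h2⟩, h3⟩, h4⟩
      exact ⟨h3, by by_contra h; exact h4 ⟨h3, by omega⟩, h2⟩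
    · rintro ⟨h1, h2, h3⟩
      exact ⟨⟨⟨h1.one_lt.le, h3⟩, h1⟩, fun h => by omega⟩
  have h1 := log_le_sum_primes_subsets R Y hY hYR
  have hF : ∀ m n : ℕ, 1 ≤ m → m ≤ n → (if (n : ℝ) ≤ Y then (1 : ℝ) else 0) ≤
      if (m : ℝ) ≤ Y then 1 else 0 := by
    intro m n _ hmn
    have : (m : ℝ) ≤ n := by exact_mod_cast hmn
    split_ifs <;> linarith
  have h2 := sum_le_prod_one_add_mul_sum hsub (fun p hp => (hQ1 p hp).one_lt.le)
    (fun p => (1 : ℝ) / (p - 1)) (fun p hp => by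
      have : (1 : ℝ) < p := by exact_mod_cast (hQ1 p hp).one_lt
      have : (0 : ℝ) < p - 1 := by linarith
      positivity) (fun n => if (n : ℝ) ≤ Y then 1 else 0) hF
  simp only [mul_ite, mul_one, mul_zero] at h2
  rw [← Finset.sum_filter, ← Finset.sum_filter, hdiff] at h2
  have h3 : sieveDensity D * ∏ p ∈ smallPrimes D, (1 + (1 : ℝ) / (p - 1)) = 1 := by
    rw [sieveDensity, ← Finset.prod_mul_distrib]
    refine Finset.prod_eq_one fun p hp => ?_
    have : (1 : ℝ) < p := by exact_mod_cast (mem_smallPrimes.1 hp).1.one_lt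
    have : (p : ℝ) - 1 ≠ 0 := by linarith
    field_simp; ring
  calc sieveDensity D * Real.log Y ≤ sieveDensity D * _ :=
        mul_le_mul_of_nonneg_left (h1.trans h2) (sieveDensity_pos D).le
    _ = _ := by rw [← mul_assoc, h3, one_mul]

/-- The lower bound is the Abel summation bound applied to the negated terms, with the negative
constant `-sieveDensity D`. -/
theorem mul_logPow_le_sum {D : ℕ} {R Y : ℝ} (hD : (D : ℝ) ≤ R) (hYR : Y ≤ R) (j : ℕ) :
    sieveDensity D / (j + 1) * logPow 0 (j + 1) Y ≤
      ∑ V ∈ (sievePrimes D R).powerset, (∏ p ∈ V, (1 : ℝ) / (p - 1)) * logPow 0 j (Y / primeProd V) := by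
  have hP : ∀ p ∈ sievePrimes D R, 1 ≤ p := one_le_of_mem_subset_sievePrimes le_rfl
  rcases lt_or_ge Y 1 with h | hY
  · rw [sum_logPow_eq_zero _ hP _ _ h, logPow, if_neg (by linarith), mul_zero]
  · rw [sum_logPow_eq_filter _ hP, logPow, if_pos hY]
    have := abel_sum_log_pow_le (sievePrimes D R).powerset (fun V => -∏ p ∈ V, (1 : ℝ) / (p - 1))
      primeProd (fun V hV => primeProd_pos fun p hp => hP p (Finset.mem_powerset.1 hV hp))
      (-sieveDensity D) 0 0 Y le_rfl hY j (fun t ht htY => by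
        rw [Finset.sum_neg_distrib]
        have := mul_log_le_sum_subsets hD ht (htY.trans hYR)
        linarith)
    simp only [neg_mul, Finset.sum_neg_distrib, mul_zero, zero_mul, add_zero] at this
    have h2 : sieveDensity D / (j + 1) * (Real.log Y + 0) ^ (j + 1) =
      sieveDensity D * ((Real.log Y ^ (j + 1) - 0 ^ (j + 1)) / (j + 1)) := by
      rw [zero_pow (Nat.succ_ne_zero j)]; ring
    rw [h2]
    simp only [add_zero]
    linarith

/-- Convolving local factors over unions multiplies the quantities 1 + g, so m copies of 1/(p − 1)
give (1 + 1/(p − 1))^m − 1. Unions have product at most the product of the parts, and decreasing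
functions turn this into a lower bound. Each copy integrates the power of the logarithm once, which
accounts for the factorials. -/
theorem pow_mul_logPow_le_sum {D : ℕ} {R Y : ℝ} (hD : (D : ℝ) ≤ R) (hYR : Y ≤ R) (hY0 : 0 ≤ Y)
    (m j : ℕ) :
    sieveDensity D ^ m * ((j.factorial : ℝ) / (j + m).factorial) * logPow 0 (j + m) Y ≤
      ∑ V ∈ (sievePrimes D R).powerset,
        (∏ p ∈ V, ((1 + (1 : ℝ) / (p - 1)) ^ m - 1)) * logPow 0 j (Y / primeProd V) := by
  have hP : ∀ p ∈ sievePrimes D R, 1 ≤ p := one_le_of_mem_subset_sievePrimes le_rfl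
  have hg : ∀ p ∈ sievePrimes D R, (0 : ℝ) ≤ 1 / ((p : ℝ) - 1) := by
    intro p hp
    have : (1 : ℝ) < p := by exact_mod_cast (mem_sievePrimes.1 hp).1.one_lt
    have : (0 : ℝ) < p - 1 := by linarith
    positivity
  induction m generalizing j with
  | zero =>
    rw [Finset.sum_eq_single_of_mem ∅ (Finset.empty_mem_powerset _)]
    · have : (j.factorial : ℝ) ≠ 0 := by positivity
      simp [primeProd, this]
    · intro V _ hV
      obtain ⟨p, hp⟩ := Finset.nonempty_iff_ne_empty.2 hV
      rw [Finset.prod_eq_zero hp (by simp), zero_mul]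
  | succ m ih =>
    have hG : ∀ p ∈ sievePrimes D R, (0 : ℝ) ≤ (1 + (1 : ℝ) / (p - 1)) ^ m - 1 := fun p hp => by
      have := one_le_pow₀ (n := m) (by linarith [hg p hp] : (1 : ℝ) ≤ 1 + (1 : ℝ) / (p - 1))
      linarith
    have h1 := sum_sum_le_sum_prod _ hP (fun p => (1 + (1 : ℝ) / (p - 1)) ^ m - 1)
      (fun p => (1 : ℝ) / (p - 1)) hG hg (fun n => logPow 0 j (Y / n))
      (fun a b ha hab => logPow_div_antitone le_rfl j hY0 a b ha hab)
    have h2 : ∀ p : ℕ, (1 + (1 : ℝ) / (p - 1)) ^ m - 1 + (1 : ℝ) / (p - 1) +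
        ((1 + (1 : ℝ) / (p - 1)) ^ m - 1) * ((1 : ℝ) / (p - 1)) =
        (1 + (1 : ℝ) / (p - 1)) ^ (m + 1) - 1 := fun p => by ring
    simp only [h2] at h1
    refine le_trans ?_ h1
    have h3 := ih (j + 1)
    have hκ : 0 ≤ sieveDensity D / (j + 1) := div_nonneg (sieveDensity_pos D).le (by positivity)
    have h4 := mul_le_mul_of_nonneg_left h3 hκ
    have h5 : sieveDensity D ^ (m + 1) * ((j.factorial : ℝ) / (j + (m + 1)).factorial) *
        logPow 0 (j + (m + 1)) Y = sieveDensity D / (j + 1) * (sieveDensity D ^ m *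
        (((j + 1).factorial : ℝ) / (j + 1 + m).factorial) * logPow 0 (j + 1 + m) Y) := by
      have e : j + (m + 1) = j + 1 + m := by ring
      rw [e, Nat.factorial_succ j]
      have h0 : (j : ℝ) + 1 ≠ 0 := by positivity
      push_cast
      field_simp
      ring
    rw [h5]
    refine h4.trans ?_
    rw [Finset.mul_sum]
    refine Finset.sum_le_sum fun U hU => ?_
    rw [Finset.mem_powerset] at hU
    have hU0 : 0 ≤ ∏ p ∈ U, ((1 + (1 : ℝ) / (p - 1)) ^ m - 1) :=
      Finset.prod_nonneg fun p hp => hG p (hU hp)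
    have hU1 : (1 : ℝ) ≤ primeProd U := by exact_mod_cast primeProd_pos fun p hp => hP p (hU hp)
    have h6 := mul_logPow_le_sum (D := D) (Y := Y / primeProd U) hD
      ((div_le_self hY0 hU1).trans hYR) j
    have h7 := mul_le_mul_of_nonneg_left h6 hU0
    calc _ = _ := by ring
      _ ≤ _ := h7
      _ = _ := by
        rw [Finset.mul_sum]
        refine Finset.sum_congr rfl fun V _ => ?_
        push_cast
        rw [div_div]; ring

/-! ### Upper bounds in every dimension. -/

/-- The upper-bound analogue for a one-dimensional density with logarithmic growth. -/
theorem sum_mul_logPow_le {P : Finset ℕ} (hP : ∀ p ∈ P, 1 ≤ p) (g : ℕ → ℝ) {κ C C₁ : ℝ}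
    (hκ : 0 ≤ κ) (hC : 0 ≤ C) (hC₁ : 0 ≤ C₁)
    (hA : ∀ t, 1 ≤ t → ∑ V ∈ P.powerset with (primeProd V : ℝ) ≤ t, ∏ p ∈ V, g p ≤
      κ * (Real.log t + C)) (Y : ℝ) (j : ℕ) :
    ∑ V ∈ P.powerset, (∏ p ∈ V, g p) * logPow C₁ j (Y / primeProd V) ≤
      κ / (j + 1) * logPow (C₁ + C) (j + 1) Y := by
  rcases lt_or_ge Y 1 with h | hY
  · rw [sum_logPow_eq_zero _ hP _ _ h, logPow, if_neg (by linarith), mul_zero]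
  · rw [sum_logPow_eq_filter _ hP, logPow, if_pos hY]
    have h1 := abel_sum_log_pow_le P.powerset (fun V => ∏ p ∈ V, g p)
      primeProd (fun V hV => primeProd_pos fun p hp => hP p (Finset.mem_powerset.1 hV hp))
      κ C C₁ Y hC₁ hY j (fun t ht _ => hA t ht)
    refine h1.trans ?_
    have hL := Real.log_nonneg hY
    set x := Real.log Y + C₁ with hx
    have hx0 : 0 ≤ x := by positivity
    -- The first two terms of the binomial expansion: the boundary term of partial summation is
    -- absorbed by shifting the logarithm by `C`.
    have h2 : x ^ (j + 1) + (j + 1) * C * x ^ j ≤ (x + C) ^ (j + 1) := by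
      clear h1
      clear_value x
      induction j with
      | zero => simp
      | succ j ih =>
        have := mul_le_mul_of_nonneg_right ih (by positivity : 0 ≤ x + C)
        have h3 : 0 ≤ ((j : ℝ) + 1) * C * C * x ^ j := by positivity
        push_cast
        calc _ ≤ (x ^ (j + 1) + (j + 1) * C * x ^ j) * (x + C) := by
              ring_nf at h3 ⊢; linarith
          _ ≤ _ := this.trans (by rw [← pow_succ])
    have h3 : (x ^ (j + 1) - C₁ ^ (j + 1)) / (j + 1) + C * x ^ j ≤ (x + C) ^ (j + 1) / (j + 1) := by
      rw [div_add' _ _ _ (by positivity), div_le_div_iff_of_pos_right (by positivity)]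
      have : 0 ≤ C₁ ^ (j + 1) := by positivity
      linarith
    have h4 := mul_le_mul_of_nonneg_left h3 hκ
    have e : Real.log Y + (C₁ + C) = x + C := by rw [hx]; ring
    rw [e]
    calc _ = _ := by ring
      _ ≤ _ := h4
      _ = _ := by ring

/-- A local factor m·g is the sum of m copies of g, and dropping the disjointness of the parts only
increases the sum. The shift of the logarithm grows by `C` with each copy. -/
theorem sum_pow_mul_logPow_le {P : Finset ℕ} (hP : ∀ p ∈ P, 1 ≤ p) (g : ℕ → ℝ)
    (hg : ∀ p ∈ P, 0 ≤ g p) {κ C C₁ : ℝ} (hκ : 0 ≤ κ) (hC : 0 ≤ C) (hC₁ : 0 ≤ C₁)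
    (hA : ∀ t, 1 ≤ t → ∑ V ∈ P.powerset with (primeProd V : ℝ) ≤ t, ∏ p ∈ V, g p ≤
      κ * (Real.log t + C)) (Y : ℝ) (m j : ℕ) :
    ∑ V ∈ P.powerset, (∏ p ∈ V, ((m : ℝ) * g p)) * logPow C₁ j (Y / primeProd V) ≤
      κ ^ m * ((j.factorial : ℝ) / (j + m).factorial) * logPow (C₁ + m * C) (j + m) Y := by
  induction m generalizing j C₁ with
  | zero =>
    rw [Finset.sum_eq_single_of_mem ∅ (Finset.empty_mem_powerset _)]
    · have : (j.factorial : ℝ) ≠ 0 := by positivity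
      simp [primeProd, this]
    · intro V _ hV
      obtain ⟨p, hp⟩ := Finset.nonempty_iff_ne_empty.2 hV
      rw [Finset.prod_eq_zero hp (by simp), zero_mul]
  | succ m ih =>
    have h1 := sum_prod_add_le P (fun p => (m : ℝ) * g p) g
      (fun p hp => mul_nonneg (Nat.cast_nonneg m) (hg p hp)) hg
      (fun n => logPow C₁ j (Y / n)) (fun n => logPow_nonneg hC₁ _ _)
    have e1 : ∀ p, (m : ℝ) * g p + g p = ((m + 1 : ℕ) : ℝ) * g p := fun p => by push_cast; ring
    simp only [e1] at h1
    refine h1.trans ?_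
    have h2 : ∀ U ∈ P.powerset, ∑ V ∈ P.powerset, (∏ p ∈ U, (m : ℝ) * g p) * (∏ p ∈ V, g p) *
        logPow C₁ j (Y / ((primeProd U * primeProd V : ℕ) : ℝ)) ≤
        κ / (j + 1) * ((∏ p ∈ U, (m : ℝ) * g p) * logPow (C₁ + C) (j + 1) (Y / primeProd U)) := by
      intro U hU
      have hU0 : 0 ≤ ∏ p ∈ U, (m : ℝ) * g p := Finset.prod_nonneg fun p hp =>
        mul_nonneg (Nat.cast_nonneg m) (hg p (Finset.mem_powerset.1 hU hp))
      have h3 := mul_le_mul_of_nonneg_left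
        (sum_mul_logPow_le hP g hκ hC hC₁ hA (Y / primeProd U) j) hU0
      calc _ = _ := by
            rw [Finset.mul_sum]
            refine Finset.sum_congr rfl fun V _ => ?_
            push_cast
            rw [div_div]; ring
        _ ≤ _ := h3
        _ = _ := by ring
    refine (Finset.sum_le_sum h2).trans ?_
    rw [← Finset.mul_sum]
    have h4 := mul_le_mul_of_nonneg_left (ih (add_nonneg hC₁ hC) (j + 1))
      (div_nonneg hκ (by positivity : (0 : ℝ) ≤ (j : ℝ) + 1))
    refine h4.trans (le_of_eq ?_)
    have e : j + (m + 1) = j + 1 + m := by ring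
    have e2 : C₁ + C + m * C = C₁ + ((m + 1 : ℕ) : ℝ) * C := by push_cast; ring
    rw [e, e2, Nat.factorial_succ j]
    have h0 : (j : ℝ) + 1 ≠ 0 := by positivity
    push_cast
    field_simp
    ring

/-! ### Logarithmic growth in multiplicative windows. -/

/-- By induction on the primes: those integers up to Z free of the earlier primes which p divides
are p times the same kind of integers up to Z/p. The error constant depends on `T` alone. -/
theorem exists_abs_sum_coprime_sub_le (T : Finset ℕ) (hT : ∀ p ∈ T, p.Prime) :
    ∃ C : ℝ, 0 ≤ C ∧ ∀ Z : ℝ, 1 ≤ Z →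
      |∑ n ∈ Icc 1 ⌊Z⌋₊ with ∀ p ∈ T, ¬ p ∣ n, (1 : ℝ) / n -
        (∏ p ∈ T, (1 - 1 / (p : ℝ))) * Real.log Z| ≤ C := by
  induction T using Finset.induction_on with
  | empty =>
    refine ⟨1, zero_le_one, fun Z hZ => ?_⟩
    have h1 := log_le_harmonic_floor Z (by linarith)
    have h2 := harmonic_floor_le_one_add_log Z hZ
    rw [harmonic_eq_sum_Icc] at h1 h2
    push_cast at h1 h2
    simp only [Finset.notMem_empty, false_imp_iff, implies_true, Finset.filter_true,
      Finset.prod_empty, one_mul, one_div]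
    rw [abs_le]; constructor <;> linarith
  | insert p T hp ih =>
    obtain ⟨C, hC, h⟩ := ih fun q hq => hT q (Finset.mem_insert_of_mem hq)
    have hpp := hT p (Finset.mem_insert_self _ _)
    have hp1 : (1 : ℝ) < p := by exact_mod_cast hpp.one_lt
    have hp0 : (0 : ℝ) < p := by linarith
    set A : ℝ → ℝ := fun Z => ∑ n ∈ Icc 1 ⌊Z⌋₊ with ∀ p ∈ T, ¬ p ∣ n, (1 : ℝ) / n with hA
    set κ := ∏ p ∈ T, (1 - 1 / (p : ℝ)) with hκ
    have hκ0 : 0 < κ := Finset.prod_pos fun q hq =>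
      one_sub_one_div_prime_pos (hT q (Finset.mem_insert_of_mem hq))
    have hrec : ∀ Z : ℝ, ∑ n ∈ Icc 1 ⌊Z⌋₊ with ∀ q ∈ insert p T, ¬ q ∣ n, (1 : ℝ) / n =
        A Z - 1 / p * A (Z / p) := by
      intro Z
      have h1 : A Z = ∑ n ∈ Icc 1 ⌊Z⌋₊ with ∀ q ∈ insert p T, ¬ q ∣ n, (1 : ℝ) / n +
          ∑ n ∈ Icc 1 ⌊Z⌋₊ with (∀ q ∈ T, ¬ q ∣ n) ∧ p ∣ n, (1 : ℝ) / n := by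
        rw [hA, ← Finset.sum_union]
        · refine Finset.sum_congr ?_ fun _ _ => rfl
          ext n
          simp only [Finset.mem_filter, Finset.mem_union, Finset.forall_mem_insert]
          tauto
        · rw [Finset.disjoint_filter]
          intro n _ h1 h2
          exact h1 p (Finset.mem_insert_self _ _) h2.2
      have h2 : ∑ n ∈ Icc 1 ⌊Z⌋₊ with (∀ q ∈ T, ¬ q ∣ n) ∧ p ∣ n, (1 : ℝ) / n =
          1 / p * A (Z / p) := by
        rw [hA, Finset.mul_sum]
        symm
        refine Finset.sum_nbij' (fun m => p * m) (fun n => n / p) ?_ ?_ ?_ ?_ ?_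
        · intro m hm
          rw [Finset.mem_filter, Finset.mem_Icc, Nat.floor_div_natCast, Nat.le_div_iff_mul_le hpp.pos] at hm
          rw [Finset.mem_filter, Finset.mem_Icc]
          refine ⟨⟨Nat.mul_pos hpp.pos hm.1.1, by rw [mul_comm]; exact hm.1.2⟩, fun q hq hd => ?_, dvd_mul_right _ _⟩
          have hqp := hT q (Finset.mem_insert_of_mem hq)
          rcases hqp.dvd_mul.1 hd with h3 | h3
          · rw [Nat.prime_dvd_prime_iff_eq hqp hpp] at h3
            exact hp (h3 ▸ hq)
          · exact hm.2 q hq h3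
        · intro n hn
          rw [Finset.mem_filter, Finset.mem_Icc] at hn
          obtain ⟨hn1, hn2, m, rfl⟩ := hn
          rw [Nat.mul_div_cancel_left m hpp.pos, Finset.mem_filter, Finset.mem_Icc,
            Nat.floor_div_natCast, Nat.le_div_iff_mul_le hpp.pos]
          refine ⟨⟨Nat.pos_of_mul_pos_left hn1.1, by rw [mul_comm]; exact hn1.2⟩, fun q hq hd =>
            hn2 q hq (Dvd.dvd.mul_left hd p)⟩
        · intro m _
          exact Nat.mul_div_cancel_left m hpp.pos
        · intro n hn
          exact Nat.mul_div_cancel' (Finset.mem_filter.1 hn).2.2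
        · intro m _
          push_cast
          rw [one_div_mul_one_div]
      rw [h1, h2]; ring
    -- One `C` for each of Z and Z/p, and κ·log p for passing from log(Z/p) to log Z. The last term
    -- also covers Z < p, where the subtracted sum is empty.
    refine ⟨C + C + κ * Real.log p, by
      have := Real.log_nonneg hp1.le
      positivity, fun Z hZ => ?_⟩
    rw [hrec, Finset.prod_insert hp]
    have hZ1 := h Z hZ
    have hlp := Real.log_nonneg hp1.le
    have hlZ := Real.log_nonneg hZ
    have hp' : 1 / (p : ℝ) ≤ 1 := by rw [div_le_one hp0]; exact hp1.le
    have hp'' : 0 < 1 / (p : ℝ) := by positivity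
    rcases le_or_gt (p : ℝ) Z with hpZ | hpZ
    · have hZ2 := h (Z / p) ((one_le_div hp0).2 hpZ)
      rw [Real.log_div (by linarith) (by linarith)] at hZ2
      rw [abs_le] at hZ1 hZ2 ⊢
      change -C ≤ A Z - _ ∧ A Z - _ ≤ C at hZ1
      change -C ≤ A (Z / p) - _ ∧ A (Z / p) - _ ≤ C at hZ2
      set x := A (Z / p) - κ * (Real.log Z - Real.log p) with hx
      have hx1 : |1 / p * x| ≤ C := by
        rw [abs_mul, abs_of_pos hp'']
        have : |x| ≤ C := abs_le.2 hZ2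
        nlinarith [abs_nonneg x]
      rw [abs_le] at hx1
      have h3 : 1 / p * (κ * Real.log p) ≤ κ * Real.log p := by
        have : 0 ≤ κ * Real.log p := by positivity
        nlinarith
      have h4 : 0 ≤ 1 / p * (κ * Real.log p) := by positivity
      have e : A Z - 1 / p * A (Z / p) - (1 - 1 / p) * κ * Real.log Z =
        (A Z - κ * Real.log Z) - 1 / p * x + 1 / p * (κ * Real.log p) := by rw [hx]; ring
      rw [e]
      constructor <;> linarith
    · have hz : A (Z / p) = 0 := by
        have : ⌊Z / p⌋₊ = 0 := by rw [Nat.floor_eq_zero, div_lt_one hp0]; exact hpZ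
        simp only [hA, this]; simp
      rw [hz, mul_zero, sub_zero]
      have h2 : Real.log Z ≤ Real.log p := Real.log_le_log (by linarith) hpZ.le
      rw [abs_le] at hZ1 ⊢
      change -C ≤ A Z - _ ∧ A Z - _ ≤ C at hZ1
      have h3 : κ * Real.log Z ≤ κ * Real.log p := mul_le_mul_of_nonneg_left h2 hκ0.le
      have h5 : 0 ≤ κ * Real.log Z := by positivity
      have h6 : 0 ≤ 1 / p * (κ * Real.log Z) := by positivity
      have h7 : 1 / p * (κ * Real.log Z) ≤ κ * Real.log Z := by nlinarith
      have e : A Z - (1 - 1 / p) * κ * Real.log Z =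
        A Z - κ * Real.log Z + 1 / p * (κ * Real.log Z) := by ring
      rw [e]
      constructor <;> linarith

/-- Subtract the estimates at `Z` and `Z / w`: the bound does not depend on `Z`. This controls the
jump of the sieve profile at R. -/
theorem exists_sum_coprime_window_le (D : ℕ) :
    ∃ C : ℝ, 0 ≤ C ∧ ∀ Z w : ℝ, 1 ≤ w →
      ∑ n ∈ Icc 1 ⌊Z⌋₊ with (∀ p ∈ smallPrimes D, ¬ p ∣ n) ∧ Z / w < n, (1 : ℝ) / n ≤
        sieveDensity D * (Real.log w + C) := by
  obtain ⟨C, hC, h⟩ := exists_abs_sum_coprime_sub_le (smallPrimes D)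
    fun p hp => (mem_smallPrimes.1 hp).1
  have hκ := sieveDensity_pos D
  refine ⟨2 * C / sieveDensity D, by positivity, fun Z w hw => ?_⟩
  have e : sieveDensity D * (Real.log w + 2 * C / sieveDensity D) =
      sieveDensity D * Real.log w + 2 * C := by field_simp
  rw [e]
  have hlw := Real.log_nonneg hw
  rcases lt_or_ge Z 1 with hZ | hZ
  · rw [Nat.floor_eq_zero.2 hZ]
    simp; positivity
  have h1 := (abs_le.1 (h Z hZ)).2
  rcases lt_or_ge (Z / w) 1 with hZw | hZw
  · refine le_trans (Finset.sum_le_sum_of_subset_of_nonneg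
      (t := (Icc 1 ⌊Z⌋₊).filter (fun n => ∀ p ∈ smallPrimes D, ¬ p ∣ n)) ?_
      fun _ _ _ => by positivity) ?_
    · exact Finset.monotone_filter_right _ fun n _ hn => hn.1
    · rw [div_lt_one (by linarith)] at hZw
      have h2 := Real.log_le_log (by linarith) hZw.le
      have h3 := mul_le_mul_of_nonneg_left h2 hκ.le
      change _ - sieveDensity D * Real.log Z ≤ C at h1
      linarith
  · have h2 := (abs_le.1 (h (Z / w) hZw)).1
    rw [Real.log_div (by linarith) (by linarith)] at h2
    have h3 : ∑ n ∈ Icc 1 ⌊Z⌋₊ with (∀ p ∈ smallPrimes D, ¬ p ∣ n) ∧ Z / w < n, (1 : ℝ) / n +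
        ∑ n ∈ Icc 1 ⌊Z / w⌋₊ with ∀ p ∈ smallPrimes D, ¬ p ∣ n, (1 : ℝ) / n ≤
        ∑ n ∈ Icc 1 ⌊Z⌋₊ with ∀ p ∈ smallPrimes D, ¬ p ∣ n, (1 : ℝ) / n := by
      rw [← Finset.sum_union]
      · refine Finset.sum_le_sum_of_subset_of_nonneg ?_ fun _ _ _ => by positivity
        intro n hn
        rw [Finset.mem_union, Finset.mem_filter, Finset.mem_filter, Finset.mem_Icc,
          Finset.mem_Icc] at hn
        rw [Finset.mem_filter, Finset.mem_Icc]
        rcases hn with hn | hn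
        · exact ⟨hn.1, hn.2.1⟩
        · exact ⟨⟨hn.1.1, hn.1.2.trans (Nat.floor_le_floor (div_le_self (by linarith) hw))⟩, hn.2⟩
      · rw [Finset.disjoint_left]
        intro n hn hn'
        rw [Finset.mem_filter] at hn hn'
        have := (Nat.le_floor_iff (by linarith : (0 : ℝ) ≤ Z / w)).1 (Finset.mem_Icc.1 hn'.1).2
        linarith [hn.2.2]
    change _ - sieveDensity D * Real.log Z ≤ C at h1
    change -C ≤ _ - sieveDensity D * (Real.log Z - Real.log w) at h2
    linarith

/-- Distinct sets of primes have distinct products, and these products are integers without prime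
factors up to `D`. -/
theorem exists_sum_subsets_inv_window_le (D : ℕ) :
    ∃ C : ℝ, 0 ≤ C ∧ ∀ R Z w : ℝ, 1 ≤ w →
      ∑ V ∈ (sievePrimes D R).powerset with Z / w < (primeProd V : ℝ) ∧ (primeProd V : ℝ) ≤ Z,
        ∏ p ∈ V, (1 : ℝ) / p ≤ sieveDensity D * (Real.log w + C) := by
  obtain ⟨C, hC, h⟩ := exists_sum_coprime_window_le D
  refine ⟨C, hC, fun R Z w hw => le_trans ?_ (h Z w hw)⟩
  have hprime : ∀ V ∈ (sievePrimes D R).powerset.filter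
      (fun V => Z / w < (primeProd V : ℝ) ∧ (primeProd V : ℝ) ≤ Z), ∀ p ∈ V, p.Prime ∧ D < p := by
    intro V hV p hp
    rw [Finset.mem_filter, Finset.mem_powerset] at hV
    have := mem_sievePrimes.1 (hV.1 hp)
    exact ⟨this.1, this.2.1⟩
  have hinj : Set.InjOn primeProd ((sievePrimes D R).powerset.filter
      (fun V => Z / w < (primeProd V : ℝ) ∧ (primeProd V : ℝ) ≤ Z) : Set (Finset ℕ)) := by
    intro U hU V hV hUV
    rw [← primeFactors_primeProd fun p hp => (hprime U hU p hp).1,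
      ← primeFactors_primeProd fun p hp => (hprime V hV p hp).1, hUV]
  have e : ∑ V ∈ (sievePrimes D R).powerset with Z / w < (primeProd V : ℝ) ∧ (primeProd V : ℝ) ≤ Z,
        ∏ p ∈ V, (1 : ℝ) / p = ∑ n ∈ ((sievePrimes D R).powerset.filter
      (fun V => Z / w < (primeProd V : ℝ) ∧ (primeProd V : ℝ) ≤ Z)).image primeProd, (1 : ℝ) / n := by
    rw [Finset.sum_image hinj]
    refine Finset.sum_congr rfl fun V _ => ?_
    rw [primeProd]; push_cast; simp
  rw [e]
  refine Finset.sum_le_sum_of_subset_of_nonneg ?_ fun _ _ _ => by positivity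
  intro n hn
  obtain ⟨V, hV, rfl⟩ := Finset.mem_image.1 hn
  have hVp := hprime V hV
  rw [Finset.mem_filter] at hV
  rw [Finset.mem_filter, Finset.mem_Icc]
  refine ⟨⟨primeProd_pos fun p hp => (hVp p hp).1.one_lt.le, Nat.le_floor hV.2.2⟩, ?_, hV.2.1⟩
  intro q hq hd
  have hq' := mem_smallPrimes.1 hq
  have hmem : q ∈ (primeProd V).primeFactors := by
    rw [Nat.mem_primeFactors]
    exact ⟨hq'.1, hd, Nat.one_le_iff_ne_zero.1 (primeProd_pos fun p hp => (hVp p hp).1.one_lt.le)⟩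
  rw [primeFactors_primeProd fun p hp => (hVp p hp).1] at hmem
  have := (hVp q hmem).2
  omega

/-- Since p ≥ 2k, each factor is at most exp(2k/p²), and the inverse squares beyond `D` sum to at
most 1/D. The result tends to 1 as `D` grows. -/
theorem prod_one_add_sieve_correction_le {k D : ℕ} (hk : 1 ≤ k) (hD : 2 * k ≤ D) (R : ℝ) :
    ∏ p ∈ sievePrimes D R, (1 + (k : ℝ) / (p * (p - k))) ≤ Real.exp (2 * k / D) := by
  have hD0 : D ≠ 0 := by omega
  have h1 : ∀ p ∈ sievePrimes D R, 1 + (k : ℝ) / (p * (p - k)) ≤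
      Real.exp (2 * k * ((p : ℝ) ^ 2)⁻¹) := by
    intro p hp
    have hpD := (mem_sievePrimes.1 hp).2.1
    have h2 : 2 * (k : ℝ) ≤ p := by exact_mod_cast (hD.trans hpD.le)
    have hk' : (1 : ℝ) ≤ k := by exact_mod_cast hk
    have h3 : (k : ℝ) / (p * (p - k)) ≤ 2 * k * ((p : ℝ) ^ 2)⁻¹ := by
      rw [← div_eq_mul_inv, div_le_div_iff₀ (by nlinarith) (by nlinarith)]
      have : 0 ≤ (k : ℝ) * p * (p - 2 * k) := by
        apply mul_nonneg (by nlinarith) (by linarith)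
      nlinarith
    have := Real.add_one_le_exp (2 * k * ((p : ℝ) ^ 2)⁻¹)
    linarith
  have h0 : ∀ p ∈ sievePrimes D R, 0 ≤ 1 + (k : ℝ) / (p * (p - k)) := by
    intro p hp
    have hpD := (mem_sievePrimes.1 hp).2.1
    have h2 : 2 * (k : ℝ) ≤ p := by exact_mod_cast (hD.trans hpD.le)
    have hk' : (1 : ℝ) ≤ k := by exact_mod_cast hk
    have : 0 ≤ (k : ℝ) / (p * (p - k)) := div_nonneg (by linarith) (by nlinarith)
    linarith
  refine (Finset.prod_le_prod h0 h1).trans ?_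
  rw [← Real.exp_sum, Real.exp_le_exp, ← Finset.mul_sum, mul_div_assoc, mul_assoc]
  have hk' : (0 : ℝ) ≤ k := Nat.cast_nonneg k
  rw [mul_div_assoc']
  rw [← mul_assoc, div_eq_mul_inv]
  refine mul_le_mul_of_nonneg_left ?_ (by positivity)
  have h2 : ∑ p ∈ sievePrimes D R, ((p : ℝ) ^ 2)⁻¹ ≤ ∑ p ∈ Ioc D (max D ⌊R⌋₊), ((p : ℝ) ^ 2)⁻¹ := by
    refine Finset.sum_le_sum_of_subset_of_nonneg ?_ fun _ _ _ => by positivity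
    intro p hp
    have := mem_sievePrimes.1 hp
    exact Finset.mem_Ioc.2 ⟨this.2.1, this.2.2.trans (le_max_right _ _)⟩
  refine h2.trans ((sum_Ioc_inv_sq_le_sub (α := ℝ) hD0 (le_max_left _ _)).trans ?_)
  have : (0 : ℝ) ≤ ((max D ⌊R⌋₊ : ℕ) : ℝ)⁻¹ := by positivity
  linarith

/-- Decompose 1/(p − k) = 1/p + k/(p(p − k)). The second part has a product bounded independently of
R, and the window estimate for the first is uniform in the endpoint, so it applies to Z divided by
any fixed product. -/
theorem exists_sum_subsets_window_le {k D : ℕ} (hk : 1 ≤ k) (hD : 2 * k ≤ D) :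
    ∃ C : ℝ, 0 ≤ C ∧ ∀ R Z w : ℝ, 1 ≤ w →
      ∑ V ∈ (sievePrimes D R).powerset with Z / w < (primeProd V : ℝ) ∧ (primeProd V : ℝ) ≤ Z,
        ∏ p ∈ V, (1 : ℝ) / (p - k) ≤
          sieveDensity D * Real.exp (2 * k / D) * (Real.log w + C) := by
  obtain ⟨C, hC, h⟩ := exists_sum_subsets_inv_window_le D
  refine ⟨C, hC, fun R Z w hw => ?_⟩
  have hp2 : ∀ p ∈ sievePrimes D R, 2 * (k : ℝ) ≤ p := by
    intro p hp
    exact_mod_cast (hD.trans (mem_sievePrimes.1 hp).2.1.le)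
  have hk' : (1 : ℝ) ≤ k := by exact_mod_cast hk
  have hc0 : ∀ p ∈ sievePrimes D R, 0 ≤ (k : ℝ) / (p * (p - k)) := fun p hp => by
    have := hp2 p hp
    exact div_nonneg (by linarith) (by nlinarith)
  have h1 := sum_prod_add_le (sievePrimes D R) (fun p => (k : ℝ) / (p * (p - k)))
    (fun p => (1 : ℝ) / p) hc0 (fun p hp => by positivity)
    (fun n => if Z / w < (n : ℝ) ∧ (n : ℝ) ≤ Z then 1 else 0) (fun n => by split_ifs <;> norm_num)
  have e : ∀ V ∈ (sievePrimes D R).powerset, ∏ p ∈ V, ((k : ℝ) / (p * (p - k)) + 1 / p) =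
      ∏ p ∈ V, (1 : ℝ) / (p - k) := by
    intro V hV
    refine Finset.prod_congr rfl fun p hp => ?_
    have := hp2 p (Finset.mem_powerset.1 hV hp)
    have h3 : (p : ℝ) ≠ 0 := by linarith
    have h4 : (p : ℝ) - k ≠ 0 := by linarith
    field_simp; ring
  rw [Finset.sum_congr rfl fun V hV => by rw [e V hV]] at h1
  simp only [mul_ite, mul_one, mul_zero] at h1
  rw [← Finset.sum_filter] at h1
  refine h1.trans ?_
  have hB : 0 ≤ sieveDensity D * (Real.log w + C) :=
    mul_nonneg (sieveDensity_pos D).le (add_nonneg (Real.log_nonneg hw) hC)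
  have h5 : ∀ U ∈ (sievePrimes D R).powerset, (∑ V ∈ (sievePrimes D R).powerset,
      if Z / w < ((primeProd U * primeProd V : ℕ) : ℝ) ∧ ((primeProd U * primeProd V : ℕ) : ℝ) ≤ Z then
        (∏ p ∈ U, (k : ℝ) / (p * (p - k))) * ∏ p ∈ V, (1 : ℝ) / p else 0) ≤
      (∏ p ∈ U, (k : ℝ) / (p * (p - k))) * (sieveDensity D * (Real.log w + C)) := by
    intro U hU
    rw [Finset.mem_powerset] at hU
    have hU1 : (0 : ℝ) < primeProd U := by
      exact_mod_cast primeProd_pos (one_le_of_mem_subset_sievePrimes hU)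
    have h6 := mul_le_mul_of_nonneg_left (h R (Z / primeProd U) w hw)
      (Finset.prod_nonneg fun p hp => hc0 p (hU hp) : 0 ≤ ∏ p ∈ U, (k : ℝ) / (p * (p - k)))
    refine le_trans (le_of_eq ?_) h6
    rw [← Finset.sum_filter, Finset.mul_sum]
    refine Finset.sum_congr ?_ fun _ _ => rfl
    refine Finset.filter_congr fun V _ => ?_
    push_cast
    rw [div_right_comm, div_lt_iff₀' hU1, le_div_iff₀' hU1]
  refine (Finset.sum_le_sum h5).trans ?_
  rw [← Finset.sum_mul, ← Finset.prod_one_add]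
  calc _ ≤ Real.exp (2 * k / D) * (sieveDensity D * (Real.log w + C)) :=
        mul_le_mul_of_nonneg_right (prod_one_add_sieve_correction_le hk hD R) hB
    _ = _ := by ring

/-! ### The Selberg weights and their linear profile. -/

/-- The truncated linear profile of the sieve weights. -/
noncomputable def sieveProfile (b R : ℝ) (n : ℕ) : ℝ :=
  if (n : ℝ) ≤ R then 1 + b / Real.log R * Real.log (R / n) else 0

/-- The Selberg weights of dimension `k` attached to `sieveProfile b R`, indexed by finite sets
of primes. -/
noncomputable def selbergWeight (k D : ℕ) (b R : ℝ) (S : Finset ℕ) : ℝ :=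
  (∏ p ∈ S, (-((p : ℝ) / k))) * ∑ T ∈ (sievePrimes D R).powerset with S ⊆ T,
    (∏ p ∈ T, (k : ℝ) / (p - k)) * sieveProfile b R (primeProd T)

/-- The quadratic form in the Selberg weights with local densities `γ`. -/
noncomputable def selbergForm (k D : ℕ) (b R : ℝ) (γ : ℕ → ℝ) : ℝ :=
  ∑ U ∈ (sievePrimes D R).powerset, ∑ V ∈ (sievePrimes D R).powerset,
    selbergWeight k D b R U * selbergWeight k D b R V * ∏ p ∈ U ∪ V, γ p

/-- Control of the squarefree integers with prime factors in `P`, weighted by `1 / (p - k)`, in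
multiplicative windows and in initial segments. -/
def HasLogGrowth (P : Finset ℕ) (k : ℕ) (κ C : ℝ) : Prop :=
  (∀ Z w : ℝ, 1 ≤ w →
    ∑ V ∈ P.powerset with Z / w < (primeProd V : ℝ) ∧ (primeProd V : ℝ) ≤ Z,
      ∏ p ∈ V, (1 : ℝ) / (p - k) ≤ κ * (Real.log w + C)) ∧
  ∀ t : ℝ, 1 ≤ t → ∑ V ∈ P.powerset with (primeProd V : ℝ) ≤ t, ∏ p ∈ V, (1 : ℝ) / (p - k) ≤
      κ * (Real.log t + C)

theorem exists_hasLogGrowth {k D : ℕ} (hk : 1 ≤ k) (hD : 2 * k ≤ D) :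
    ∃ C : ℝ, 0 ≤ C ∧ ∀ R : ℝ,
      HasLogGrowth (sievePrimes D R) k (sieveDensity D * Real.exp (2 * k / D)) C := by
  obtain ⟨C, hC, h⟩ := exists_sum_subsets_window_le hk hD
  have hκ : 0 ≤ sieveDensity D * Real.exp (2 * k / D) :=
    mul_nonneg (sieveDensity_pos D).le (Real.exp_pos _).le
  refine ⟨C + Real.log 2, add_nonneg hC (Real.log_nonneg one_le_two), fun R => ⟨fun Z w hw => ?_, fun t ht => ?_⟩⟩
  · refine (h R Z w hw).trans (mul_le_mul_of_nonneg_left ?_ hκ)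
    linarith [Real.log_nonneg one_le_two]
  -- An initial segment is a window of ratio 2t: its lower end is 1/2, below every product. The
  -- factor 2 is why log 2 enters the constant.
  · have h1 := h R t (t * 2) (by linarith)
    rw [Real.log_mul (by linarith) two_ne_zero] at h1
    have e : Real.log t + (C + Real.log 2) = Real.log t + Real.log 2 + C := by ring
    rw [e]
    refine le_trans (le_of_eq ?_) h1
    refine Finset.sum_congr (Finset.filter_congr fun V hV => ?_) fun _ _ => rfl
    have h2 : (1 : ℝ) ≤ primeProd V := by
      exact_mod_cast primeProd_pos (one_le_of_mem_subset_sievePrimes (Finset.mem_powerset.1 hV))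
    have h3 : t / (t * 2) = 1 / 2 := by field_simp
    rw [h3]
    exact ⟨fun h => ⟨by linarith, h⟩, fun h => h.2⟩

section profile

variable {b R : ℝ}

theorem sieveProfile_nonneg (hb : 0 ≤ b) (hR : 1 < R) (n : ℕ) (hn : 1 ≤ n) :
    0 ≤ sieveProfile b R n := by
  rw [sieveProfile]
  have hn' : (1 : ℝ) ≤ n := by exact_mod_cast hn
  split_ifs with h
  · have h1 := Real.log_pos hR
    have h2 : 0 ≤ Real.log (R / n) := Real.log_nonneg ((one_le_div (by linarith)).2 h)
    positivity
  · exact le_rfl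

theorem sieveProfile_antitone (hb : 0 ≤ b) (hR : 1 < R) (m n : ℕ) (hm : 1 ≤ m) (hmn : m ≤ n) :
    sieveProfile b R n ≤ sieveProfile b R m := by
  have hm' : (1 : ℝ) ≤ m := by exact_mod_cast hm
  have hmn' : (m : ℝ) ≤ n := by exact_mod_cast hmn
  by_cases h : (n : ℝ) ≤ R
  · rw [sieveProfile, sieveProfile, if_pos h, if_pos (hmn'.trans h)]
    have h1 := Real.log_pos hR
    have h2 : Real.log (R / n) ≤ Real.log (R / m) :=
      Real.log_le_log (div_pos (by linarith) (by linarith))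
        (div_le_div_of_nonneg_left (by linarith) (by linarith) hmn')
    have h3 : 0 ≤ b / Real.log R := by positivity
    have := mul_le_mul_of_nonneg_left h2 h3
    linarith
  · rw [sieveProfile, if_neg h]
    exact sieveProfile_nonneg hb hR m hm

theorem sieveProfile_eq_logPow (n : ℕ) (hn : 1 ≤ n) :
    sieveProfile b R n = logPow 0 0 (R / n) + b / Real.log R * logPow 0 1 (R / n) := by
  have hn' : (0 : ℝ) < n := by exact_mod_cast hn
  rw [sieveProfile, logPow, logPow]
  by_cases h : (n : ℝ) ≤ R
  · rw [if_pos h, if_pos ((one_le_div hn').2 h), if_pos ((one_le_div hn').2 h)]; simp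
  · rw [if_neg h, if_neg (fun h' => h ((one_le_div hn').1 h')),
      if_neg (fun h' => h ((one_le_div hn').1 h'))]; simp

theorem sieveProfile_le (hb : 0 ≤ b) (hR : 1 < R) (n : ℕ) (hn : 1 ≤ n) :
    sieveProfile b R n ≤ (1 + b) * logPow 0 0 (R / n) := by
  rw [sieveProfile_eq_logPow n hn, logPow, logPow]
  split_ifs with h
  · have h1 := Real.log_pos hR
    have hn' : (1 : ℝ) ≤ n := by exact_mod_cast hn
    have h2 : Real.log (R / n) ≤ Real.log R :=
      Real.log_le_log (by linarith) (div_le_self (by linarith) hn')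
    have h3 : b / Real.log R * Real.log (R / n) ≤ b := by
      rw [div_mul_eq_mul_div, div_le_iff₀ h1]
      exact mul_le_mul_of_nonneg_left h2 hb
    simp only [add_zero, pow_zero, pow_one, mul_one]
    linarith
  · simp

/-- The profile is linear in the logarithm, so multiplying by q changes it by b·log q/log R, a
quantity whose square is bounded through log q/log R ≤ 1. The exception is when q·n passes the
cutoff R while n does not; there the change is at most 1 + b. -/
theorem sieveProfile_sub_sq_le (hb : 0 ≤ b) (hR : 1 < R) (n q : ℕ) (hn : 1 ≤ n) (hq : 1 ≤ q)
    (hqR : (q : ℝ) ≤ R) :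
    (sieveProfile b R n - sieveProfile b R (q * n)) ^ 2 ≤
      b ^ 2 * (Real.log q / Real.log R) * logPow 0 0 (R / n) +
        (1 + b) ^ 2 * (if R / q < (n : ℝ) ∧ (n : ℝ) ≤ R then 1 else 0) := by
  have h1 := Real.log_pos hR
  have hn' : (1 : ℝ) ≤ n := by exact_mod_cast hn
  have hq' : (1 : ℝ) ≤ q := by exact_mod_cast hq
  have hlq := Real.log_nonneg hq'
  have hlqR : Real.log q ≤ Real.log R := Real.log_le_log (by linarith) hqR
  have hl0 : 0 ≤ b ^ 2 * (Real.log q / Real.log R) * logPow 0 0 (R / n) :=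
    mul_nonneg (by positivity) (logPow_nonneg le_rfl _ _)
  rcases le_or_gt (n : ℝ) R with hnR | hnR
  · have hl1 : logPow 0 0 (R / n) = 1 := by
      rw [logPow, if_pos ((one_le_div (by linarith)).2 hnR)]; simp
    rcases le_or_gt (n : ℝ) (R / q) with h2 | h2
    · have h3 : ((q * n : ℕ) : ℝ) ≤ R := by
        push_cast; rwa [le_div_iff₀' (by linarith)] at h2
      rw [if_neg (fun h => by linarith [h.1]), mul_zero, add_zero, hl1, sieveProfile, if_pos hnR,
        sieveProfile, if_pos h3]
      push_cast
      rw [Real.log_div (by linarith) (by linarith),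
        Real.log_div (by linarith) (by positivity), Real.log_mul (by linarith) (by linarith)]
      have e : 1 + b / Real.log R * (Real.log R - Real.log n) -
          (1 + b / Real.log R * (Real.log R - (Real.log q + Real.log n))) =
          b * (Real.log q / Real.log R) := by ring
      rw [e, mul_pow, mul_one]
      refine mul_le_mul_of_nonneg_left ?_ (sq_nonneg b)
      have h4 : Real.log q / Real.log R ≤ 1 := (div_le_one h1).2 hlqR
      have h5 : 0 ≤ Real.log q / Real.log R := by positivity
      nlinarith
    · rw [if_pos ⟨h2, hnR⟩, mul_one]
      have h3 : sieveProfile b R (q * n) = 0 := by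
        rw [sieveProfile, if_neg]
        push_cast
        rw [div_lt_iff₀' (by linarith)] at h2
        linarith
      rw [h3, sub_zero]
      have h4 := sieveProfile_le hb hR n hn
      rw [hl1, mul_one] at h4
      have := pow_le_pow_left₀ (sieveProfile_nonneg hb hR n hn) h4 2
      linarith
  · have h2 : sieveProfile b R n = 0 := by rw [sieveProfile, if_neg (by linarith)]
    have h3 : sieveProfile b R (q * n) = 0 := by
      rw [sieveProfile, if_neg]
      push_cast
      nlinarith
    rw [h2, h3]
    simp only [sub_self, ne_eq, OfNat.ofNat_ne_zero, not_false_eq_true, zero_pow]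
    have : (0 : ℝ) ≤ (1 + b) ^ 2 * (if R / q < (n : ℝ) ∧ (n : ℝ) ≤ R then 1 else 0) := by
      split_ifs <;> positivity
    linarith

end profile

/-! ### Evaluation of the three quadratic forms. -/

/-- All dependence on the density sits in the factors 1 − (p/k)γ(p). They vanish for the integers,
partially cancel for the primes, and vanish away from q when divisibility by q is imposed. -/
theorem selbergForm_eq {k D : ℕ} {b R : ℝ} {γ : ℕ → ℝ} (hγ : ∀ p ∈ sievePrimes D R, γ p ≠ 0) :
    selbergForm k D b R γ = ∑ S ∈ (sievePrimes D R).powerset, (∏ p ∈ S, ((γ p)⁻¹ - 1)) *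
      ((∏ p ∈ S, (-((p : ℝ) / k * γ p))) * ∑ V ∈ (sievePrimes D R \ S).powerset,
        (∏ p ∈ S ∪ V, (k : ℝ) / (p - k)) * sieveProfile b R (primeProd (S ∪ V)) *
          ∏ p ∈ V, (1 - (p : ℝ) / k * γ p)) ^ 2 := by
  rw [selbergForm, selberg_diagonalisation _ _ hγ]
  refine Finset.sum_congr rfl fun S hS => ?_
  rw [Finset.mem_powerset] at hS
  have h1 := sum_supersets_weights (sievePrimes D R) (fun p => (p : ℝ) / k) γ
    (fun T => (∏ p ∈ T, (k : ℝ) / (p - k)) * sieveProfile b R (primeProd T)) (S := S)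
  simp only [selbergWeight]
  rw [h1, sum_supersets hS]
  congr 3
  refine Finset.sum_congr rfl fun V hV => ?_
  rw [Finset.union_sdiff_cancel_left
    ((Finset.disjoint_sdiff).mono_right (Finset.mem_powerset.1 hV))]

section forms

variable {k D : ℕ} {b R : ℝ}

theorem two_mul_le_of_mem_sievePrimes (hD : 2 * k ≤ D) {p : ℕ} (hp : p ∈ sievePrimes D R) :
    2 * (k : ℝ) ≤ p := by
  exact_mod_cast (hD.trans (mem_sievePrimes.1 hp).2.1.le)

theorem cast_lt_of_mem_sievePrimes (hD : 2 * k ≤ D) {p : ℕ} (hp : p ∈ sievePrimes D R) :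
    (k : ℝ) + 1 ≤ p := by
  have := (mem_sievePrimes.1 hp).2.1
  exact_mod_cast (by omega : k + 1 ≤ p)

/-- With γ = k/p only the empty V contributes, so the diagonal variables reduce to the prescribed
profile. -/
theorem selbergForm_natural (hk : 1 ≤ k) (hD : 2 * k ≤ D) :
    selbergForm k D b R (fun p => (k : ℝ) / p) = ∑ S ∈ (sievePrimes D R).powerset,
      (∏ p ∈ S, (k : ℝ) / (p - k)) * sieveProfile b R (primeProd S) ^ 2 := by
  have hk' : (1 : ℝ) ≤ k := by exact_mod_cast hk
  have hp0 : ∀ p ∈ sievePrimes D R, (p : ℝ) ≠ 0 := fun p hp => by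
    have := two_mul_le_of_mem_sievePrimes hD hp; linarith
  rw [selbergForm_eq fun p hp => div_ne_zero (by linarith) (hp0 p hp)]
  refine Finset.sum_congr rfl fun S hS => ?_
  rw [Finset.mem_powerset] at hS
  rw [Finset.sum_eq_single_of_mem ∅ (Finset.empty_mem_powerset _)]
  · rw [Finset.union_empty, Finset.prod_empty, mul_one, mul_pow, mul_pow, ← mul_assoc, ← mul_assoc,
      ← Finset.prod_pow, ← Finset.prod_pow, ← Finset.prod_mul_distrib, ← Finset.prod_mul_distrib]
    congr 1
    refine Finset.prod_congr rfl fun p hp => ?_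
    have h1 := hp0 p (hS hp)
    have h2 : (p : ℝ) - k ≠ 0 := by
      have := cast_lt_of_mem_sievePrimes hD (hS hp); linarith
    have h3 : (k : ℝ) ≠ 0 := by linarith
    field_simp
  · intro V hV hne
    obtain ⟨p, hp⟩ := Finset.nonempty_iff_ne_empty.2 hne
    have h1 := hp0 p (Finset.sdiff_subset (Finset.mem_powerset.1 hV hp))
    have h3 : (k : ℝ) ≠ 0 := by linarith
    rw [Finset.prod_eq_zero hp (by field_simp; ring), mul_zero]

theorem prod_dimension_nonneg (hD : 2 * k ≤ D) {S : Finset ℕ} (hS : S ⊆ sievePrimes D R) (c : ℝ)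
    (hc : 0 ≤ c) : 0 ≤ ∏ p ∈ S, c / ((p : ℝ) - k) :=
  Finset.prod_nonneg fun p hp => by
    have := cast_lt_of_mem_sievePrimes hD (hS hp)
    exact div_nonneg hc (by linarith)

theorem sum_dimension_logPow_le (hD : 2 * k ≤ D) {κ C : ℝ} (hκ : 0 ≤ κ) (hC : 0 ≤ C)
    (hG : HasLogGrowth (sievePrimes D R) k κ C) (m j : ℕ) (hR : 1 ≤ R) :
    ∑ S ∈ (sievePrimes D R).powerset,
      (∏ p ∈ S, (m : ℝ) / (p - k)) * logPow 0 j (R / primeProd S) ≤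
    κ ^ m * ((j.factorial : ℝ) / (j + m).factorial) * (Real.log R + m * C) ^ (j + m) := by
  have h := sum_pow_mul_logPow_le (P := sievePrimes D R) (one_le_of_mem_subset_sievePrimes le_rfl)
    (fun p => (1 : ℝ) / (p - k)) (fun p hp => by
      have := cast_lt_of_mem_sievePrimes hD hp
      exact div_nonneg zero_le_one (by linarith)) hκ hC le_rfl hG.2 R m j
  simp only [mul_one_div] at h
  rw [zero_add] at h
  refine h.trans (le_of_eq ?_)
  rw [logPow, if_pos hR]

/-- Expand the squared profile into log powers 0, 1, 2 and sum each in dimension k. The ratios j!/(j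
+ k)! are the beta integrals of x^j against (1 − x)^(k−1)/(k−1)!. The factor with exponent k + 2
collects the shifts of all three logarithms. -/
theorem selbergForm_natural_le (hk : 1 ≤ k) (hD : 2 * k ≤ D) {κ C : ℝ} (hκ : 0 ≤ κ) (hC : 0 ≤ C)
    (hG : HasLogGrowth (sievePrimes D R) k κ C) (hb : 0 ≤ b) (hR : 1 < R) :
    selbergForm k D b R (fun p => (k : ℝ) / p) ≤
      κ ^ k * Real.log R ^ k * (1 + k * C / Real.log R) ^ (k + 2) *
        (1 / k.factorial + 2 * b / (k + 1).factorial + 2 * b ^ 2 / (k + 2).factorial) := by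
  have hL := Real.log_pos hR
  set L := Real.log R with hLdef
  rw [selbergForm_natural hk hD]
  have h1 : ∀ S ∈ (sievePrimes D R).powerset,
      (∏ p ∈ S, (k : ℝ) / (p - k)) * sieveProfile b R (primeProd S) ^ 2 =
      (∏ p ∈ S, (k : ℝ) / (p - k)) * logPow 0 0 (R / primeProd S) +
      2 * (b / L) * ((∏ p ∈ S, (k : ℝ) / (p - k)) * logPow 0 1 (R / primeProd S)) +
      (b / L) ^ 2 * ((∏ p ∈ S, (k : ℝ) / (p - k)) * logPow 0 2 (R / primeProd S)) := by
    intro S hS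
    rw [sieveProfile_eq_logPow _
      (primeProd_pos (one_le_of_mem_subset_sievePrimes (Finset.mem_powerset.1 hS)))]
    rw [← hLdef]
    simp only [logPow]
    split_ifs
    · ring
    · ring
  rw [Finset.sum_congr rfl h1, Finset.sum_add_distrib, Finset.sum_add_distrib, ← Finset.mul_sum,
    ← Finset.mul_sum]
  have i0 := sum_dimension_logPow_le hD hκ hC hG k 0 hR.le
  have i1 := sum_dimension_logPow_le hD hκ hC hG k 1 hR.le
  have i2 := sum_dimension_logPow_le hD hκ hC hG k 2 hR.le
  rw [← hLdef] at i0 i1 i2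
  have hx : 1 ≤ 1 + k * C / L := by
    have : 0 ≤ k * C / L := by positivity
    linarith
  set x := 1 + k * C / L with hxdef
  have e : L + k * C = L * x := by rw [hxdef]; field_simp
  rw [e] at i0 i1 i2
  have hb' : 0 ≤ b / L := by positivity
  have p0 : x ^ k ≤ x ^ (k + 2) := pow_le_pow_right₀ hx (by omega)
  have p1 : x ^ (k + 1) ≤ x ^ (k + 2) := pow_le_pow_right₀ hx (by omega)
  have a0 : κ ^ k * (((0).factorial : ℝ) / (0 + k).factorial) * (L * x) ^ (0 + k) ≤
      κ ^ k * L ^ k * x ^ (k + 2) * (1 / k.factorial) := by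
    rw [zero_add, mul_pow, Nat.factorial_zero, Nat.cast_one]
    have : 0 ≤ κ ^ k * L ^ k * (1 / (k.factorial : ℝ)) := by positivity
    have := mul_le_mul_of_nonneg_left p0 this
    linarith
  have a1 : 2 * (b / L) * (κ ^ k * (((1).factorial : ℝ) / (1 + k).factorial) * (L * x) ^ (1 + k)) ≤
      κ ^ k * L ^ k * x ^ (k + 2) * (2 * b / (k + 1).factorial) := by
    have : 0 ≤ κ ^ k * L ^ k * (2 * b / ((k + 1).factorial : ℝ)) := by positivity
    have h2 := mul_le_mul_of_nonneg_left p1 this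
    have h3 : 2 * (b / L) * (κ ^ k * (((1).factorial : ℝ) / (1 + k).factorial) * (L * x) ^ (1 + k)) =
      κ ^ k * L ^ k * (2 * b / ((k + 1).factorial : ℝ)) * x ^ (k + 1) := by
      rw [add_comm 1 k, mul_pow, Nat.factorial_one, Nat.cast_one, pow_succ L]
      field_simp
    rw [h3]; linarith
  have a2 : (b / L) ^ 2 * (κ ^ k * (((2).factorial : ℝ) / (2 + k).factorial) * (L * x) ^ (2 + k)) =
      κ ^ k * L ^ k * x ^ (k + 2) * (2 * b ^ 2 / (k + 2).factorial) := by
    rw [add_comm 2 k, mul_pow, Nat.factorial_two, pow_add L]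
    push_cast
    field_simp
  have i1' := mul_le_mul_of_nonneg_left i1 (by positivity : 0 ≤ 2 * (b / L))
  have i2' := mul_le_mul_of_nonneg_left i2 (by positivity : 0 ≤ (b / L) ^ 2)
  rw [a2] at i2'
  linarith [i0.trans a0, i1'.trans a1]

theorem selbergWeight_eq_zero (hD : ∀ p ∈ sievePrimes D R, 1 ≤ p) {S : Finset ℕ}
    (hSR : R < primeProd S) : selbergWeight k D b R S = 0 := by
  rw [selbergWeight, Finset.sum_eq_zero, mul_zero]
  intro T hT
  rw [Finset.mem_filter, Finset.mem_powerset] at hT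
  have h1 : (primeProd S : ℝ) ≤ primeProd T := by
    exact_mod_cast primeProd_le_of_subset hT.2 fun p hp => hD p (hT.1 hp)
  rw [sieveProfile, if_neg (by linarith), mul_zero]

/-- The prefactor p/k combines with k/(p − k) into 1 + k/(p − k), exactly what restores the primes
of S in the remaining sum. The weight is therefore bounded by the complete sum, the weight at the
empty set. -/
theorem abs_selbergWeight_le (hk : 1 ≤ k) (hD : 2 * k ≤ D) {κ C : ℝ} (hκ : 0 ≤ κ) (hC : 0 ≤ C)
    (hG : HasLogGrowth (sievePrimes D R) k κ C) (hb : 0 ≤ b) (hR : 1 < R) {S : Finset ℕ}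
    (hS : S ⊆ sievePrimes D R) :
    |selbergWeight k D b R S| ≤ (1 + b) * (κ ^ k * (Real.log R + k * C) ^ k) := by
  have hk' : (1 : ℝ) ≤ k := by exact_mod_cast hk
  have hP := one_le_of_mem_subset_sievePrimes (D := D) (R := R) le_rfl
  have hpos : ∀ p ∈ sievePrimes D R, 0 ≤ (k : ℝ) / (p - k) := fun p hp => by
    have := cast_lt_of_mem_sievePrimes hD hp
    exact div_nonneg (by linarith) (by linarith)
  rw [selbergWeight, sum_supersets hS, abs_mul, Finset.abs_prod]
  have h1 : ∑ V ∈ (sievePrimes D R \ S).powerset, (∏ p ∈ S ∪ V, (k : ℝ) / (p - k)) *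
      sieveProfile b R (primeProd (S ∪ V)) = (∏ p ∈ S, (k : ℝ) / (p - k)) *
      ∑ V ∈ (sievePrimes D R \ S).powerset, (∏ p ∈ V, (k : ℝ) / (p - k)) *
        sieveProfile b R (primeProd S * primeProd V) := by
    rw [Finset.mul_sum]
    refine Finset.sum_congr rfl fun V hV => ?_
    have hd := (Finset.disjoint_sdiff).mono_right (Finset.mem_powerset.1 hV)
    rw [Finset.prod_union hd, primeProd_union hd, mul_assoc]
  have hnn : 0 ≤ ∑ V ∈ (sievePrimes D R \ S).powerset, (∏ p ∈ V, (k : ℝ) / (p - k)) *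
      sieveProfile b R (primeProd S * primeProd V) := by
    refine Finset.sum_nonneg fun V hV => ?_
    have hV' := (Finset.mem_powerset.1 hV).trans Finset.sdiff_subset
    refine mul_nonneg (Finset.prod_nonneg fun p hp => hpos p (hV' hp))
      (sieveProfile_nonneg hb hR _ ?_)
    exact Nat.mul_pos (primeProd_pos fun p hp => hP p (hS hp)) (primeProd_pos fun p hp => hP p (hV' hp))
  rw [h1, abs_mul, abs_of_nonneg hnn, abs_of_nonneg (Finset.prod_nonneg fun p hp => hpos p (hS hp)),
    ← mul_assoc, ← Finset.prod_mul_distrib]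
  have h2 : ∏ p ∈ S, |(-((p : ℝ) / k))| * ((k : ℝ) / (p - k)) = ∏ p ∈ S, (1 + (k : ℝ) / (p - k)) := by
    refine Finset.prod_congr rfl fun p hp => ?_
    have := cast_lt_of_mem_sievePrimes hD (hS hp)
    have h3 : (p : ℝ) - k ≠ 0 := by linarith
    rw [abs_neg, abs_of_nonneg (by positivity)]
    field_simp; ring
  rw [h2]
  refine (prod_one_add_mul_sum_le hS hP _ hpos _ (sieveProfile_antitone hb hR)).trans ?_
  have h3 : ∑ S ∈ (sievePrimes D R).powerset, (∏ p ∈ S, (k : ℝ) / (p - k)) *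
      sieveProfile b R (primeProd S) ≤ (1 + b) * ∑ S ∈ (sievePrimes D R).powerset,
        (∏ p ∈ S, (k : ℝ) / (p - k)) * logPow 0 0 (R / primeProd S) := by
    rw [Finset.mul_sum]
    refine Finset.sum_le_sum fun T hT => ?_
    rw [Finset.mem_powerset] at hT
    have := mul_le_mul_of_nonneg_left (sieveProfile_le hb hR _ (primeProd_pos fun p hp => hP p (hT hp)))
      (Finset.prod_nonneg fun p hp => hpos p (hT hp))
    linarith
  refine h3.trans (mul_le_mul_of_nonneg_left ?_ (by linarith))
  refine (sum_dimension_logPow_le hD hκ hC hG k 0 hR.le).trans ?_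
  rw [zero_add, mul_right_comm]
  have hL := Real.log_pos hR
  refine mul_le_of_le_one_right (by positivity) ?_
  rw [Nat.factorial_zero, Nat.cast_one]
  exact (div_le_one (by positivity)).2 (by exact_mod_cast Nat.one_le_iff_ne_zero.2 (Nat.factorial_ne_zero k))

end forms

section forms

variable {k D : ℕ} {b R : ℝ}

/-- It compares the local factor of the iterated lower bound with the one in the prime form.
Bernoulli's inequality is applied to 1 − 1/p, the inverse of 1 + 1/(p − 1). -/
theorem one_add_inv_pow_sub_one_le {k p : ℕ} (hk : 1 ≤ k) (hp : k < p) :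
    (1 + (1 : ℝ) / (p - 1)) ^ (k - 1) - 1 ≤ ((k : ℝ) - 1) / (p - k) := by
  have hk' : (1 : ℝ) ≤ k := by exact_mod_cast hk
  have hp' : (k : ℝ) + 1 ≤ p := by exact_mod_cast hp
  have hp0 : (0 : ℝ) < p := by linarith
  have h1 : 1 + ((k - 1 : ℕ) : ℝ) * (-(1 / p)) ≤ (1 + -(1 / (p : ℝ))) ^ (k - 1) :=
    one_add_mul_le_pow (by
      have : 1 / (p : ℝ) ≤ 1 := by rw [div_le_one hp0]; linarith
      linarith) _
  rw [Nat.cast_sub hk, Nat.cast_one] at h1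
  have h2 : (p - k : ℝ) / (p - 1) ≤ 1 + ((k : ℝ) - 1) * (-(1 / p)) := by
    have e : 1 + ((k : ℝ) - 1) * (-(1 / p)) = (p - k + 1) / p := by field_simp; ring
    rw [e, div_le_div_iff₀ (by linarith) hp0]
    nlinarith
  have h3 : (1 + (1 : ℝ) / (p - 1)) * (1 + -(1 / (p : ℝ))) = 1 := by
    have : (p : ℝ) - 1 ≠ 0 := by linarith
    field_simp; ring
  have h4 : (1 + (1 : ℝ) / (p - 1)) ^ (k - 1) * (1 + -(1 / (p : ℝ))) ^ (k - 1) = 1 := by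
    rw [← mul_pow, h3, one_pow]
  have h5 : 0 ≤ (1 + (1 : ℝ) / (p - 1)) ^ (k - 1) := by
    have : 0 ≤ (1 : ℝ) / (p - 1) := div_nonneg zero_le_one (by linarith)
    positivity
  have h6 := mul_le_mul_of_nonneg_left (h2.trans h1) h5
  rw [h4, mul_div_assoc', div_le_one (by linarith)] at h6
  rw [le_div_iff₀ (by linarith)]
  linarith

/-- The quadratic form with the densities of the primes, diagonalised. -/
theorem selbergForm_prime (hk : 2 ≤ k) (hD : 2 * k ≤ D) :
    selbergForm k D b R (fun p => ((k : ℝ) - 1) / (p - 1)) =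
      ∑ S ∈ (sievePrimes D R).powerset,
        (∏ p ∈ S, ((k : ℝ) - 1) / (p - k)) * ((∏ p ∈ S, (1 + (1 : ℝ) / (p - 1))) *
          ∑ V ∈ (sievePrimes D R \ S).powerset, (∏ p ∈ V, (1 : ℝ) / (p - 1)) *
            sieveProfile b R (primeProd S * primeProd V)) ^ 2 := by
  have hk' : (2 : ℝ) ≤ k := by exact_mod_cast hk
  have hpk : ∀ p ∈ sievePrimes D R, (k : ℝ) + 1 ≤ p := fun p hp => cast_lt_of_mem_sievePrimes hD hp
  rw [selbergForm_eq fun p hp => div_ne_zero (by linarith) (by linarith [hpk p hp])]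
  refine Finset.sum_congr rfl fun S hS => ?_
  rw [Finset.mem_powerset] at hS
  have h1 : ∑ V ∈ (sievePrimes D R \ S).powerset,
        (∏ p ∈ S ∪ V, (k : ℝ) / (p - k)) * sieveProfile b R (primeProd (S ∪ V)) *
          ∏ p ∈ V, (1 - (p : ℝ) / k * (((k : ℝ) - 1) / (p - 1))) =
      (∏ p ∈ S, (k : ℝ) / (p - k)) * ∑ V ∈ (sievePrimes D R \ S).powerset,
        (∏ p ∈ V, (1 : ℝ) / (p - 1)) * sieveProfile b R (primeProd S * primeProd V) := by
    rw [Finset.mul_sum]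
    refine Finset.sum_congr rfl fun V hV => ?_
    rw [Finset.mem_powerset] at hV
    have hd := (Finset.disjoint_sdiff).mono_right hV
    rw [Finset.prod_union hd, primeProd_union hd]
    -- For the density of the primes the deviation factor is (p − k)/(k(p − 1)), so the
    -- k-dimensional inner sum collapses to a one-dimensional one.
    have h2 : (∏ p ∈ V, (k : ℝ) / (p - k)) *
        ∏ p ∈ V, (1 - (p : ℝ) / k * (((k : ℝ) - 1) / (p - 1))) = ∏ p ∈ V, (1 : ℝ) / (p - 1) := by
      rw [← Finset.prod_mul_distrib]
      refine Finset.prod_congr rfl fun p hp => ?_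
      have h3 := hpk p (Finset.sdiff_subset (hV hp))
      have h4 : (p : ℝ) - k ≠ 0 := by linarith
      have h5 : (p : ℝ) - 1 ≠ 0 := by linarith
      have h6 : (k : ℝ) ≠ 0 := by linarith
      field_simp; ring
    rw [← h2]; ring
  rw [h1, mul_pow, mul_pow, mul_pow, ← mul_assoc, ← mul_assoc, ← mul_assoc,
    ← Finset.prod_pow, ← Finset.prod_pow, ← Finset.prod_pow, ← Finset.prod_mul_distrib,
    ← Finset.prod_mul_distrib, ← Finset.prod_mul_distrib]
  congr 1
  refine Finset.prod_congr rfl fun p hp => ?_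
  have h3 := hpk p (hS hp)
  have h4 : (p : ℝ) - k ≠ 0 := by linarith
  have h5 : (p : ℝ) - 1 ≠ 0 := by linarith
  have h6 : (k : ℝ) ≠ 0 := by linarith
  have h7 : (k : ℝ) - 1 ≠ 0 := by linarith
  field_simp
  ring

/-- A one-dimensional sum integrates the profile once: 1 + bx becomes x + bx²/2. -/
theorem le_sum_inv_mul_sieveProfile (hDR : (D : ℝ) ≤ R) (hb : 0 ≤ b) (hR : 1 < R) {n : ℕ}
    (hn : 1 ≤ n) :
    sieveDensity D * (logPow 0 1 (R / n) + b / Real.log R / 2 * logPow 0 2 (R / n)) ≤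
      ∑ V ∈ (sievePrimes D R).powerset, (∏ p ∈ V, (1 : ℝ) / (p - 1)) *
        sieveProfile b R (n * primeProd V) := by
  have hn' : (1 : ℝ) ≤ n := by exact_mod_cast hn
  have hY : R / n ≤ R := div_le_self (by linarith) hn'
  have h0 := mul_logPow_le_sum (D := D) hDR hY 0
  have h1 := mul_logPow_le_sum (D := D) hDR hY 1
  have hL := Real.log_pos hR
  have h1' := mul_le_mul_of_nonneg_left h1 (by positivity : 0 ≤ b / Real.log R)
  have e : ∑ V ∈ (sievePrimes D R).powerset, (∏ p ∈ V, (1 : ℝ) / (p - 1)) *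
        sieveProfile b R (n * primeProd V) =
      ∑ V ∈ (sievePrimes D R).powerset,
        (∏ p ∈ V, (1 : ℝ) / (p - 1)) * logPow 0 0 (R / n / primeProd V) + b / Real.log R *
      ∑ V ∈ (sievePrimes D R).powerset,
        (∏ p ∈ V, (1 : ℝ) / (p - 1)) * logPow 0 1 (R / n / primeProd V) := by
    rw [Finset.mul_sum, ← Finset.sum_add_distrib]
    refine Finset.sum_congr rfl fun V hV => ?_
    rw [sieveProfile_eq_logPow _ (Nat.mul_pos hn
      (primeProd_pos (one_le_of_mem_subset_sievePrimes (Finset.mem_powerset.1 hV))))]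
    push_cast
    rw [div_div]; ring
  rw [e]
  refine le_trans (le_of_eq ?_) (add_le_add h0 h1')
  norm_num
  ring

/-- The factor ∏ (1 + 1/(p − 1)) over S pays for lifting the condition that V avoid S, so the inner
sum is at least the integrated profile. Its square, with log powers 2, 3, 4, is then summed in
dimension k − 1. -/
theorem le_selbergForm_prime (hk : 2 ≤ k) (hD : 2 * k ≤ D) (hDR : (D : ℝ) ≤ R) (hb : 0 ≤ b)
    (hR : 1 < R) :
    sieveDensity D ^ (k + 1) * Real.log R ^ (k + 1) *
      (2 / (k + 1).factorial + 6 * b / (k + 2).factorial + 6 * b ^ 2 / (k + 3).factorial) ≤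
      selbergForm k D b R (fun p => ((k : ℝ) - 1) / (p - 1)) := by
  have hk' : (2 : ℝ) ≤ k := by exact_mod_cast hk
  have hL := Real.log_pos hR
  set L := Real.log R with hLdef
  set κ := sieveDensity D with hκdef
  have hκ : 0 < κ := sieveDensity_pos D
  have hP := one_le_of_mem_subset_sievePrimes (D := D) (R := R) le_rfl
  have hpk : ∀ p ∈ sievePrimes D R, (k : ℝ) + 1 ≤ p := fun p hp => cast_lt_of_mem_sievePrimes hD hp
  have hg : ∀ p ∈ sievePrimes D R, (0 : ℝ) ≤ 1 / (p - 1) := fun p hp =>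
    div_nonneg zero_le_one (by linarith [hpk p hp])
  rw [selbergForm_prime hk hD]
  have h1 : ∀ S ∈ (sievePrimes D R).powerset,
      κ ^ 2 * ((∏ p ∈ S, ((1 + (1 : ℝ) / (p - 1)) ^ (k - 1) - 1)) * logPow 0 2 (R / primeProd S)) +
      κ ^ 2 * (b / L) * ((∏ p ∈ S, ((1 + (1 : ℝ) / (p - 1)) ^ (k - 1) - 1)) *
        logPow 0 3 (R / primeProd S)) +
      κ ^ 2 * (b / L) ^ 2 / 4 * ((∏ p ∈ S, ((1 + (1 : ℝ) / (p - 1)) ^ (k - 1) - 1)) *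
        logPow 0 4 (R / primeProd S)) ≤
      (∏ p ∈ S, ((k : ℝ) - 1) / (p - k)) * ((∏ p ∈ S, (1 + (1 : ℝ) / (p - 1))) *
          ∑ V ∈ (sievePrimes D R \ S).powerset, (∏ p ∈ V, (1 : ℝ) / (p - 1)) *
            sieveProfile b R (primeProd S * primeProd V)) ^ 2 := by
    intro S hS
    rw [Finset.mem_powerset] at hS
    have hS1 : 1 ≤ primeProd S := primeProd_pos fun p hp => hP p (hS hp)
    have hF : ∀ m n : ℕ, 1 ≤ m → m ≤ n →
        sieveProfile b R (primeProd S * n) ≤ sieveProfile b R (primeProd S * m) := fun m n hm hmn =>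
      sieveProfile_antitone hb hR _ _ (Nat.mul_pos hS1 hm) (Nat.mul_le_mul_left _ hmn)
    have h2 := (le_sum_inv_mul_sieveProfile hDR hb hR hS1).trans
      (sum_le_prod_one_add_mul_sum hS hP (fun p => (1 : ℝ) / (p - 1)) hg
        (fun n => sieveProfile b R (primeProd S * n)) hF)
    have h3 : 0 ≤ κ * (logPow 0 1 (R / primeProd S) + b / L / 2 * logPow 0 2 (R / primeProd S)) :=
      mul_nonneg hκ.le (add_nonneg (logPow_nonneg le_rfl _ _)
        (mul_nonneg (by positivity) (logPow_nonneg le_rfl _ _)))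
    have h4 := pow_le_pow_left₀ h3 h2 2
    have h5 : ∏ p ∈ S, ((1 + (1 : ℝ) / (p - 1)) ^ (k - 1) - 1) ≤ ∏ p ∈ S, ((k : ℝ) - 1) / (p - k) := by
      refine Finset.prod_le_prod (fun p hp => ?_) fun p hp => ?_
      · have := one_le_pow₀ (n := k - 1) (by linarith [hg p (hS hp)] : (1 : ℝ) ≤ 1 + (1 : ℝ) / (p - 1))
        linarith
      · refine one_add_inv_pow_sub_one_le (by omega) ?_
        have := hpk p (hS hp)
        exact_mod_cast (by linarith : (k : ℝ) < p)
    have h6 : 0 ≤ ∏ p ∈ S, ((k : ℝ) - 1) / (p - k) := prod_dimension_nonneg hD hS _ (by linarith)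
    refine le_trans (le_of_eq ?_) (mul_le_mul h5 h4 (sq_nonneg _) h6)
    simp only [logPow]
    split_ifs <;> ring
  refine le_trans ?_ (Finset.sum_le_sum h1)
  rw [Finset.sum_add_distrib, Finset.sum_add_distrib, ← Finset.mul_sum, ← Finset.mul_sum,
    ← Finset.mul_sum]
  have hR0 : 0 ≤ R := by linarith
  have j2 := pow_mul_logPow_le_sum hDR le_rfl hR0 (k - 1) 2
  have j3 := pow_mul_logPow_le_sum hDR le_rfl hR0 (k - 1) 3
  have j4 := pow_mul_logPow_le_sum hDR le_rfl hR0 (k - 1) 4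
  have e2 : 2 + (k - 1) = k + 1 := by omega
  have e3 : 3 + (k - 1) = k + 2 := by omega
  have e4 : 4 + (k - 1) = k + 3 := by omega
  have f3 : Nat.factorial 3 = 6 := rfl
  have f4 : Nat.factorial 4 = 24 := rfl
  rw [e2, logPow, if_pos hR.le, Nat.factorial_two] at j2
  rw [e3, logPow, if_pos hR.le, f3] at j3
  rw [e4, logPow, if_pos hR.le, f4] at j4
  rw [← hLdef, ← hκdef] at j2 j3 j4
  have j2' := mul_le_mul_of_nonneg_left j2 (by positivity : 0 ≤ κ ^ 2)
  have j3' := mul_le_mul_of_nonneg_left j3 (by positivity : 0 ≤ κ ^ 2 * (b / L))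
  have j4' := mul_le_mul_of_nonneg_left j4 (by positivity : 0 ≤ κ ^ 2 * (b / L) ^ 2 / 4)
  refine le_trans (le_of_eq ?_) (add_le_add (add_le_add j2' j3') j4')
  have eκ : κ ^ (k + 1) = κ ^ (k - 1) * κ ^ 2 := by rw [← pow_add]; congr 1; omega
  have eL2 : L ^ (k + 2) = L ^ (k + 1) * L := by ring
  have eL3 : L ^ (k + 3) = L ^ (k + 1) * L ^ 2 := by ring
  rw [eκ, add_zero, eL2, eL3]
  push_cast
  field_simp
  ring

/-- The quadratic form when divisibility by `q` is imposed. -/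
theorem selbergForm_update (hk : 1 ≤ k) (hD : 2 * k ≤ D) {q : ℕ} (hq : q ∈ sievePrimes D R) :
    selbergForm k D b R (fun p => if p = q then 1 else (k : ℝ) / p) =
      ∑ S ∈ (sievePrimes D R).powerset with q ∉ S, (∏ p ∈ S, (k : ℝ) / (p - k)) *
        (sieveProfile b R (primeProd S) - sieveProfile b R (q * primeProd S)) ^ 2 := by
  have hk' : (1 : ℝ) ≤ k := by exact_mod_cast hk
  have hpk : ∀ p ∈ sievePrimes D R, (k : ℝ) + 1 ≤ p := fun p hp => cast_lt_of_mem_sievePrimes hD hp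
  rw [selbergForm_eq, Finset.sum_filter]
  swap
  · intro p hp
    split_ifs
    · exact one_ne_zero
    · exact div_ne_zero (by linarith) (by linarith [hpk p hp])
  refine Finset.sum_congr rfl fun S hS => ?_
  rw [Finset.mem_powerset] at hS
  by_cases hqS : q ∈ S
  -- The diagonal coefficient 1/γ − 1 is zero at q.
  · rw [if_neg (not_not.2 hqS), Finset.prod_eq_zero hqS (by simp), zero_mul]
  · rw [if_pos hqS]
    have hne : ∀ p ∈ S, p ≠ q := fun p hp h => hqS (h ▸ hp)
    -- Any V containing a prime other than q carries a vanishing factor. The two remaining sets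
    -- enter with opposite signs and produce the difference of the profile at S and at q·S.
    have hsub : ({∅, {q}} : Finset (Finset ℕ)) ⊆ (sievePrimes D R \ S).powerset := by
      intro V hV
      rw [Finset.mem_insert, Finset.mem_singleton] at hV
      rw [Finset.mem_powerset]
      rcases hV with rfl | rfl
      · exact Finset.empty_subset _
      · exact Finset.singleton_subset_iff.2 (Finset.mem_sdiff.2 ⟨hq, hqS⟩)
    rw [← Finset.sum_subset hsub]
    · rw [Finset.sum_pair (by simp), Finset.union_empty, Finset.prod_empty, mul_one,
        Finset.prod_singleton, if_pos rfl, Finset.union_comm S {q}, ← Finset.insert_eq,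
        Finset.prod_insert hqS, primeProd_insert hqS]
      have h1 : (k : ℝ) / (q - k) * (∏ p ∈ S, (k : ℝ) / (p - k)) *
          sieveProfile b R (q * primeProd S) * (1 - (q : ℝ) / k * 1) =
          - ((∏ p ∈ S, (k : ℝ) / (p - k)) * sieveProfile b R (q * primeProd S)) := by
        have h2 : (q : ℝ) - k ≠ 0 := by linarith [hpk q hq]
        have h3 : (k : ℝ) ≠ 0 := by linarith
        field_simp; ring
      rw [h1, ← sub_eq_add_neg, ← mul_sub, mul_pow, mul_pow, ← mul_assoc, ← mul_assoc,
        ← Finset.prod_pow, ← Finset.prod_pow, ← Finset.prod_mul_distrib, ← Finset.prod_mul_distrib]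
      congr 1
      refine Finset.prod_congr rfl fun p hp => ?_
      rw [if_neg (hne p hp)]
      have h1 := hpk p (hS hp)
      have h2 : (p : ℝ) - k ≠ 0 := by linarith
      have h3 : (k : ℝ) ≠ 0 := by linarith
      have h4 : (p : ℝ) ≠ 0 := by linarith
      field_simp
    · intro V hV hne
      rw [Finset.mem_powerset] at hV
      rw [Finset.mem_insert, Finset.mem_singleton, not_or] at hne
      have : ∃ p ∈ V, p ≠ q := by
        by_contra h
        push Not at h
        have : V ⊆ {q} := fun p hp => Finset.mem_singleton.2 (h p hp)
        rcases Finset.subset_singleton_iff.1 this with h | h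
        exacts [hne.1 h, hne.2 h]
      obtain ⟨p, hp, hpq⟩ := this
      have h3 : (k : ℝ) ≠ 0 := by linarith
      have h4 : (p : ℝ) ≠ 0 := by linarith [hpk p (Finset.sdiff_subset (hV hp))]
      rw [Finset.prod_eq_zero hp (by rw [if_neg hpq]; field_simp; ring), mul_zero]

/-- Split k/(p − k) into (k − 1)/(p − k) and 1/(p − k). For a fixed set from the first part, the
window condition confines the second to a window of the same ratio, so one power of log R is
replaced by log w + C. -/
theorem sum_dimension_window_le (hk : 1 ≤ k) (hD : 2 * k ≤ D) {κ C : ℝ} (hκ : 0 ≤ κ) (hC : 0 ≤ C)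
    (hG : HasLogGrowth (sievePrimes D R) k κ C) (hR : 1 < R) {w : ℝ} (hw : 1 ≤ w) :
    ∑ S ∈ (sievePrimes D R).powerset, (∏ p ∈ S, (k : ℝ) / (p - k)) *
      (if R / w < (primeProd S : ℝ) ∧ (primeProd S : ℝ) ≤ R then 1 else 0) ≤
      κ ^ k * (Real.log R + k * C) ^ (k - 1) * (Real.log w + C) := by
  have hL := Real.log_pos hR
  have hlw := Real.log_nonneg hw
  have hP := one_le_of_mem_subset_sievePrimes (D := D) (R := R) le_rfl
  have hpk : ∀ p ∈ sievePrimes D R, (k : ℝ) + 1 ≤ p := fun p hp => cast_lt_of_mem_sievePrimes hD hp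
  have h1 := sum_prod_add_le (sievePrimes D R) (fun p => ((k - 1 : ℕ) : ℝ) / (p - k))
    (fun p => (1 : ℝ) / (p - k)) (fun p hp => div_nonneg (Nat.cast_nonneg _) (by linarith [hpk p hp]))
    (fun p hp => div_nonneg zero_le_one (by linarith [hpk p hp]))
    (fun n => if R / w < (n : ℝ) ∧ (n : ℝ) ≤ R then 1 else 0) (fun n => by split_ifs <;> norm_num)
  have e : ∀ p : ℕ, ((k - 1 : ℕ) : ℝ) / ((p : ℝ) - k) + 1 / (p - k) = k / (p - k) := by
    intro p
    rw [← add_div, Nat.cast_sub hk]; simp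
  simp only [e] at h1
  refine h1.trans ?_
  have h2 : ∀ U ∈ (sievePrimes D R).powerset, ∑ V ∈ (sievePrimes D R).powerset,
      (∏ p ∈ U, ((k - 1 : ℕ) : ℝ) / (p - k)) * (∏ p ∈ V, (1 : ℝ) / (p - k)) *
      (if R / w < ((primeProd U * primeProd V : ℕ) : ℝ) ∧
        ((primeProd U * primeProd V : ℕ) : ℝ) ≤ R then 1 else 0) ≤
      ((∏ p ∈ U, ((k - 1 : ℕ) : ℝ) / (p - k)) * logPow 0 0 (R / primeProd U)) *
        (κ * (Real.log w + C)) := by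
    intro U hU
    rw [Finset.mem_powerset] at hU
    have hU1 : (1 : ℝ) ≤ primeProd U := by exact_mod_cast primeProd_pos fun p hp => hP p (hU hp)
    have hU0 : 0 ≤ ∏ p ∈ U, ((k - 1 : ℕ) : ℝ) / ((p : ℝ) - k) :=
      prod_dimension_nonneg hD hU _ (Nat.cast_nonneg _)
    have h3 : ∑ V ∈ (sievePrimes D R).powerset,
        (∏ p ∈ U, ((k - 1 : ℕ) : ℝ) / (p - k)) * (∏ p ∈ V, (1 : ℝ) / (p - k)) *
        (if R / w < ((primeProd U * primeProd V : ℕ) : ℝ) ∧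
          ((primeProd U * primeProd V : ℕ) : ℝ) ≤ R then 1 else 0) =
        (∏ p ∈ U, ((k - 1 : ℕ) : ℝ) / (p - k)) * ∑ V ∈ (sievePrimes D R).powerset with
          R / primeProd U / w < (primeProd V : ℝ) ∧ (primeProd V : ℝ) ≤ R / primeProd U,
          ∏ p ∈ V, (1 : ℝ) / (p - k) := by
      rw [Finset.sum_filter, Finset.mul_sum]
      refine Finset.sum_congr rfl fun V _ => ?_
      have : (R / primeProd U / w < (primeProd V : ℝ) ∧ (primeProd V : ℝ) ≤ R / primeProd U) ↔
          (R / w < ((primeProd U * primeProd V : ℕ) : ℝ) ∧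
          ((primeProd U * primeProd V : ℕ) : ℝ) ≤ R) := by
        push_cast
        rw [div_right_comm, div_lt_iff₀' (by linarith : (0 : ℝ) < primeProd U),
          le_div_iff₀' (by linarith : (0 : ℝ) < primeProd U)]
      simp only [this]
      split_ifs <;> ring
    rw [h3, mul_assoc]
    refine mul_le_mul_of_nonneg_left ?_ hU0
    by_cases hUR : (primeProd U : ℝ) ≤ R
    · rw [logPow, if_pos ((one_le_div (by linarith)).2 hUR), pow_zero, one_mul]
      exact hG.1 _ w hw
    · rw [logPow, if_neg (fun h => hUR ((one_le_div (by linarith)).1 h)), zero_mul]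
      refine le_of_eq (Finset.sum_eq_zero fun V hV => ?_)
      rw [Finset.mem_filter, Finset.mem_powerset] at hV
      exfalso
      have hV1 : (1 : ℝ) ≤ primeProd V := by exact_mod_cast primeProd_pos fun p hp => hP p (hV.1 hp)
      exact hUR ((one_le_div (by linarith)).1 (hV1.trans hV.2.2))
  refine (Finset.sum_le_sum h2).trans ?_
  rw [← Finset.sum_mul]
  have h4 := sum_dimension_logPow_le hD hκ hC hG (k - 1) 0 hR.le
  have h5 := mul_le_mul_of_nonneg_right h4
    (mul_nonneg hκ (add_nonneg hlw hC) : 0 ≤ κ * (Real.log w + C))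
  refine h5.trans ?_
  have eκ : κ ^ k = κ ^ (k - 1) * κ := by rw [← pow_succ]; congr 1; omega
  have h6 : (((0).factorial : ℝ) / (0 + (k - 1)).factorial) ≤ 1 := by
    rw [Nat.factorial_zero, Nat.cast_one]
    exact (div_le_one (by positivity)).2 (by exact_mod_cast Nat.one_le_iff_ne_zero.2 (Nat.factorial_ne_zero _))
  have h7 : (Real.log R + ((k - 1 : ℕ) : ℝ) * C) ^ (0 + (k - 1)) ≤ (Real.log R + k * C) ^ (k - 1) := by
    rw [zero_add]
    refine pow_le_pow_left₀ (by positivity) ?_ _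
    have : ((k - 1 : ℕ) : ℝ) ≤ k := by exact_mod_cast Nat.sub_le k 1
    have := mul_le_mul_of_nonneg_right this hC
    linarith
  have h8 : κ ^ (k - 1) * (((0).factorial : ℝ) / (0 + (k - 1)).factorial) *
      (Real.log R + ((k - 1 : ℕ) : ℝ) * C) ^ (0 + (k - 1)) ≤
      κ ^ (k - 1) * 1 * (Real.log R + k * C) ^ (k - 1) := by
    refine mul_le_mul (mul_le_mul_of_nonneg_left h6 (by positivity)) h7 (by positivity) (by positivity)
  calc _ ≤ κ ^ (k - 1) * 1 * (Real.log R + k * C) ^ (k - 1) * (κ * (Real.log w + C)) :=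
        mul_le_mul_of_nonneg_right h8 (mul_nonneg hκ (add_nonneg hlw hC))
    _ = _ := by rw [eκ]; ring

/-- The change of the profile contributes log q/log R times the mass, and its jump at R contributes
a window of ratio q, of relative size (log q + C)/log R. -/
theorem selbergForm_update_le (hk : 1 ≤ k) (hD : 2 * k ≤ D) {κ C : ℝ} (hκ : 0 ≤ κ) (hC : 0 ≤ C)
    (hG : HasLogGrowth (sievePrimes D R) k κ C) (hb : 0 ≤ b) (hR : 1 < R) {q : ℕ}
    (hq : q ∈ sievePrimes D R) :
    selbergForm k D b R (fun p => if p = q then 1 else (k : ℝ) / p) ≤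
      κ ^ k * (Real.log R + k * C) ^ k * ((1 + b) ^ 2 * ((2 * Real.log q + C) / Real.log R)) := by
  have hL := Real.log_pos hR
  have hP := one_le_of_mem_subset_sievePrimes (D := D) (R := R) le_rfl
  have hq1 := hP q hq
  have hq1' : (1 : ℝ) ≤ q := by exact_mod_cast hq1
  have hlq := Real.log_nonneg hq1'
  have hqR : (q : ℝ) ≤ R :=
    (Nat.le_floor_iff (by linarith)).1 (mem_sievePrimes.1 hq).2.2
  rw [selbergForm_update hk hD hq]
  have hnn : ∀ S ∈ (sievePrimes D R).powerset, 0 ≤ ∏ p ∈ S, (k : ℝ) / (p - k) := fun S hS =>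
    prod_dimension_nonneg hD (Finset.mem_powerset.1 hS) _ (Nat.cast_nonneg k)
  refine (Finset.sum_le_sum_of_subset_of_nonneg (Finset.filter_subset _ _) fun S hS _ =>
    mul_nonneg (hnn S hS) (sq_nonneg _)).trans ?_
  have h1 : ∀ S ∈ (sievePrimes D R).powerset, (∏ p ∈ S, (k : ℝ) / (p - k)) *
      (sieveProfile b R (primeProd S) - sieveProfile b R (q * primeProd S)) ^ 2 ≤
      b ^ 2 * (Real.log q / Real.log R) *
        ((∏ p ∈ S, (k : ℝ) / (p - k)) * logPow 0 0 (R / primeProd S)) +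
      (1 + b) ^ 2 * ((∏ p ∈ S, (k : ℝ) / (p - k)) *
        (if R / q < (primeProd S : ℝ) ∧ (primeProd S : ℝ) ≤ R then 1 else 0)) := by
    intro S hS
    have h2 := mul_le_mul_of_nonneg_left (sieveProfile_sub_sq_le hb hR _ q
      (primeProd_pos fun p hp => hP p (Finset.mem_powerset.1 hS hp)) hq1 hqR) (hnn S hS)
    linarith
  refine (Finset.sum_le_sum h1).trans ?_
  rw [Finset.sum_add_distrib, ← Finset.mul_sum, ← Finset.mul_sum]
  have h3 := sum_dimension_logPow_le hD hκ hC hG k 0 hR.le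
  have h4 := sum_dimension_window_le hk hD hκ hC hG hR hq1'
  rw [zero_add, Nat.factorial_zero, Nat.cast_one] at h3
  set X := Real.log R + k * C with hX
  have hX0 : Real.log R ≤ X := by
    have : 0 ≤ k * C := by positivity
    linarith
  have hXp : 0 < X := by linarith
  have h5 : κ ^ k * (1 / (k.factorial : ℝ)) * X ^ k ≤ κ ^ k * X ^ k := by
    have : 1 / (k.factorial : ℝ) ≤ 1 :=
      (div_le_one (by positivity)).2 (by exact_mod_cast Nat.one_le_iff_ne_zero.2 (Nat.factorial_ne_zero k))
    have := mul_le_mul_of_nonneg_left this (by positivity : 0 ≤ κ ^ k * X ^ k)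
    linarith
  have h6 : X ^ (k - 1) ≤ X ^ k / Real.log R := by
    rw [le_div_iff₀ hL]
    have e : X ^ k = X ^ (k - 1) * X := by rw [← pow_succ]; congr 1; omega
    rw [e]
    exact mul_le_mul_of_nonneg_left hX0 (by positivity)
  have h7 : κ ^ k * X ^ (k - 1) * (Real.log q + C) ≤ κ ^ k * (X ^ k / Real.log R) * (Real.log q + C) :=
    mul_le_mul_of_nonneg_right (mul_le_mul_of_nonneg_left h6 (by positivity)) (by positivity)
  have h8 := mul_le_mul_of_nonneg_left (h3.trans h5)
    (by positivity : 0 ≤ b ^ 2 * (Real.log q / Real.log R))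
  have h9 := mul_le_mul_of_nonneg_left (h4.trans h7) (by positivity : 0 ≤ (1 + b) ^ 2)
  have h10 : b ^ 2 * (Real.log q / Real.log R) * (κ ^ k * X ^ k) ≤
      (1 + b) ^ 2 * (Real.log q / Real.log R) * (κ ^ k * X ^ k) := by
    refine mul_le_mul_of_nonneg_right (mul_le_mul_of_nonneg_right ?_ (by positivity)) (by positivity)
    nlinarith
  refine (add_le_add (h8.trans h10) h9).trans (le_of_eq ?_)
  field_simp
  ring

end forms

/-! ### Reduction of weighted sums to quadratic forms. -/

/-- The squared Selberg sieve weight of the tuple `n + h i`. -/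
noncomputable def sieveWeight {k : ℕ} (h : Fin k → ℕ) (D : ℕ) (b R : ℝ) (n : ℕ) : ℝ :=
  (∑ S ∈ (sievePrimes D R).powerset with ∀ p ∈ S, p ∣ ∏ i, (n + h i), selbergWeight k D b R S) ^ 2

theorem sieveWeight_nonneg {k : ℕ} (h : Fin k → ℕ) (D : ℕ) (b R : ℝ) (n : ℕ) :
    0 ≤ sieveWeight h D b R n := sq_nonneg _

theorem sum_mul_sieveWeight {k : ℕ} (h : Fin k → ℕ) (D : ℕ) (b R : ℝ) (M : Finset ℕ) (a : ℕ → ℝ) :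
    ∑ n ∈ M, a n * sieveWeight h D b R n =
      ∑ U ∈ (sievePrimes D R).powerset, ∑ V ∈ (sievePrimes D R).powerset,
        selbergWeight k D b R U * selbergWeight k D b R V *
          ∑ n ∈ M with ∀ p ∈ U ∪ V, p ∣ ∏ i, (n + h i), a n := by
  have h1 : ∀ n ∈ M, a n * sieveWeight h D b R n =
      ∑ U ∈ (sievePrimes D R).powerset, ∑ V ∈ (sievePrimes D R).powerset,
        selbergWeight k D b R U * selbergWeight k D b R V *
          (if ∀ p ∈ U ∪ V, p ∣ ∏ i, (n + h i) then a n else 0) := by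
    intro n _
    rw [sieveWeight, sq, Finset.sum_mul_sum, Finset.sum_filter, Finset.mul_sum]
    refine Finset.sum_congr rfl fun U _ => ?_
    split_ifs with hU
    · rw [Finset.sum_filter, Finset.mul_sum]
      refine Finset.sum_congr rfl fun V _ => ?_
      by_cases hV : ∀ p ∈ V, p ∣ ∏ i, (n + h i)
      · rw [if_pos hV, if_pos]
        · ring
        · intro p hp
          rcases Finset.mem_union.1 hp with hp | hp
          exacts [hU p hp, hV p hp]
      · rw [if_neg hV, if_neg]
        · ring
        · exact fun hh => hV fun p hp => hh p (Finset.mem_union_right _ hp)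
    · rw [mul_zero, Finset.sum_eq_zero]
      intro V _
      rw [if_neg, mul_zero]
      exact fun hh => hU fun p hp => hh p (Finset.mem_union_left _ hp)
  rw [Finset.sum_congr rfl h1, Finset.sum_comm]
  refine Finset.sum_congr rfl fun U _ => ?_
  rw [Finset.sum_comm]
  refine Finset.sum_congr rfl fun V _ => ?_
  rw [← Finset.mul_sum, Finset.sum_filter]

/-- Comparison of a weighted sum with the Selberg form. -/
theorem abs_sum_mul_sieveWeight_sub_le {k : ℕ} (h : Fin k → ℕ) (D : ℕ) (b R : ℝ) (hR : 0 ≤ R)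
    (M : Finset ℕ) (a : ℕ → ℝ) (X : ℝ) (γ : ℕ → ℝ) (r : Finset ℕ → ℝ) (hr : ∀ S, 0 ≤ r S)
    (hS : ∀ S ⊆ sievePrimes D R,
      |∑ n ∈ M with ∀ p ∈ S, p ∣ ∏ i, (n + h i), a n - X * ∏ p ∈ S, γ p| ≤ r S)
    (Λ : ℝ) (hΛ : ∀ S ⊆ sievePrimes D R, |selbergWeight k D b R S| ≤ Λ) :
    |∑ n ∈ M, a n * sieveWeight h D b R n - X * selbergForm k D b R γ| ≤
      Λ ^ 2 * ∑ S ∈ (sievePrimes D R).powerset with (primeProd S : ℝ) ≤ R ^ 2, 3 ^ S.card * r S := by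
  have hP := one_le_of_mem_subset_sievePrimes (D := D) (R := R) le_rfl
  have hΛ0 : 0 ≤ Λ := (abs_nonneg _).trans (hΛ ∅ (Finset.empty_subset _))
  rw [sum_mul_sieveWeight, selbergForm, Finset.mul_sum, ← Finset.sum_sub_distrib]
  refine (Finset.abs_sum_le_sum_abs _ _).trans ?_
  -- Each set S is the union of 3^|S| ordered pairs.
  have h1 : ∑ S ∈ (sievePrimes D R).powerset with (primeProd S : ℝ) ≤ R ^ 2, 3 ^ S.card * r S =
      ∑ U ∈ (sievePrimes D R).powerset, ∑ V ∈ (sievePrimes D R).powerset,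
        (if (primeProd (U ∪ V) : ℝ) ≤ R ^ 2 then r (U ∪ V) else 0) := by
    have := sum_sum_union (sievePrimes D R) (fun _ => 1) (fun _ => 1)
      (fun S => if (primeProd S : ℝ) ≤ R ^ 2 then r S else 0)
    simp only [Finset.prod_const, one_pow, one_mul] at this
    rw [this, Finset.sum_filter]
    refine Finset.sum_congr rfl fun S _ => ?_
    split_ifs <;> norm_num
  rw [h1, Finset.mul_sum]
  refine Finset.sum_le_sum fun U hU => ?_
  rw [Finset.mul_sum, ← Finset.sum_sub_distrib, Finset.mul_sum]
  refine (Finset.abs_sum_le_sum_abs _ _).trans (Finset.sum_le_sum fun V hV => ?_)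
  rw [Finset.mem_powerset] at hU hV
  have e : selbergWeight k D b R U * selbergWeight k D b R V *
        ∑ n ∈ M with ∀ p ∈ U ∪ V, p ∣ ∏ i, (n + h i), a n -
      X * (selbergWeight k D b R U * selbergWeight k D b R V * ∏ p ∈ U ∪ V, γ p) =
      selbergWeight k D b R U * selbergWeight k D b R V *
        (∑ n ∈ M with ∀ p ∈ U ∪ V, p ∣ ∏ i, (n + h i), a n - X * ∏ p ∈ U ∪ V, γ p) := by ring
  rw [e, abs_mul, abs_mul]
  have hnn : 0 ≤ Λ ^ 2 * (if (primeProd (U ∪ V) : ℝ) ≤ R ^ 2 then r (U ∪ V) else 0) := by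
    refine mul_nonneg (sq_nonneg _) ?_
    split_ifs
    exacts [hr _, le_rfl]
  by_cases hUR : R < primeProd U
  · rw [selbergWeight_eq_zero hP hUR]; simpa using hnn
  by_cases hVR : R < primeProd V
  · rw [selbergWeight_eq_zero hP hVR]; simpa using hnn
  have h2 : (primeProd (U ∪ V) : ℝ) ≤ R ^ 2 := by
    have h3 : (primeProd (U ∪ V) : ℝ) ≤ primeProd U * primeProd V := by
      exact_mod_cast primeProd_union_le (fun p hp => hP p (hU hp))
    refine h3.trans ?_
    rw [sq]
    exact mul_le_mul (not_lt.1 hUR) (not_lt.1 hVR) (Nat.cast_nonneg _) hR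
  rw [if_pos h2, sq]
  exact mul_le_mul (mul_le_mul (hΛ U hU) (hΛ V hV) (abs_nonneg _) hΛ0)
    (hS _ (Finset.union_subset hU hV)) (abs_nonneg _) (mul_nonneg hΛ0 hΛ0)

/-- Within the natural numbers, c·(p − 1) plays the role of −c modulo p. -/
theorem modEq_mul_sub_one_iff {p n c : ℕ} (hp : 1 ≤ p) : n ≡ c * (p - 1) [MOD p] ↔ p ∣ n + c := by
  have e : c * (p - 1) + c = c * p := by
    obtain ⟨m, rfl⟩ := Nat.exists_eq_add_of_le hp
    rw [Nat.add_sub_cancel_left]; ring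
  constructor
  · intro h
    have := h.add_right c
    rw [e] at this
    exact (Nat.modEq_zero_iff_dvd).1 (this.trans (Nat.modEq_zero_iff_dvd.2 (dvd_mul_left p c)))
  · intro h
    have h1 : n + c ≡ c * (p - 1) + c [MOD p] := by
      rw [e]
      exact (Nat.modEq_zero_iff_dvd.2 h).trans (Nat.modEq_zero_iff_dvd.2 (dvd_mul_left p c)).symm
    exact Nat.ModEq.add_right_cancel' c h1

/-- Distribution of `a` over the `n` for which every prime of `S` divides one of the `n + h i`,
deduced from the distribution in arithmetic progressions. -/
theorem abs_sum_dvd_prod_sub_le {k : ℕ} (h : Fin k → ℕ) (M P : Finset ℕ) (hP : ∀ p ∈ P, p.Prime)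
    (a : ℕ → ℝ) (I : Finset (Fin k)) (Good : ℕ → ℕ → Prop) (X E : ℕ → ℝ)
    (h_prog : ∀ q c, Good q c → |∑ n ∈ M with n ≡ c [MOD q], a n - X q| ≤ E q)
    (h_good : ∀ q c p i c', Good q c → p ∈ P → ¬ p ∣ q → i ∈ I → c' ≡ c [MOD q] → p ∣ c' + h i →
      Good (q * p) c')
    (h_vanish : ∀ i ∉ I, ∀ p ∈ P, ∀ n ∈ M, p ∣ n + h i → a n = 0)
    (h_dist : ∀ p ∈ P, ∀ i j n, p ∣ n + h i → p ∣ n + h j → i = j)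
    {S : Finset ℕ} (hS : S ⊆ P) (q c : ℕ) (hg : Good q c) (hq : ∀ p ∈ S, ¬ p ∣ q) :
    |∑ n ∈ M with n ≡ c [MOD q] ∧ ∀ p ∈ S, p ∣ ∏ i, (n + h i), a n -
      (I.card : ℝ) ^ S.card * X (q * primeProd S)| ≤ (I.card : ℝ) ^ S.card * E (q * primeProd S) := by
  induction S using Finset.induction_on generalizing q c with
  | empty => simpa [primeProd] using h_prog q c hg
  | insert p S hpS ih =>
    have hpP := hS (Finset.mem_insert_self p S)
    have hpp := hP p hpP
    have hpq := hq p (Finset.mem_insert_self p S)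
    have hco : Nat.Coprime q p := ((Nat.Prime.coprime_iff_not_dvd hpp).2 hpq).symm
    set C : Fin k → ℕ := fun i => (Nat.chineseRemainder hco c (h i * (p - 1))).1 with hC
    have hC1 : ∀ i, C i ≡ c [MOD q] := fun i => (Nat.chineseRemainder hco c (h i * (p - 1))).2.1
    have hC2 : ∀ i, p ∣ C i + h i := fun i =>
      (modEq_mul_sub_one_iff hpp.one_lt.le).1 (Nat.chineseRemainder hco c (h i * (p - 1))).2.2
    have hiff : ∀ i n, n ≡ C i [MOD q * p] ↔ n ≡ c [MOD q] ∧ p ∣ n + h i := by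
      intro i n
      rw [← Nat.modEq_and_modEq_iff_modEq_mul hco, ← modEq_mul_sub_one_iff hpp.one_lt.le]
      have := (Nat.chineseRemainder hco c (h i * (p - 1))).2
      exact ⟨fun hh => ⟨hh.1.trans this.1, hh.2.trans this.2⟩,
        fun hh => ⟨hh.1.trans this.1.symm, hh.2.trans this.2.symm⟩⟩
    -- Each n counted has exactly one index i with p ∣ n + h i, by `h_dist`; indices outside `I`
    -- have a(n) = 0. This trades the prime p for `I.card` progressions modulo q·p.
    have hsplit : ∑ n ∈ M with n ≡ c [MOD q] ∧ ∀ r ∈ insert p S, r ∣ ∏ i, (n + h i), a n =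
        ∑ i ∈ I, ∑ n ∈ M with n ≡ C i [MOD q * p] ∧ ∀ r ∈ S, r ∣ ∏ i, (n + h i), a n := by
      simp only [Finset.sum_filter]
      rw [Finset.sum_comm]
      refine Finset.sum_congr rfl fun n hn => ?_
      simp only [hiff, Finset.forall_mem_insert]
      by_cases hbase : n ≡ c [MOD q] ∧ ∀ r ∈ S, r ∣ ∏ i, (n + h i)
      · by_cases hdvd : p ∣ ∏ i, (n + h i)
        · rw [if_pos ⟨hbase.1, hdvd, hbase.2⟩]
          obtain ⟨i, _, hi⟩ := (Prime.dvd_finsetProd_iff hpp.prime _).1 hdvd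
          by_cases hiI : i ∈ I
          · rw [Finset.sum_eq_single_of_mem i hiI, if_pos ⟨⟨hbase.1, hi⟩, hbase.2⟩]
            intro j _ hji
            rw [if_neg]
            exact fun hh => hji (h_dist p hpP j i n hh.1.2 hi)
          · rw [h_vanish i hiI p hpP n hn hi]; simp
        · rw [if_neg (fun hh => hdvd hh.2.1)]
          symm
          refine Finset.sum_eq_zero fun i _ => ?_
          rw [if_neg]
          exact fun hh => hdvd (hh.1.2.trans (Finset.dvd_prod_of_mem _ (Finset.mem_univ i)))
      · rw [if_neg (fun hh => hbase ⟨hh.1, hh.2.2⟩)]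
        symm
        refine Finset.sum_eq_zero fun i _ => ?_
        rw [if_neg]
        exact fun hh => hbase ⟨hh.1.1, hh.2⟩
    have hih : ∀ i ∈ I, |∑ n ∈ M with n ≡ C i [MOD q * p] ∧ ∀ r ∈ S, r ∣ ∏ i, (n + h i), a n -
        (I.card : ℝ) ^ S.card * X (q * p * primeProd S)| ≤
        (I.card : ℝ) ^ S.card * E (q * p * primeProd S) := by
      intro i hi
      refine ih ((Finset.subset_insert p S).trans hS) (q * p) (C i)
        (h_good q c p i (C i) hg hpP hpq hi (hC1 i) (hC2 i)) fun r hr hd => ?_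
      have hrp := hP r (hS (Finset.mem_insert_of_mem hr))
      rcases hrp.dvd_mul.1 hd with hd | hd
      · exact hq r (Finset.mem_insert_of_mem hr) hd
      · rw [Nat.prime_dvd_prime_iff_eq hrp hpp] at hd
        exact hpS (hd ▸ hr)
    rw [hsplit, primeProd_insert hpS, Finset.card_insert_of_notMem hpS, ← mul_assoc]
    have e1 : (I.card : ℝ) ^ (S.card + 1) * X (q * p * primeProd S) =
        ∑ i ∈ I, (I.card : ℝ) ^ S.card * X (q * p * primeProd S) := by
      rw [Finset.sum_const, nsmul_eq_mul]; ring
    have e2 : (I.card : ℝ) ^ (S.card + 1) * E (q * p * primeProd S) =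
        ∑ i ∈ I, (I.card : ℝ) ^ S.card * E (q * p * primeProd S) := by
      rw [Finset.sum_const, nsmul_eq_mul]; ring
    rw [e1, e2, ← Finset.sum_sub_distrib]
    exact (Finset.abs_sum_le_sum_abs _ _).trans (Finset.sum_le_sum hih)

theorem abs_card_modEq_sub_le {A B : ℕ} (hAB : A ≤ B) (q c : ℕ) (hq : 1 ≤ q) :
    |(#{n ∈ Ioc A B | n ≡ c [MOD q]} : ℝ) - ((B : ℝ) - A) / q| ≤ 1 := by
  have h1 := Nat.Ioc_filter_modEq_card A B (by omega : 0 < q) c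
  set x : ℚ := ((B : ℕ) - c : ℚ) / q with hx
  set y : ℚ := ((A : ℕ) - c : ℚ) / q with hy
  have hq' : (0 : ℚ) < q := by exact_mod_cast hq
  have hxy : y ≤ x := by
    rw [hx, hy, div_le_div_iff_of_pos_right hq']
    have : (A : ℚ) ≤ B := by exact_mod_cast hAB
    linarith
  rw [max_eq_left (sub_nonneg.2 (Int.floor_le_floor hxy))] at h1
  have h2 : ((#{n ∈ Ioc A B | n ≡ c [MOD q]} : ℕ) : ℚ) = (⌊x⌋ : ℚ) - ⌊y⌋ := by
    have := congrArg (fun z : ℤ => (z : ℚ)) h1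
    push_cast at this
    exact this
  have h3 : |((#{n ∈ Ioc A B | n ≡ c [MOD q]} : ℕ) : ℚ) - ((B : ℚ) - A) / q| ≤ 1 := by
    have e : ((B : ℚ) - A) / q = x - y := by rw [hx, hy]; field_simp; ring
    rw [h2, e, abs_le]
    have a1 := Int.floor_le x
    have a2 := Int.lt_floor_add_one x
    have a3 := Int.floor_le y
    have a4 := Int.lt_floor_add_one y
    constructor <;> linarith
  have h4 : ((|((#{n ∈ Ioc A B | n ≡ c [MOD q]} : ℕ) : ℚ) - ((B : ℚ) - A) / q| : ℚ) : ℝ) ≤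
      ((1 : ℚ) : ℝ) := by exact_mod_cast h3
  simpa using h4

/-! ### Distribution in progressions. -/

/-- The largest error term of the primes in the progressions modulo `q`. -/
noncomputable def maxPrimeError (N q : ℕ) : ℝ := ⨆ a : (ZMod q)ˣ, |primeError N q a|

/-- The largest sum of the Liouville function over initial segments of progressions modulo `q`. -/
noncomputable def maxLiouvilleSum (N q : ℕ) : ℝ :=
  ⨆ y : Fin (N + 1), ⨆ a : ZMod q, |liouvilleSum (y : ℕ) q a|

theorem abs_primeError_le_max (N q : ℕ) (hq : 1 ≤ q) (a : (ZMod q)ˣ) :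
    |primeError N q a| ≤ maxPrimeError N q := by
  have : NeZero q := ⟨by omega⟩
  exact le_ciSup (f := fun a : (ZMod q)ˣ => |primeError N q a|) (Set.finite_range _).bddAbove a

theorem maxPrimeError_nonneg (N q : ℕ) : 0 ≤ maxPrimeError N q :=
  Real.iSup_nonneg fun _ => abs_nonneg _

theorem abs_liouvilleSum_le_max (N q y : ℕ) (hq : 1 ≤ q) (hy : y ≤ N) (a : ZMod q) :
    |liouvilleSum y q a| ≤ maxLiouvilleSum N q := by
  have : NeZero q := ⟨by omega⟩
  have h1 : |liouvilleSum y q a| ≤ ⨆ a : ZMod q, |liouvilleSum y q a| :=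
    le_ciSup (f := fun a : ZMod q => |liouvilleSum y q a|) (Set.finite_range _).bddAbove a
  exact h1.trans (le_ciSup (f := fun y : Fin (N + 1) => ⨆ a : ZMod q, |liouvilleSum (y : ℕ) q a|)
    (Set.finite_range _).bddAbove ⟨y, by omega⟩)

theorem maxLiouvilleSum_nonneg (N q : ℕ) : 0 ≤ maxLiouvilleSum N q :=
  Real.iSup_nonneg fun _ => Real.iSup_nonneg fun _ => abs_nonneg _

theorem natCast_zmod_eq_iff_modEq {q : ℕ} (hq : 1 ≤ q) (a : ZMod q) (n : ℕ) :
    (n : ZMod q) = a ↔ n ≡ a.val [MOD q] := by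
  have : NeZero q := ⟨by omega⟩
  rw [← ZMod.natCast_eq_natCast_iff, ZMod.natCast_zmod_val]

theorem card_zmod_filter_le (N q : ℕ) (hq : 1 ≤ q) (a : ZMod q) :
    (#((Icc 1 N).filter (fun n : ℕ => (n : ZMod q) = a)) : ℝ) ≤ N / q + 1 := by
  have h := abs_card_modEq_sub_le (Nat.zero_le N) q a.val hq
  have e : (Icc 1 N).filter (fun n : ℕ => (n : ZMod q) = a) =
      (Ioc 0 N).filter (fun n => n ≡ a.val [MOD q]) := by
    ext n
    rw [Finset.mem_filter, Finset.mem_filter, natCast_zmod_eq_iff_modEq hq, Finset.mem_Icc,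
      Finset.mem_Ioc]
    rfl
  rw [e]
  have := (abs_le.1 h).2
  simp only [Nat.cast_zero, sub_zero] at this
  linarith

theorem maxPrimeError_le (N q : ℕ) (hq : 1 ≤ q) (hN : 1 ≤ N) :
    maxPrimeError N q ≤ Real.log N * (N / q + 1) + N / q.totient := by
  have hl : 0 ≤ Real.log N := Real.log_nonneg (by exact_mod_cast hN)
  refine Real.iSup_le (fun a => ?_) (by positivity)
  rw [primeError]
  refine (abs_sub _ _).trans ?_
  rw [abs_of_nonneg (by positivity : (0 : ℝ) ≤ (N : ℝ) / q.totient)]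
  refine add_le_add ?_ le_rfl
  rw [abs_of_nonneg (Finset.sum_nonneg fun p hp => Real.log_natCast_nonneg p)]
  have h1 : ∑ p ∈ (Icc 1 N).filter (fun p : ℕ => p.Prime ∧ (p : ZMod q) = (a : ZMod q)), Real.log p ≤
      ∑ p ∈ (Icc 1 N).filter (fun p : ℕ => (p : ZMod q) = (a : ZMod q)), Real.log N := by
    refine le_trans (Finset.sum_le_sum_of_subset_of_nonneg
      (Finset.monotone_filter_right _ fun p _ hp => hp.2) fun p _ _ => Real.log_natCast_nonneg p) ?_
    refine Finset.sum_le_sum fun p hp => ?_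
    have hp' := Finset.mem_Icc.1 (Finset.mem_filter.1 hp).1
    exact Real.log_le_log (by exact_mod_cast hp'.1) (by exact_mod_cast hp'.2)
  refine h1.trans ?_
  rw [Finset.sum_const, nsmul_eq_mul, mul_comm]
  exact mul_le_mul_of_nonneg_left (card_zmod_filter_le N q hq _) hl

theorem maxLiouvilleSum_le (N q : ℕ) (hq : 1 ≤ q) : maxLiouvilleSum N q ≤ N / q + 1 := by
  have h0 : (0 : ℝ) ≤ (N : ℝ) / q + 1 := by positivity
  refine Real.iSup_le (fun y => Real.iSup_le (fun a => ?_) h0) h0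
  rw [liouvilleSum]
  refine (Finset.abs_sum_le_sum_abs _ _).trans ?_
  have h1 : ∀ n ∈ (Icc 1 (y : ℕ)).filter (fun n : ℕ => (n : ZMod q) = a),
      |((ArithmeticFunction.liouville n : ℤ) : ℝ)| ≤ 1 := by
    intro n hn
    have hn0 : n ≠ 0 := by
      have := (Finset.mem_Icc.1 (Finset.mem_filter.1 hn).1).1; omega
    rw [ArithmeticFunction.liouville_apply hn0]
    push_cast
    rw [abs_pow, abs_neg, abs_one, one_pow]
  refine (Finset.sum_le_sum h1).trans ?_
  rw [Finset.sum_const, nsmul_eq_mul, mul_one]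
  refine (card_zmod_filter_le _ q hq a).trans ?_
  have : ((y : ℕ) : ℝ) ≤ N := by exact_mod_cast Nat.lt_succ_iff.1 y.2
  have : ((y : ℕ) : ℝ) / q ≤ N / q := div_le_div_of_nonneg_right this (Nat.cast_nonneg q)
  linarith

/-- A dyadic sum at n + s is a difference of two initial segments in a shifted class, which is the
form in which the levels of distribution are stated. -/
theorem sum_shift_progression (f : ℕ → ℝ) (N s q c : ℕ) :
    ∑ n ∈ Ioc N (2 * N) with n ≡ c [MOD q], f (n + s) =
      ∑ n ∈ (Icc 1 (2 * N + s)).filter (fun n : ℕ => (n : ZMod q) = ((c + s : ℕ) : ZMod q)), f n -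
      ∑ n ∈ (Icc 1 (N + s)).filter (fun n : ℕ => (n : ZMod q) = ((c + s : ℕ) : ZMod q)), f n := by
  rw [eq_sub_iff_add_eq]
  have e : (Icc 1 (2 * N + s)).filter (fun n : ℕ => (n : ZMod q) = ((c + s : ℕ) : ZMod q)) =
      ((Ioc N (2 * N)).filter (fun n => n ≡ c [MOD q])).image (· + s) ∪
      (Icc 1 (N + s)).filter (fun n : ℕ => (n : ZMod q) = ((c + s : ℕ) : ZMod q)) := by
    ext n
    simp only [Finset.mem_union, Finset.mem_image, Finset.mem_filter, Finset.mem_Icc,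
      Finset.mem_Ioc, ZMod.natCast_eq_natCast_iff]
    constructor
    · rintro ⟨⟨h1, h2⟩, h3⟩
      by_cases hn : n ≤ N + s
      · exact Or.inr ⟨⟨h1, hn⟩, h3⟩
      · refine Or.inl ⟨n - s, ⟨⟨by omega, by omega⟩, ?_⟩, by omega⟩
        refine Nat.ModEq.add_right_cancel' s ?_
        rwa [Nat.sub_add_cancel (by omega)]
    · rintro (⟨m, ⟨⟨h1, h2⟩, h3⟩, rfl⟩ | ⟨⟨h1, h2⟩, h3⟩)
      · exact ⟨⟨by omega, by omega⟩, h3.add_right s⟩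
      · exact ⟨⟨h1, by omega⟩, h3⟩
  rw [e, Finset.sum_union, Finset.sum_image fun x _ y _ hxy => Nat.add_right_cancel hxy]
  rw [Finset.disjoint_left]
  intro n hn hn'
  obtain ⟨m, hm, rfl⟩ := Finset.mem_image.1 hn
  have h1 := (Finset.mem_Ioc.1 (Finset.mem_filter.1 hm).1).1
  have h2 := (Finset.mem_Icc.1 (Finset.mem_filter.1 hn').1).2
  omega

theorem abs_sum_liouville_progression_le (N s q c : ℕ) (hq : 1 ≤ q) :
    |∑ n ∈ Ioc N (2 * N) with n ≡ c [MOD q], (ArithmeticFunction.liouville (n + s) : ℝ)| ≤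
      2 * maxLiouvilleSum (2 * N + s) q := by
  rw [sum_shift_progression (fun n => (ArithmeticFunction.liouville n : ℝ)) N s q c]
  have h1 := abs_liouvilleSum_le_max (2 * N + s) q (2 * N + s) hq le_rfl ((c + s : ℕ) : ZMod q)
  have h2 := abs_liouvilleSum_le_max (2 * N + s) q (N + s) hq (by omega) ((c + s : ℕ) : ZMod q)
  rw [liouvilleSum] at h1 h2
  refine (abs_sub _ _).trans ?_
  linarith

theorem abs_sum_prime_progression_sub_le (N s q c : ℕ) (hq : 1 ≤ q) (hc : Nat.Coprime (c + s) q) :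
    |∑ n ∈ Ioc N (2 * N) with n ≡ c [MOD q], (if (n + s).Prime then Real.log (n + s : ℕ) else 0) -
      (N : ℝ) / q.totient| ≤ maxPrimeError (2 * N + s) q + maxPrimeError (N + s) q := by
  rw [sum_shift_progression (fun n => if n.Prime then Real.log n else 0) N s q c]
  have h1 := abs_primeError_le_max (2 * N + s) q hq (ZMod.unitOfCoprime (c + s) hc)
  have h2 := abs_primeError_le_max (N + s) q hq (ZMod.unitOfCoprime (c + s) hc)
  have e : ∀ M : ℕ, ∑ n ∈ (Icc 1 M).filter (fun n : ℕ => (n : ZMod q) = ((c + s : ℕ) : ZMod q)),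
      (if n.Prime then Real.log n else 0) = primeError M q (ZMod.unitOfCoprime (c + s) hc) +
        (M : ℝ) / q.totient := by
    intro M
    rw [primeError, sub_add_cancel, ZMod.coe_unitOfCoprime, ← Finset.sum_filter, Finset.filter_filter]
    refine Finset.sum_congr (Finset.filter_congr fun n _ => and_comm) fun _ _ => rfl
  rw [e, e]
  have e2 : primeError (2 * N + s) q (ZMod.unitOfCoprime (c + s) hc) +
      ((2 * N + s : ℕ) : ℝ) / q.totient - (primeError (N + s) q (ZMod.unitOfCoprime (c + s) hc) +
      ((N + s : ℕ) : ℝ) / q.totient) - (N : ℝ) / q.totient =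
      primeError (2 * N + s) q (ZMod.unitOfCoprime (c + s) hc) -
      primeError (N + s) q (ZMod.unitOfCoprime (c + s) hc) := by
    push_cast; ring
  rw [e2]
  exact (abs_sub _ _).trans (add_le_add h1 h2)

/-! ### Error terms with divisor-type multiplicities. -/

section errors

variable {k D : ℕ} {R κ C : ℝ}

theorem primeProd_le_prod_sub_inv (hD : 2 * k ≤ D) {S : Finset ℕ} (hS : S ⊆ sievePrimes D R) :
    1 / (primeProd S : ℝ) ≤ ∏ p ∈ S, (1 : ℝ) / (p - k) := by
  rw [primeProd]
  push_cast
  rw [one_div, ← Finset.prod_inv_distrib]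
  refine Finset.prod_le_prod (fun p _ => by positivity) fun p hp => ?_
  have := cast_lt_of_mem_sievePrimes hD (hS hp)
  rw [← one_div]
  have hk : (0 : ℝ) ≤ k := Nat.cast_nonneg k
  exact one_div_le_one_div_of_le (by linarith) (by linarith)

/-- The multiplicity m^|S| makes this a sum of dimension m, with cutoff R². -/
theorem sum_pow_card_mul_prod_le (hD : 2 * k ≤ D) (hκ : 0 ≤ κ) (hC : 0 ≤ C)
    (hG : HasLogGrowth (sievePrimes D R) k κ C) (m : ℕ) (hR : 1 ≤ R) :
    ∑ S ∈ (sievePrimes D R).powerset with (primeProd S : ℝ) ≤ R ^ 2,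
      (m : ℝ) ^ S.card * ∏ p ∈ S, (1 : ℝ) / (p - k) ≤ κ ^ m * (2 * Real.log R + m * C) ^ m := by
  have h := sum_pow_mul_logPow_le (P := sievePrimes D R) (one_le_of_mem_subset_sievePrimes le_rfl)
    (fun p => (1 : ℝ) / (p - k)) (fun p hp => by
      have := cast_lt_of_mem_sievePrimes hD hp
      exact div_nonneg zero_le_one (by linarith)) hκ hC le_rfl hG.2 (R ^ 2) m 0
  rw [sum_logPow_eq_filter _ (one_le_of_mem_subset_sievePrimes le_rfl)] at h
  simp only [pow_zero, mul_one, Finset.prod_mul_distrib, Finset.prod_const] at h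
  refine h.trans ?_
  rw [logPow, if_pos (one_le_pow₀ hR), Real.log_pow, Nat.factorial_zero, zero_add, zero_add]
  have hL := Real.log_nonneg hR
  push_cast
  rw [mul_right_comm]
  refine mul_le_of_le_one_right (by positivity) ?_
  exact (div_le_one (by positivity)).2 (by exact_mod_cast Nat.one_le_iff_ne_zero.2 (Nat.factorial_ne_zero m))

/-- Since the product of S is at most R², each term may be weighted by R²·∏ 1/(p − k) ≥ 1. -/
theorem sum_pow_card_le (hD : 2 * k ≤ D) (hκ : 0 ≤ κ) (hC : 0 ≤ C)
    (hG : HasLogGrowth (sievePrimes D R) k κ C) (m : ℕ) (hR : 1 ≤ R) :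
    ∑ S ∈ (sievePrimes D R).powerset with (primeProd S : ℝ) ≤ R ^ 2, (m : ℝ) ^ S.card ≤
      R ^ 2 * (κ ^ m * (2 * Real.log R + m * C) ^ m) := by
  refine le_trans ?_ (mul_le_mul_of_nonneg_left (sum_pow_card_mul_prod_le hD hκ hC hG m hR)
    (by positivity))
  rw [Finset.mul_sum]
  refine Finset.sum_le_sum fun S hS => ?_
  rw [Finset.mem_filter, Finset.mem_powerset] at hS
  have h1 := primeProd_le_prod_sub_inv hD hS.1
  have h2 : (1 : ℝ) ≤ primeProd S := by
    exact_mod_cast primeProd_pos (one_le_of_mem_subset_sievePrimes hS.1)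
  have h3 : 1 ≤ R ^ 2 * ∏ p ∈ S, (1 : ℝ) / (p - k) := by
    calc (1 : ℝ) = primeProd S * (1 / primeProd S) := by field_simp
      _ ≤ _ := mul_le_mul hS.2 h1 (by positivity) (by positivity)
  have := mul_le_mul_of_nonneg_left h3 (by positivity : (0 : ℝ) ≤ (m : ℝ) ^ S.card)
  linarith

/-- Sums of an error term against divisor-type multiplicities. -/
theorem sum_pow_card_mul_error_le (hD : 2 * k ≤ D) (hκ : 0 ≤ κ) (hC : 0 ≤ C)
    (hG : HasLogGrowth (sievePrimes D R) k κ C) (m : ℕ) (hR : 1 ≤ R) {W Q : ℕ} (hW : 1 ≤ W)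
    (hQ : (W : ℝ) * R ^ 2 ≤ Q) (e : ℕ → ℝ) (he : ∀ q, 0 ≤ e q) {B T : ℝ} (hT : 0 < T)
    (hB : ∀ S ⊆ sievePrimes D R, (primeProd S : ℝ) ≤ R ^ 2 →
      e (W * primeProd S) ≤ B * ∏ p ∈ S, (1 : ℝ) / (p - k)) :
    ∑ S ∈ (sievePrimes D R).powerset with (primeProd S : ℝ) ≤ R ^ 2,
      (m : ℝ) ^ S.card * e (W * primeProd S) ≤
      B * (κ ^ (m ^ 2) * (2 * Real.log R + (m ^ 2 : ℕ) * C) ^ (m ^ 2)) / T +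
        T * ∑ q ∈ Icc 1 Q, e q := by
  set 𝒮 := (sievePrimes D R).powerset.filter (fun S => (primeProd S : ℝ) ≤ R ^ 2) with h𝒮
  have h1 : ∀ S ∈ 𝒮, (m : ℝ) ^ S.card * e (W * primeProd S) ≤
      B / T * (((m ^ 2 : ℕ) : ℝ) ^ S.card * ∏ p ∈ S, (1 : ℝ) / (p - k)) +
        T * e (W * primeProd S) := by
    intro S hS
    rw [h𝒮, Finset.mem_filter, Finset.mem_powerset] at hS
    have hb := hB S hS.1 hS.2
    set x := (m : ℝ) ^ S.card with hx
    have hx0 : 0 ≤ x := by positivity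
    have hx2 : ((m ^ 2 : ℕ) : ℝ) ^ S.card = x ^ 2 := by
      push_cast; rw [hx, ← pow_mul, ← pow_mul, mul_comm]
    -- This takes the place of Cauchy–Schwarz: multiplicities beyond T are charged to the trivial
    -- bound through their squares, the others to the averaged error with loss T.
    have h2 : x ≤ x ^ 2 / T + T := by
      rw [div_add' _ _ _ hT.ne', le_div_iff₀ hT]
      nlinarith [sq_nonneg (x - T), mul_nonneg hx0 hT.le]
    have h3 := mul_le_mul_of_nonneg_right h2 (he (W * primeProd S))
    have h4 := mul_le_mul_of_nonneg_left hb (by positivity : 0 ≤ x ^ 2 / T)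
    rw [hx2]
    calc _ ≤ _ := h3
      _ = x ^ 2 / T * e (W * primeProd S) + T * e (W * primeProd S) := by ring
      _ ≤ _ := add_le_add h4 le_rfl
      _ = _ := by ring
  refine (Finset.sum_le_sum h1).trans ?_
  rw [Finset.sum_add_distrib, ← Finset.mul_sum, ← Finset.mul_sum]
  refine add_le_add ?_ (mul_le_mul_of_nonneg_left ?_ hT.le)
  · have h5 := sum_pow_card_mul_prod_le hD hκ hC hG (m ^ 2) hR
    have hB0 : 0 ≤ B := by
      have := hB ∅ (Finset.empty_subset _) (by
        rw [primeProd, Finset.prod_empty, Nat.cast_one]; exact one_le_pow₀ hR)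
      simp only [Finset.prod_empty, mul_one] at this
      exact (he _).trans this
    have h6 := mul_le_mul_of_nonneg_left h5 (by positivity : 0 ≤ B / T)
    refine h6.trans (le_of_eq (by ring))
  -- Different S give different moduli, so the sum is part of the one over all q up to Q.
  · have hinj : Set.InjOn (fun S => W * primeProd S) (𝒮 : Set (Finset ℕ)) := by
      intro U hU V hV hUV
      have hU' := Finset.mem_powerset.1 (Finset.mem_filter.1 (Finset.mem_coe.1 hU)).1
      have hV' := Finset.mem_powerset.1 (Finset.mem_filter.1 (Finset.mem_coe.1 hV)).1
      have : primeProd U = primeProd V := Nat.eq_of_mul_eq_mul_left hW hUV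
      rw [← primeFactors_primeProd fun p hp => (mem_sievePrimes.1 (hU' hp)).1,
        ← primeFactors_primeProd fun p hp => (mem_sievePrimes.1 (hV' hp)).1, this]
    rw [← Finset.sum_image (f := e) hinj]
    refine Finset.sum_le_sum_of_subset_of_nonneg ?_ fun q _ _ => he q
    intro q hq
    obtain ⟨S, hS, rfl⟩ := Finset.mem_image.1 hq
    rw [h𝒮, Finset.mem_filter, Finset.mem_powerset] at hS
    rw [Finset.mem_Icc]
    refine ⟨Nat.mul_pos hW (primeProd_pos (one_le_of_mem_subset_sievePrimes hS.1)), ?_⟩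
    have h7 : ((W * primeProd S : ℕ) : ℝ) ≤ Q := by
      push_cast
      exact (mul_le_mul_of_nonneg_left hS.2 (Nat.cast_nonneg W)).trans hQ
    exact_mod_cast h7

end errors

/-! ### Presieving and comparison with the forms. -/

/-- The product of the primes up to `D`. -/
def smallModulus (D : ℕ) : ℕ := primeProd (smallPrimes D)

/-- The integers in `(N, 2N]` congruent to `v` modulo the product of the primes up to `D`. -/
def sieveRange (D v N : ℕ) : Finset ℕ := (Ioc N (2 * N)).filter (fun n => n ≡ v [MOD smallModulus D])

theorem smallModulus_pos (D : ℕ) : 1 ≤ smallModulus D :=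
  primeProd_pos fun _ hp => (mem_smallPrimes.1 hp).1.one_lt.le

theorem prime_dvd_smallModulus_iff {D p : ℕ} (hp : p.Prime) : p ∣ smallModulus D ↔ p ≤ D := by
  constructor
  · intro h
    obtain ⟨q, hq, hd⟩ := (Prime.dvd_finsetProd_iff (S := smallPrimes D) hp.prime (fun p => p)).1 h
    have hq' := mem_smallPrimes.1 hq
    rw [Nat.prime_dvd_prime_iff_eq hp hq'.1] at hd
    exact hd ▸ hq'.2
  · exact fun h => Finset.dvd_prod_of_mem _ (mem_smallPrimes.2 ⟨hp, h⟩)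

theorem not_dvd_smallModulus {D p : ℕ} {R : ℝ} (hp : p ∈ sievePrimes D R) : ¬ p ∣ smallModulus D := by
  have := mem_sievePrimes.1 hp
  rw [prime_dvd_smallModulus_iff this.1]
  omega

/-- A sieving prime exceeds `D`, hence all the shifts, so shifts that agree modulo it are equal. -/
theorem eq_of_dvd_add_of_dvd_add {k D : ℕ} {R : ℝ} {h : Fin k → ℕ} (hinj : Function.Injective h)
    (hhD : ∀ i, h i ≤ D) {p : ℕ} (hp : p ∈ sievePrimes D R) (i j : Fin k) (n : ℕ)
    (hi : p ∣ n + h i) (hj : p ∣ n + h j) : i = j := by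
  have hpD := (mem_sievePrimes.1 hp).2.1
  have h1 : n + h i ≡ n + h j [MOD p] :=
    (Nat.modEq_zero_iff_dvd.2 hi).trans (Nat.modEq_zero_iff_dvd.2 hj).symm
  have h2 := Nat.ModEq.add_left_cancel' n h1
  have h3 := Nat.ModEq.eq_of_lt_of_lt h2 (lt_of_le_of_lt (hhD i) hpD) (lt_of_le_of_lt (hhD j) hpD)
  exact hinj h3

theorem totient_primeProd {S : Finset ℕ} (hS : ∀ p ∈ S, p.Prime) :
    ((primeProd S).totient : ℝ) = ∏ p ∈ S, ((p : ℝ) - 1) := by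
  induction S using Finset.induction_on with
  | empty => simp [primeProd]
  | insert p S hp ih =>
    have hS' : ∀ q ∈ S, q.Prime := fun q hq => hS q (Finset.mem_insert_of_mem hq)
    have hpp := hS p (Finset.mem_insert_self p S)
    have hco : Nat.Coprime p (primeProd S) := by
      refine Nat.Coprime.prod_right fun q hq => ?_
      rw [Nat.coprime_primes hpp (hS' q hq)]
      exact fun h => hp (h ▸ hq)
    rw [primeProd_insert hp, Nat.totient_mul hco, Nat.totient_prime hpp, Nat.cast_mul, ih hS',
      Finset.prod_insert hp, Nat.cast_sub hpp.one_lt.le, Nat.cast_one]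

theorem totient_smallModulus (D : ℕ) :
    ((smallModulus D).totient : ℝ) = smallModulus D * sieveDensity D := by
  rw [smallModulus, totient_primeProd fun p hp => (mem_smallPrimes.1 hp).1, sieveDensity, primeProd]
  push_cast
  rw [← Finset.prod_mul_distrib]
  refine Finset.prod_congr rfl fun p hp => ?_
  have : (p : ℝ) ≠ 0 := by
    have := (mem_smallPrimes.1 hp).1.pos
    positivity
  field_simp

theorem coprime_smallModulus_primeProd {D : ℕ} {R : ℝ} {S : Finset ℕ} (hS : S ⊆ sievePrimes D R) :
    Nat.Coprime (smallModulus D) (primeProd S) :=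
  Nat.Coprime.prod_right fun _ hp =>
    ((Nat.Prime.coprime_iff_not_dvd (mem_sievePrimes.1 (hS hp)).1).2
      (not_dvd_smallModulus (hS hp))).symm

section comparison

variable {k : ℕ} {h : Fin k → ℕ} {D v N : ℕ} {b R Λ : ℝ}

theorem abs_sum_sieveWeight_sub_le (hinj : Function.Injective h) (hhD : ∀ i, h i ≤ D)
    (hR : 0 ≤ R) (hΛ : ∀ S ⊆ sievePrimes D R, |selbergWeight k D b R S| ≤ Λ) :
    |∑ n ∈ sieveRange D v N, sieveWeight h D b R n -
      (N : ℝ) / smallModulus D * selbergForm k D b R (fun p => (k : ℝ) / p)| ≤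
      Λ ^ 2 * ∑ S ∈ (sievePrimes D R).powerset with (primeProd S : ℝ) ≤ R ^ 2,
        ((3 * k : ℕ) : ℝ) ^ S.card := by
  have := abs_sum_mul_sieveWeight_sub_le h D b R hR (sieveRange D v N) (fun _ => 1)
    ((N : ℝ) / smallModulus D) (fun p => (k : ℝ) / p) (fun S => (k : ℝ) ^ S.card)
    (fun S => by positivity) (fun S hS => ?_) Λ hΛ
  · simp only [one_mul] at this
    refine this.trans (le_of_eq ?_)
    congr 1
    refine Finset.sum_congr rfl fun S _ => ?_
    push_cast
    rw [mul_pow]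
  · have h1 := abs_sum_dvd_prod_sub_le h (Ioc N (2 * N)) (sievePrimes D R)
      (fun p hp => (mem_sievePrimes.1 hp).1) (fun _ => 1) Finset.univ (fun q _ => 1 ≤ q)
      (fun q => (N : ℝ) / q) (fun _ => 1)
      (fun q c hq => by
        have := abs_card_modEq_sub_le (by omega : N ≤ 2 * N) q c hq
        rw [Finset.sum_const, nsmul_eq_mul, mul_one]
        push_cast at this
        rwa [show (2 * (N : ℝ) - N) = N by ring] at this)
      (fun q c p i c' hq hp _ _ _ _ => Nat.mul_pos hq (mem_sievePrimes.1 hp).1.pos)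
      (fun i hi => absurd (Finset.mem_univ i) hi)
      (fun p hp i j n => eq_of_dvd_add_of_dvd_add hinj hhD hp i j n) hS (smallModulus D) v
      (smallModulus_pos D) (fun p hp => not_dvd_smallModulus (hS hp))
    rw [Finset.card_univ, Fintype.card_fin, mul_one] at h1
    rw [sieveRange, Finset.filter_filter]
    have e : (N : ℝ) / smallModulus D * ∏ p ∈ S, (k : ℝ) / p =
        (k : ℝ) ^ S.card * ((N : ℝ) / ((smallModulus D * primeProd S : ℕ) : ℝ)) := by
      rw [Finset.prod_div_distrib, Finset.prod_const, primeProd]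
      push_cast
      rw [div_mul_div_comm, mul_div_assoc', mul_comm ((k : ℝ) ^ S.card)]
    rw [e]
    exact h1

theorem abs_sum_dvd_sieveWeight_sub_le (hinj : Function.Injective h) (hhD : ∀ i, h i ≤ D)
    (hR : 0 ≤ R) (hΛ : ∀ S ⊆ sievePrimes D R, |selbergWeight k D b R S| ≤ Λ) (m : Fin k) {q₀ : ℕ}
    (hq₀ : q₀ ∈ sievePrimes D R) :
    |∑ n ∈ sieveRange D v N, (if q₀ ∣ n + h m then (1 : ℝ) else 0) * sieveWeight h D b R n -
      (N : ℝ) / (smallModulus D * q₀) *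
        selbergForm k D b R (fun p => if p = q₀ then 1 else (k : ℝ) / p)| ≤
      Λ ^ 2 * ∑ S ∈ (sievePrimes D R).powerset with (primeProd S : ℝ) ≤ R ^ 2,
        ((3 * k : ℕ) : ℝ) ^ S.card := by
  have hq := (mem_sievePrimes.1 hq₀).1
  have hk : (1 : ℝ) ≤ k := by exact_mod_cast (Nat.one_le_of_lt m.2)
  have := abs_sum_mul_sieveWeight_sub_le h D b R hR (sieveRange D v N)
    (fun n => if q₀ ∣ n + h m then (1 : ℝ) else 0)
    ((N : ℝ) / (smallModulus D * q₀)) (fun p => if p = q₀ then 1 else (k : ℝ) / p)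
    (fun S => (k : ℝ) ^ S.card) (fun S => by positivity) (fun S hS => ?_) Λ hΛ
  · refine this.trans (le_of_eq ?_)
    congr 1
    refine Finset.sum_congr rfl fun S _ => ?_
    push_cast
    rw [mul_pow]
  -- The prime q₀ is moved from the index set into the modulus by the Chinese remainder theorem, so
  -- that the uniform counting lemma applies to the other primes.
  · have hS' : S.erase q₀ ⊆ sievePrimes D R := (Finset.erase_subset _ _).trans hS
    have hco : Nat.Coprime (smallModulus D) q₀ :=
      ((Nat.Prime.coprime_iff_not_dvd hq).2 (not_dvd_smallModulus hq₀)).symm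
    obtain ⟨c, hc1, hc2⟩ := Nat.chineseRemainder hco v (h m * (q₀ - 1))
    have hiff : ∀ n, n ≡ c [MOD smallModulus D * q₀] ↔ n ≡ v [MOD smallModulus D] ∧ q₀ ∣ n + h m := by
      intro n
      rw [← Nat.modEq_and_modEq_iff_modEq_mul hco, ← modEq_mul_sub_one_iff hq.one_lt.le]
      exact ⟨fun hh => ⟨hh.1.trans hc1, hh.2.trans hc2⟩,
        fun hh => ⟨hh.1.trans hc1.symm, hh.2.trans hc2.symm⟩⟩
    have h1 := abs_sum_dvd_prod_sub_le h (Ioc N (2 * N)) (sievePrimes D R)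
      (fun p hp => (mem_sievePrimes.1 hp).1) (fun _ => 1) Finset.univ (fun q _ => 1 ≤ q)
      (fun q => (N : ℝ) / q) (fun _ => 1)
      (fun q c hq => by
        have := abs_card_modEq_sub_le (by omega : N ≤ 2 * N) q c hq
        rw [Finset.sum_const, nsmul_eq_mul, mul_one]
        push_cast at this
        rwa [show (2 * (N : ℝ) - N) = N by ring] at this)
      (fun q c p i c' hq hp _ _ _ _ => Nat.mul_pos hq (mem_sievePrimes.1 hp).1.pos)
      (fun i hi => absurd (Finset.mem_univ i) hi)
      (fun p hp i j n => eq_of_dvd_add_of_dvd_add hinj hhD hp i j n) hS' (smallModulus D * q₀) c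
      (Nat.mul_pos (smallModulus_pos D) hq.pos) (fun p hp hd => by
        have hpp := (mem_sievePrimes.1 (hS' hp)).1
        rcases hpp.dvd_mul.1 hd with hd | hd
        · exact not_dvd_smallModulus (hS' hp) hd
        · rw [Nat.prime_dvd_prime_iff_eq hpp hq] at hd
          exact Finset.ne_of_mem_erase hp hd)
    rw [Finset.card_univ, Fintype.card_fin, mul_one] at h1
    have e1 : ∑ n ∈ sieveRange D v N with ∀ p ∈ S, p ∣ ∏ i, (n + h i),
        (if q₀ ∣ n + h m then (1 : ℝ) else 0) =
        ∑ n ∈ Ioc N (2 * N) with n ≡ c [MOD smallModulus D * q₀] ∧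
          ∀ p ∈ S.erase q₀, p ∣ ∏ i, (n + h i), (1 : ℝ) := by
      rw [← Finset.sum_filter, sieveRange, Finset.filter_filter, Finset.filter_filter]
      refine Finset.sum_congr (Finset.filter_congr fun n _ => ?_) fun _ _ => rfl
      rw [hiff]
      constructor
      · rintro ⟨a1, a2, a3⟩
        exact ⟨⟨a1, a3⟩, fun p hp => a2 p (Finset.mem_of_mem_erase hp)⟩
      · rintro ⟨⟨a1, a3⟩, a2⟩
        refine ⟨a1, fun p hp => ?_, a3⟩
        by_cases hpq : p = q₀
        · rw [hpq]
          exact a3.trans (Finset.dvd_prod_of_mem _ (Finset.mem_univ m))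
        · exact a2 p (Finset.mem_erase.2 ⟨hpq, hp⟩)
    have e2 : (N : ℝ) / (smallModulus D * q₀) * ∏ p ∈ S, (if p = q₀ then 1 else (k : ℝ) / p) =
        (k : ℝ) ^ (S.erase q₀).card *
          ((N : ℝ) / ((smallModulus D * q₀ * primeProd (S.erase q₀) : ℕ) : ℝ)) := by
      rw [← Finset.prod_erase S (a := q₀) (by simp)]
      rw [Finset.prod_congr rfl fun p hp => by rw [if_neg (Finset.ne_of_mem_erase hp)]]
      rw [Finset.prod_div_distrib, Finset.prod_const, primeProd]
      push_cast
      rw [div_mul_div_comm, mul_div_assoc', mul_comm ((k : ℝ) ^ _)]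
    rw [e1, e2]
    exact h1.trans (pow_le_pow_right₀ hk (Finset.card_le_card (Finset.erase_subset _ _)))

theorem abs_sum_liouville_sieveWeight_le (hinj : Function.Injective h) (hhD : ∀ i, h i ≤ D)
    (hR : 0 ≤ R) (hΛ : ∀ S ⊆ sievePrimes D R, |selbergWeight k D b R S| ≤ Λ) (m : Fin k) :
    |∑ n ∈ sieveRange D v N,
      (ArithmeticFunction.liouville (n + h m) : ℝ) * sieveWeight h D b R n| ≤
      Λ ^ 2 * ∑ S ∈ (sievePrimes D R).powerset with (primeProd S : ℝ) ≤ R ^ 2,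
        ((3 * k : ℕ) : ℝ) ^ S.card *
          (2 * maxLiouvilleSum (2 * N + h m) (smallModulus D * primeProd S)) := by
  have := abs_sum_mul_sieveWeight_sub_le h D b R hR (sieveRange D v N)
    (fun n => (ArithmeticFunction.liouville (n + h m) : ℝ)) 0 (fun _ => 0)
    (fun S => (k : ℝ) ^ S.card * (2 * maxLiouvilleSum (2 * N + h m) (smallModulus D * primeProd S)))
    (fun S => mul_nonneg (by positivity) (mul_nonneg zero_le_two (maxLiouvilleSum_nonneg _ _)))
    (fun S hS => ?_) Λ hΛ
  · rw [zero_mul, sub_zero] at this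
    refine this.trans (le_of_eq ?_)
    congr 1
    refine Finset.sum_congr rfl fun S _ => ?_
    push_cast
    rw [mul_pow]; ring
  · have h1 := abs_sum_dvd_prod_sub_le h (Ioc N (2 * N)) (sievePrimes D R)
      (fun p hp => (mem_sievePrimes.1 hp).1)
      (fun n => (ArithmeticFunction.liouville (n + h m) : ℝ)) Finset.univ (fun q _ => 1 ≤ q)
      (fun _ => 0) (fun q => 2 * maxLiouvilleSum (2 * N + h m) q)
      (fun q c hq => by
        rw [sub_zero]
        exact abs_sum_liouville_progression_le N (h m) q c hq)
      (fun q c p i c' hq hp _ _ _ _ => Nat.mul_pos hq (mem_sievePrimes.1 hp).1.pos)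
      (fun i hi => absurd (Finset.mem_univ i) hi)
      (fun p hp i j n => eq_of_dvd_add_of_dvd_add hinj hhD hp i j n) hS (smallModulus D) v
      (smallModulus_pos D) (fun p hp => not_dvd_smallModulus (hS hp))
    rw [Finset.card_univ, Fintype.card_fin, mul_zero] at h1
    rw [sieveRange, Finset.filter_filter, zero_mul]
    exact h1

/-- A prime n + h_m exceeds N ≥ R, so no sieving prime divides it: only the k − 1 classes with i ≠ m
remain, which gives the density (k − 1)/(p − 1). The goodness predicate records that these classes
stay reduced. -/
theorem abs_sum_prime_sieveWeight_sub_le (hinj : Function.Injective h) (hhD : ∀ i, h i ≤ D)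
    (hR : 0 ≤ R) (hRN : R ≤ N) (hΛ : ∀ S ⊆ sievePrimes D R, |selbergWeight k D b R S| ≤ Λ)
    (m : Fin k) (hv : Nat.Coprime (v + h m) (smallModulus D)) :
    |∑ n ∈ sieveRange D v N,
      (if (n + h m).Prime then Real.log (n + h m : ℕ) else 0) * sieveWeight h D b R n -
      (N : ℝ) / (smallModulus D).totient *
        selbergForm k D b R (fun p => ((k : ℝ) - 1) / (p - 1))| ≤
      Λ ^ 2 * ∑ S ∈ (sievePrimes D R).powerset with (primeProd S : ℝ) ≤ R ^ 2,
        ((3 * k : ℕ) : ℝ) ^ S.card *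
          (maxPrimeError (2 * N + h m) (smallModulus D * primeProd S) +
            maxPrimeError (N + h m) (smallModulus D * primeProd S)) := by
  have hk : 1 ≤ k := Nat.one_le_of_lt m.2
  have hE : ∀ q, 0 ≤ maxPrimeError (2 * N + h m) q + maxPrimeError (N + h m) q := fun q =>
    add_nonneg (maxPrimeError_nonneg _ _) (maxPrimeError_nonneg _ _)
  have := abs_sum_mul_sieveWeight_sub_le h D b R hR (sieveRange D v N)
    (fun n => if (n + h m).Prime then Real.log (n + h m : ℕ) else 0)
    ((N : ℝ) / (smallModulus D).totient) (fun p => ((k : ℝ) - 1) / (p - 1))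
    (fun S => (k : ℝ) ^ S.card * (maxPrimeError (2 * N + h m) (smallModulus D * primeProd S) +
            maxPrimeError (N + h m) (smallModulus D * primeProd S)))
    (fun S => mul_nonneg (by positivity) (hE _)) (fun S hS => ?_) Λ hΛ
  · refine this.trans (le_of_eq ?_)
    congr 1
    refine Finset.sum_congr rfl fun S _ => ?_
    push_cast
    rw [mul_pow]; ring
  · have h1 := abs_sum_dvd_prod_sub_le h (Ioc N (2 * N)) (sievePrimes D R)
      (fun p hp => (mem_sievePrimes.1 hp).1)
      (fun n => if (n + h m).Prime then Real.log (n + h m : ℕ) else 0) (Finset.univ.erase m)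
      (fun q c => 1 ≤ q ∧ Nat.Coprime (c + h m) q)
      (fun q => (N : ℝ) / q.totient)
      (fun q => maxPrimeError (2 * N + h m) q + maxPrimeError (N + h m) q)
      (fun q c hq => abs_sum_prime_progression_sub_le N (h m) q c hq.1 hq.2)
      (fun q c p i c' hq hp hpq hi hc1 hc2 => by
        have hpp := (mem_sievePrimes.1 hp).1
        refine ⟨Nat.mul_pos hq.1 hpp.pos, Nat.Coprime.mul_right ?_ ?_⟩
        · have h2 := (hc1.add_right (h m)).gcd_eq
          rw [Nat.Coprime, h2]
          exact hq.2
        · refine ((Nat.Prime.coprime_iff_not_dvd hpp).2 fun hd => ?_).symm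
          exact Finset.ne_of_mem_erase hi (eq_of_dvd_add_of_dvd_add hinj hhD hp i m c' hc2 hd))
      (fun i hi p hp n hn hd => by
        have him : i = m := by
          by_contra hne
          exact hi (Finset.mem_erase.2 ⟨hne, Finset.mem_univ i⟩)
        rw [him] at hd
        rw [if_neg]
        intro hpr
        have hp' := mem_sievePrimes.1 hp
        rw [Nat.prime_dvd_prime_iff_eq hp'.1 hpr] at hd
        have h3 : p ≤ N := hp'.2.2.trans (by
          have := Nat.floor_le_floor hRN
          rwa [Nat.floor_natCast] at this)
        have := (Finset.mem_Ioc.1 hn).1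
        omega)
      (fun p hp i j n => eq_of_dvd_add_of_dvd_add hinj hhD hp i j n) hS (smallModulus D) v
      ⟨smallModulus_pos D, hv⟩ (fun p hp => not_dvd_smallModulus (hS hp))
    rw [Finset.card_erase_of_mem (Finset.mem_univ m), Finset.card_univ, Fintype.card_fin] at h1
    rw [sieveRange, Finset.filter_filter]
    have e : (N : ℝ) / (smallModulus D).totient * ∏ p ∈ S, ((k : ℝ) - 1) / (p - 1) =
        ((k - 1 : ℕ) : ℝ) ^ S.card * ((N : ℝ) / (smallModulus D * primeProd S).totient) := by
      rw [Nat.totient_mul (coprime_smallModulus_primeProd hS), Nat.cast_mul,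
        totient_primeProd fun p hp => (mem_sievePrimes.1 (hS hp)).1, Finset.prod_div_distrib,
        Finset.prod_const, Nat.cast_sub hk, Nat.cast_one, div_mul_div_comm, mul_div_assoc',
        mul_comm (((k : ℝ) - 1) ^ S.card)]
    rw [e]
    refine h1.trans (mul_le_mul_of_nonneg_right ?_ (hE _))
    exact pow_le_pow_left₀ (Nat.cast_nonneg _) (by exact_mod_cast Nat.sub_le k 1) _

end comparison

/-! ### Prime sums and comparison of growth rates. -/

open Filter Asymptotics

/-- Chebyshev's argument: ∏ p^⌊n/p⌋ divides n! ≤ n^n, and ⌊n/p⌋ ≥ n/(2p) for p ≤ n. -/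
theorem sum_log_div_primes_le (n : ℕ) :
    ∑ p ∈ smallPrimes n, Real.log p / p ≤ 2 * Real.log n := by
  rcases Nat.eq_zero_or_pos n with rfl | hn
  · simp [smallPrimes]
  have hn' : (0 : ℝ) < n := by exact_mod_cast hn
  have hdvd : ∏ p ∈ smallPrimes n, p ^ (n / p) ∣ n.factorial := by
    refine Finset.prod_dvd_of_isRelPrime (fun p hp q hq hpq => ?_) fun p hp => ?_
    · have hp' := (mem_smallPrimes.1 (Finset.mem_coe.1 hp)).1
      have hq' := (mem_smallPrimes.1 (Finset.mem_coe.1 hq)).1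
      exact Nat.coprime_iff_isRelPrime.1 (Nat.Coprime.pow _ _ ((Nat.coprime_primes hp' hq').2 hpq))
    · have hp' := (mem_smallPrimes.1 hp).1
      rw [hp'.pow_dvd_factorial_iff (b := n + 2) (lt_of_le_of_lt (Nat.log_le_self p n) (by omega))]
      have := Finset.single_le_sum (f := fun i => n / p ^ i) (s := Ico 1 (n + 2))
        (fun _ _ => Nat.zero_le _) (Finset.mem_Ico.2 ⟨le_rfl, by omega⟩ : 1 ∈ Ico 1 (n + 2))
      simpa using this
  have h1 : ∏ p ∈ smallPrimes n, p ^ (n / p) ≤ n ^ n :=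
    (Nat.le_of_dvd (Nat.factorial_pos n) hdvd).trans (Nat.factorial_le_pow n)
  have hpos : ∀ p ∈ smallPrimes n, ((p : ℝ) ^ (n / p)) ≠ 0 := fun p hp => by
    have := (mem_smallPrimes.1 hp).1.pos
    positivity
  have h2 : ∑ p ∈ smallPrimes n, ((n / p : ℕ) : ℝ) * Real.log p ≤ n * Real.log n := by
    have h3 : ((∏ p ∈ smallPrimes n, p ^ (n / p) : ℕ) : ℝ) ≤ ((n ^ n : ℕ) : ℝ) := by exact_mod_cast h1
    push_cast at h3
    have h4 := Real.log_le_log (Finset.prod_pos fun p hp =>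
      lt_of_le_of_ne (by positivity) (hpos p hp).symm) h3
    rw [Real.log_prod hpos, Real.log_pow] at h4
    simpa only [Real.log_pow] using h4
  have h5 : ∀ p ∈ smallPrimes n, (n : ℝ) / 2 * (Real.log p / p) ≤ ((n / p : ℕ) : ℝ) * Real.log p := by
    intro p hp
    have hp' := mem_smallPrimes.1 hp
    have hp0 : (0 : ℝ) < p := by exact_mod_cast hp'.1.pos
    have h6 : 1 ≤ n / p := (Nat.one_le_div_iff hp'.1.pos).2 hp'.2
    have h7 : n < p * (n / p + 1) := Nat.lt_mul_div_succ n hp'.1.pos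
    have h7' : (n : ℝ) < p * (((n / p : ℕ) : ℝ) + 1) := by exact_mod_cast h7
    have h6' : (1 : ℝ) ≤ ((n / p : ℕ) : ℝ) := by exact_mod_cast h6
    have h8 : (n : ℝ) / 2 / p ≤ ((n / p : ℕ) : ℝ) := by
      rw [div_le_iff₀ hp0]; nlinarith
    have := mul_le_mul_of_nonneg_right h8 (Real.log_natCast_nonneg p)
    calc _ = (n : ℝ) / 2 / p * Real.log p := by ring
      _ ≤ _ := this
  have h9 := (Finset.sum_le_sum h5).trans h2
  rw [← Finset.mul_sum] at h9
  have h10 : (n : ℝ) / 2 * ∑ p ∈ smallPrimes n, Real.log p / p ≤ (n : ℝ) / 2 * (2 * Real.log n) := by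
    linarith
  exact le_of_mul_le_mul_left h10 (by positivity)

/-- For p > e^C the constant is at most log p; the fewer than e^C + 1 remaining primes contribute a
bounded amount. -/
theorem sum_log_add_const_div_primes_le {C : ℝ} (hC : 0 ≤ C) (n : ℕ) :
    ∑ p ∈ smallPrimes n, (2 * Real.log p + C) / p ≤
      6 * Real.log n + C * (Real.exp C + 1) := by
  have h1 : ∀ p ∈ smallPrimes n, (2 * Real.log p + C) / p ≤
      3 * (Real.log p / p) + C * (if (p : ℝ) ≤ Real.exp C then 1 else 0) := by
    intro p hp
    have hp' := (mem_smallPrimes.1 hp).1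
    have hp1 : (1 : ℝ) ≤ p := by exact_mod_cast hp'.one_lt.le
    have hl := Real.log_natCast_nonneg p
    by_cases h : (p : ℝ) ≤ Real.exp C
    · rw [if_pos h, add_div]
      have h2 : C / p ≤ C := div_le_self hC hp1
      have h3 : 0 ≤ Real.log p / p := by positivity
      have h4 : 2 * Real.log p / p = 2 * (Real.log p / p) := by ring
      linarith
    · rw [if_neg h, mul_zero, add_zero]
      have h2 : C ≤ Real.log p := by
        rw [Real.le_log_iff_exp_le (by linarith)]; exact (not_le.1 h).le
      rw [mul_div_assoc', div_le_div_iff_of_pos_right (by linarith)]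
      linarith
  refine (Finset.sum_le_sum h1).trans ?_
  rw [Finset.sum_add_distrib, ← Finset.mul_sum, ← Finset.mul_sum]
  have h2 := sum_log_div_primes_le n
  have h3 : ∑ p ∈ smallPrimes n, (if (p : ℝ) ≤ Real.exp C then (1 : ℝ) else 0) ≤ Real.exp C + 1 := by
    rw [← Finset.sum_filter, Finset.sum_const, nsmul_eq_mul, mul_one]
    have h4 : (smallPrimes n).filter (fun p : ℕ => (p : ℝ) ≤ Real.exp C) ⊆ Icc 1 ⌊Real.exp C⌋₊ := by
      intro p hp
      rw [Finset.mem_filter] at hp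
      exact Finset.mem_Icc.2 ⟨(mem_smallPrimes.1 hp.1).1.one_lt.le, Nat.le_floor hp.2⟩
    have h5 := Finset.card_le_card h4
    rw [Nat.card_Icc, Nat.add_sub_cancel] at h5
    have h6 : (((smallPrimes n).filter (fun p : ℕ => (p : ℝ) ≤ Real.exp C)).card : ℝ) ≤
      (⌊Real.exp C⌋₊ : ℝ) := by exact_mod_cast h5
    have := Nat.floor_le (Real.exp_pos C).le
    linarith
  have h4 := mul_le_mul_of_nonneg_left h3 hC
  linarith

theorem tendsto_log_natCast : Tendsto (fun N : ℕ => Real.log N) atTop atTop :=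
  Real.tendsto_log_atTop.comp tendsto_natCast_atTop_atTop

theorem mul_log_add_isBigO (a d : ℝ) :
    (fun N : ℕ => a * Real.log N + d) =O[atTop] fun N : ℕ => Real.log N := by
  refine ((isBigO_refl (fun N : ℕ => Real.log N) atTop).const_mul_left a).add ?_
  exact (isLittleO_const_left.2 (Or.inr (tendsto_norm_atTop_atTop.comp tendsto_log_natCast))).isBigO

theorem log_pow_mul_rpow_isLittleO (m : ℕ) {s : ℝ} (hs : s < 1) :
    (fun N : ℕ => Real.log N ^ m * (N : ℝ) ^ s) =o[atTop] fun N : ℕ => (N : ℝ) := by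
  have h1 := (isLittleO_log_rpow_rpow_atTop (m : ℝ) (by linarith : 0 < 1 - s)).comp_tendsto
    tendsto_natCast_atTop_atTop
  have h2 := h1.mul_isBigO (isBigO_refl (fun N : ℕ => (N : ℝ) ^ s) atTop)
  refine h2.congr' (Eventually.of_forall fun N => ?_) ?_
  · simp [Function.comp]
  · filter_upwards [eventually_gt_atTop 0] with N hN
    have hN' : (0 : ℝ) < N := by exact_mod_cast hN
    simp only [Function.comp]
    rw [← Real.rpow_add hN']
    simp

theorem div_log_isLittleO :
    (fun N : ℕ => (N : ℝ) / Real.log N) =o[atTop] fun N : ℕ => (N : ℝ) := by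
  have h1 : (fun N : ℕ => (Real.log N)⁻¹) =o[atTop] fun _ : ℕ => (1 : ℝ) :=
    (isLittleO_one_iff ℝ).2 (tendsto_inv_atTop_zero.comp tendsto_log_natCast)
  have := (isBigO_refl (fun N : ℕ => (N : ℝ)) atTop).mul_isLittleO h1
  simpa [div_eq_mul_inv] using this

/-! ### Negligible error terms. -/

section asymptotics

/-- The bound for the Selberg weights, as a function of `log R = β log N`. -/
noncomputable def weightBound (k : ℕ) (b κ C β : ℝ) (N : ℕ) : ℝ :=
  (1 + b) * (κ ^ k * (β * Real.log N + k * C) ^ k)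

theorem weightBound_isBigO (k : ℕ) (b κ C β : ℝ) :
    weightBound k b κ C β =O[atTop] fun N : ℕ => Real.log N ^ k :=
  (((mul_log_add_isBigO β (k * C)).pow k).const_mul_left (κ ^ k)).const_mul_left (1 + b)

/-- There are about R² = N^(2β) moduli up to logarithms. The extra N^c pays for summing the error
over all the small primes q. -/
theorem weightBound_error_isLittleO (k m : ℕ) (b κ C β c : ℝ) (hc : 2 * β + c < 1) :
    (fun N : ℕ => (N : ℝ) ^ c * (weightBound k b κ C β N ^ 2 *
      (((N : ℝ) ^ β) ^ 2 * (κ ^ m * (2 * (β * Real.log N) + m * C) ^ m)))) =o[atTop]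
      fun N : ℕ => (N : ℝ) := by
  have h1 := (weightBound_isBigO k b κ C β).pow 2
  have h2 := ((mul_log_add_isBigO (2 * β) (m * C)).pow m).const_mul_left (κ ^ m)
  have h3 := (h1.mul h2).mul (isBigO_refl (fun N : ℕ => (N : ℝ) ^ (2 * β + c)) atTop)
  have h4 : (fun N : ℕ => (Real.log N ^ k) ^ 2 * Real.log N ^ m * (N : ℝ) ^ (2 * β + c)) =o[atTop]
      fun N : ℕ => (N : ℝ) := by
    have := log_pow_mul_rpow_isLittleO (k * 2 + m) hc
    refine this.congr_left fun N => ?_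
    rw [pow_add, pow_mul]
  refine (h3.trans_isLittleO h4).congr' ?_ EventuallyEq.rfl
  filter_upwards [eventually_gt_atTop 0] with N hN
  have hN' : (0 : ℝ) < N := by exact_mod_cast hN
  rw [Real.rpow_add hN', two_mul β, Real.rpow_add hN']
  ring

/-- The level-of-distribution error, against the square of the weight bound, is negligible. -/
theorem level_error_isLittleO {k D : ℕ} (hD : 2 * k ≤ D) {b κ C β ϑ : ℝ} (hκ : 0 ≤ κ) (hC : 0 ≤ C)
    (hG : ∀ R, HasLogGrowth (sievePrimes D R) k κ C) (hk : 1 ≤ k) (hβ : 0 < β) (hβ2 : 2 * β < 1)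
    (hβϑ : 2 * β < ϑ) (e : ℕ → ℕ → ℝ) (he : ∀ M q, 0 ≤ e M q)
    (htriv : ∀ M q, 2 ≤ M → 1 ≤ q → q ≤ M → e M q ≤ 4 * Real.log M * ((M : ℝ) / q.totient))
    (hlev : ∀ ε : ℝ, 0 < ε → ∀ A : ℝ, 0 < A → ∃ K : ℝ, ∀ M : ℕ, 2 ≤ M →
      ∑ q ∈ Icc 1 ⌊(M : ℝ) ^ (ϑ - ε)⌋₊, e M q ≤ K * ((M : ℝ) / Real.log (M : ℝ) ^ A))
    (f : ℕ → ℕ) (hf1 : ∀ N, N ≤ f N) (hf2 : ∀ᶠ N in atTop, f N ≤ 4 * N) (m : ℕ) :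
    (fun N : ℕ => weightBound k b κ C β N ^ 2 *
      ∑ S ∈ (sievePrimes D ((N : ℝ) ^ β)).powerset with (primeProd S : ℝ) ≤ ((N : ℝ) ^ β) ^ 2,
        (m : ℝ) ^ S.card * e (f N) (smallModulus D * primeProd S)) =o[atTop]
      fun N : ℕ => (N : ℝ) := by
  set W := smallModulus D with hW
  have hW1 : 1 ≤ W := smallModulus_pos D
  -- Half of the gap, so that ϑ − ε = 2β + ε and N^(ϑ−ε) exceeds the largest modulus W·N^(2β).
  set ε := (ϑ - 2 * β) / 2 with hε
  have hε0 : 0 < ε := by rw [hε]; linarith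
  -- The splitting parameter is T = (log)^t. The exponent pays for the squared weights (2k), the
  -- divisor sum (m²) and the logarithm in the trivial bound, with one power to spare. The exponent
  -- A below then pays for T and the squared weights, again with one to spare.
  set t := 2 * k + m ^ 2 + 2 with ht
  set A := t + 2 * k + 1 with hA
  obtain ⟨K, hK⟩ := hlev ε hε0 A (by rw [hA]; positivity)
  set err : ℕ → ℝ := fun N => weightBound k b κ C β N ^ 2 *
    (8 * (κ ^ (m ^ 2) * (2 * (β * Real.log N) + (m ^ 2 : ℕ) * C) ^ (m ^ 2)) *
      (4 * N * (4 * Real.log N)) / Real.log N ^ t + |K| * (4 * N / Real.log N ^ (2 * k + 1))) with herr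
  have herr_o : err =o[atTop] fun N : ℕ => (N : ℝ) := by
    have h1 := (weightBound_isBigO k b κ C β).pow 2
    have h2 := ((mul_log_add_isBigO (2 * β) ((m ^ 2 : ℕ) * C)).pow (m ^ 2)).const_mul_left
      (128 * κ ^ (m ^ 2))
    have h3 := (h1.mul h2).mul
      (isBigO_refl (fun N : ℕ => (N : ℝ) * Real.log N / Real.log N ^ t) atTop)
    have h4 := (h1.const_mul_left (4 * |K|)).mul
      (isBigO_refl (fun N : ℕ => (N : ℝ) / Real.log N ^ (2 * k + 1)) atTop)
    have hlog : ∀ᶠ N : ℕ in atTop, 0 < Real.log N := tendsto_log_natCast.eventually_gt_atTop 0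
    have h3' : (fun N : ℕ => (Real.log N ^ k) ^ 2 * Real.log N ^ (m ^ 2) *
        ((N : ℝ) * Real.log N / Real.log N ^ t)) =ᶠ[atTop] fun N : ℕ => (N : ℝ) / Real.log N := by
      filter_upwards [hlog] with N hN
      rw [ht, pow_add, pow_add, pow_mul']
      field_simp
    have h4' : (fun N : ℕ => (Real.log N ^ k) ^ 2 * ((N : ℝ) / Real.log N ^ (2 * k + 1)))
        =ᶠ[atTop] fun N : ℕ => (N : ℝ) / Real.log N := by
      filter_upwards [hlog] with N hN
      rw [pow_add, pow_mul']
      field_simp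
    have h5 := (h3.congr' EventuallyEq.rfl h3').add (h4.congr' EventuallyEq.rfl h4')
    refine (h5.trans_isLittleO div_log_isLittleO).congr' (Eventually.of_forall fun N => ?_)
      EventuallyEq.rfl
    simp only [herr]
    ring
  refine IsBigO.trans_isLittleO (IsBigO.of_bound 1 ?_) herr_o
  have hQ : ∀ᶠ N : ℕ in atTop, (W : ℝ) * (N : ℝ) ^ (2 * β) + 1 ≤ (N : ℝ) ^ (ϑ - ε) := by
    have h1 : Tendsto (fun N : ℕ => (N : ℝ) ^ ε) atTop atTop :=
      (tendsto_rpow_atTop hε0).comp tendsto_natCast_atTop_atTop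
    filter_upwards [h1.eventually_ge_atTop ((W : ℝ) + 1), eventually_ge_atTop 1] with N hN hN1
    have hN' : (1 : ℝ) ≤ N := by exact_mod_cast hN1
    have h2 : (1 : ℝ) ≤ (N : ℝ) ^ (2 * β) := Real.one_le_rpow hN' (by linarith)
    have e1 : ϑ - ε = ε + 2 * β := by rw [hε]; ring
    rw [e1, Real.rpow_add (by linarith)]
    nlinarith
  have hQ1 : ∀ᶠ N : ℕ in atTop, (W : ℝ) * (N : ℝ) ^ (2 * β) ≤ N := by
    have h1 : Tendsto (fun N : ℕ => (N : ℝ) ^ (1 - 2 * β)) atTop atTop :=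
      (tendsto_rpow_atTop (by linarith)).comp tendsto_natCast_atTop_atTop
    filter_upwards [h1.eventually_ge_atTop (W : ℝ), eventually_ge_atTop 1] with N hN hN1
    have hN' : (1 : ℝ) ≤ N := by exact_mod_cast hN1
    have := mul_le_mul_of_nonneg_right hN (by positivity : 0 ≤ (N : ℝ) ^ (2 * β))
    rw [← Real.rpow_add (by linarith)] at this
    simpa using this
  filter_upwards [hQ, hQ1, hf2, eventually_ge_atTop 4] with N hQN hQ1N hfN hN4
  have hN4' : (4 : ℝ) ≤ N := by exact_mod_cast hN4
  have hlN : 0 < Real.log N := Real.log_pos (by linarith)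
  have hN0 : (0 : ℝ) ≤ N := by linarith
  have hfN1 : (N : ℝ) ≤ f N := by exact_mod_cast hf1 N
  have hfN2 : (f N : ℝ) ≤ 4 * N := by exact_mod_cast hfN
  have hlf1 : Real.log N ≤ Real.log (f N) := Real.log_le_log (by linarith) hfN1
  have hlf2 : Real.log (f N) ≤ 4 * Real.log N := by
    have h1 := Real.log_le_log (by linarith) hfN2
    rw [Real.log_mul (by norm_num) (by linarith)] at h1
    have h2 := Real.log_le_log (by norm_num) hN4'
    linarith
  have hR1 : (1 : ℝ) ≤ (N : ℝ) ^ β := Real.one_le_rpow (by linarith) hβ.le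
  have hRsq : ((N : ℝ) ^ β) ^ 2 = (N : ℝ) ^ (2 * β) := by
    rw [← Real.rpow_natCast, ← Real.rpow_mul hN0]; ring_nf
  have hlR : Real.log ((N : ℝ) ^ β) = β * Real.log N := Real.log_rpow (by linarith) β
  have hsum := sum_pow_card_mul_error_le hD hκ hC (hG ((N : ℝ) ^ β)) m hR1 hW1
    (Q := ⌊(f N : ℝ) ^ (ϑ - ε)⌋₊) (by
      have h1 : (N : ℝ) ^ (ϑ - ε) ≤ (f N : ℝ) ^ (ϑ - ε) :=
        Real.rpow_le_rpow hN0 hfN1 (by rw [hε]; linarith)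
      have h2 := Nat.lt_floor_add_one ((f N : ℝ) ^ (ϑ - ε))
      rw [hRsq]; linarith) (e (f N)) (he (f N)) (B := 4 * Real.log (f N) * f N)
    (T := Real.log (f N) ^ t) (pow_pos (hlN.trans_le hlf1) t) (fun S hS hSR => by
      have hS1 : 1 ≤ primeProd S := primeProd_pos (one_le_of_mem_subset_sievePrimes hS)
      have h1 : W * primeProd S ≤ f N := by
        have h2 : ((W * primeProd S : ℕ) : ℝ) ≤ f N := by
          push_cast
          rw [hRsq] at hSR
          exact ((mul_le_mul_of_nonneg_left hSR (Nat.cast_nonneg W)).trans hQ1N).trans hfN1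
        exact_mod_cast h2
      refine (htriv (f N) (W * primeProd S) (by have := hf1 N; omega) (Nat.mul_pos hW1 hS1) h1).trans ?_
      rw [mul_assoc (4 * Real.log (f N))]
      refine mul_le_mul_of_nonneg_left ?_ (by linarith)
      rw [div_eq_mul_one_div]
      refine mul_le_mul_of_nonneg_left ?_ (by linarith)
      rw [Nat.totient_mul (coprime_smallModulus_primeProd hS)]
      push_cast
      rw [totient_primeProd fun p hp => (mem_sievePrimes.1 (hS hp)).1]
      have hWt : (1 : ℝ) ≤ (W.totient : ℝ) := by
        exact_mod_cast Nat.totient_pos.2 (by omega)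
      have hk' : (1 : ℝ) ≤ k := by exact_mod_cast hk
      have hpos : 0 < ∏ p ∈ S, ((p : ℝ) - 1) := Finset.prod_pos fun p hp => by
        have := cast_lt_of_mem_sievePrimes hD (hS hp); linarith
      calc 1 / ((W.totient : ℝ) * ∏ p ∈ S, ((p : ℝ) - 1)) ≤ 1 / ∏ p ∈ S, ((p : ℝ) - 1) :=
            one_div_le_one_div_of_le hpos (by nlinarith)
        _ = ∏ p ∈ S, 1 / ((p : ℝ) - 1) := by simp
        _ ≤ _ := Finset.prod_le_prod (fun p hp => by
            have := cast_lt_of_mem_sievePrimes hD (hS hp)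
            exact div_nonneg zero_le_one (by linarith)) fun p hp => by
            have := cast_lt_of_mem_sievePrimes hD (hS hp)
            exact one_div_le_one_div_of_le (by linarith) (by linarith))
  rw [hlR] at hsum
  have hsum0 : 0 ≤ ∑ S ∈ (sievePrimes D ((N : ℝ) ^ β)).powerset with
      (primeProd S : ℝ) ≤ ((N : ℝ) ^ β) ^ 2, (m : ℝ) ^ S.card * e (f N) (W * primeProd S) :=
    Finset.sum_nonneg fun S _ => mul_nonneg (by positivity) (he _ _)
  rw [Real.norm_eq_abs, Real.norm_eq_abs, one_mul, abs_of_nonneg (mul_nonneg (sq_nonneg _) hsum0)]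
  refine le_trans ?_ (le_abs_self _)
  rw [herr]
  refine mul_le_mul_of_nonneg_left (hsum.trans (add_le_add ?_ ?_)) (sq_nonneg _)
  · have hY : 0 ≤ κ ^ (m ^ 2) * (2 * (β * Real.log N) + (m ^ 2 : ℕ) * C) ^ (m ^ 2) := by positivity
    have h1 : 4 * Real.log (f N) * f N ≤ 8 * (4 * N * (4 * Real.log N)) := by
      have := mul_le_mul hlf2 hfN2 (by linarith) (by linarith)
      nlinarith
    have h2 : Real.log N ^ t ≤ Real.log (f N) ^ t := pow_le_pow_left₀ hlN.le hlf1 _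
    have h3 := mul_le_mul_of_nonneg_right h1 hY
    calc _ ≤ 8 * (4 * N * (4 * Real.log N)) *
          (κ ^ (m ^ 2) * (2 * (β * Real.log N) + (m ^ 2 : ℕ) * C) ^ (m ^ 2)) / Real.log N ^ t :=
          div_le_div₀ (by positivity) h3 (by positivity) h2
      _ = _ := by ring
  · have h1 := hK (f N) (by have := hf1 N; omega)
    have hlf : 0 < Real.log (f N) := by linarith
    have h2 := mul_le_mul_of_nonneg_left h1 (by positivity : 0 ≤ Real.log (f N) ^ t)
    refine h2.trans ?_
    rw [Real.rpow_natCast]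
    have e1 : Real.log (f N) ^ t * (K * ((f N : ℝ) / Real.log (f N) ^ A)) =
        K * ((f N : ℝ) / Real.log (f N) ^ (2 * k + 1)) := by
      rw [hA, add_assoc, pow_add _ t]
      field_simp
    rw [e1]
    refine mul_le_mul (le_abs_self K) ?_ (by positivity) (abs_nonneg K)
    exact div_le_div₀ (by linarith) hfN2 (by positivity) (pow_le_pow_left₀ hlN.le hlf1 _)

end asymptotics

/-! ### Asymptotic bounds for the sieve sums. -/

/-- The order of magnitude of the total sieve mass. -/
noncomputable def sieveUnit (k D : ℕ) (β : ℝ) (N : ℕ) : ℝ :=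
  (N : ℝ) / smallModulus D * (sieveDensity D ^ k * (β * Real.log N) ^ k)

theorem sieveUnit_nonneg (k D : ℕ) {β : ℝ} (hβ : 0 ≤ β) (N : ℕ) : 0 ≤ sieveUnit k D β N := by
  have := sieveDensity_pos D
  have := Real.log_natCast_nonneg N
  rw [sieveUnit]; positivity

theorem eventually_abs_le_sieveUnit {k D : ℕ} {β : ℝ} (hβ : 0 < β) {f : ℕ → ℝ}
    (hf : f =o[atTop] fun N : ℕ => (N : ℝ)) {δ : ℝ} (hδ : 0 < δ) :
    ∀ᶠ N in atTop, |f N| ≤ δ * sieveUnit k D β N := by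
  have hκ := sieveDensity_pos D
  have hW : (0 : ℝ) < smallModulus D := by exact_mod_cast smallModulus_pos D
  have h1 := hf.bound (by positivity : 0 < δ * (sieveDensity D ^ k / smallModulus D))
  have h2 : ∀ᶠ N : ℕ in atTop, 1 ≤ β * Real.log N := by
    filter_upwards [tendsto_log_natCast.eventually_ge_atTop (1 / β)] with N hN
    rwa [div_le_iff₀' hβ] at hN
  filter_upwards [h1, h2] with N hN hL
  rw [Real.norm_eq_abs, Real.norm_eq_abs, abs_of_nonneg (Nat.cast_nonneg N : (0:ℝ) ≤ (N:ℝ))] at hN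
  refine hN.trans ?_
  have h3 : 1 ≤ (β * Real.log N) ^ k := one_le_pow₀ hL
  have h4 := mul_le_mul_of_nonneg_left h3
    (by positivity : 0 ≤ δ * ((N : ℝ) / smallModulus D * sieveDensity D ^ k))
  rw [sieveUnit]
  calc _ = δ * ((N : ℝ) / smallModulus D * sieveDensity D ^ k) * 1 := by ring
    _ ≤ _ := h4
    _ = _ := by ring

section asymptotics

variable {k D : ℕ} {h : Fin k → ℕ} {b C β : ℝ}

theorem eventually_log_rpow_gt (hβ : 0 < β) (M : ℝ) : ∀ᶠ N : ℕ in atTop, M < β * Real.log N := by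
  filter_upwards [tendsto_log_natCast.eventually_gt_atTop (M / β)] with N hN
  rwa [div_lt_iff₀' hβ] at hN

theorem abs_selbergWeight_le_weightBound (hk : 1 ≤ k) (hD : 2 * k ≤ D) {κ : ℝ} (hκ : 0 ≤ κ)
    (hC : 0 ≤ C) (hG : ∀ R, HasLogGrowth (sievePrimes D R) k κ C) (hb : 0 ≤ b) {N : ℕ} (hN : 0 < N)
    (hR : 1 < (N : ℝ) ^ β) :
    ∀ S ⊆ sievePrimes D ((N : ℝ) ^ β), |selbergWeight k D b ((N : ℝ) ^ β) S| ≤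
      weightBound k b κ C β N := by
  intro S hS
  have := abs_selbergWeight_le hk hD hκ hC (hG _) hb hR hS
  rwa [Real.log_rpow (by exact_mod_cast hN)] at this

theorem one_lt_rpow_of_log_pos {N : ℕ} (hN : 0 < N) (h : 0 < β * Real.log N) : 1 < (N : ℝ) ^ β := by
  rw [← Real.log_pos_iff (by positivity), Real.log_rpow (by exact_mod_cast hN)]
  exact h

theorem growth_constant_nonneg (k D : ℕ) : 0 ≤ sieveDensity D * Real.exp (2 * k / D) :=
  mul_nonneg (sieveDensity_pos D).le (Real.exp_pos _).le

theorem tendsto_one_add_const_div_log (hβ : 0 < β) (c : ℝ) :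
    Tendsto (fun N : ℕ => 1 + c / (β * Real.log N)) atTop (nhds 1) := by
  have h1 : Tendsto (fun N : ℕ => β * Real.log N) atTop atTop :=
    tendsto_log_natCast.const_mul_atTop hβ
  have := (tendsto_const_nhds (x := (1 : ℝ))).add (h1.const_div_atTop c)
  simpa using this

theorem eventually_sum_sieveWeight_le (hk : 1 ≤ k) (hD : 2 * k ≤ D) (hinj : Function.Injective h)
    (hhD : ∀ i, h i ≤ D) (hb : 0 ≤ b) (hC : 0 ≤ C)
    (hG : ∀ R, HasLogGrowth (sievePrimes D R) k (sieveDensity D * Real.exp (2 * k / D)) C)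
    (hβ : 0 < β) (hβ2 : 2 * β < 1) (v : ℕ) {δ : ℝ} (hδ : 0 < δ) :
    ∀ᶠ N : ℕ in atTop, ∑ n ∈ sieveRange D v N, sieveWeight h D b ((N : ℝ) ^ β) n ≤
      sieveUnit k D β N * (Real.exp (2 * k / D) ^ k *
        (1 / k.factorial + 2 * b / (k + 1).factorial + 2 * b ^ 2 / (k + 2).factorial) + δ) := by
  set A := 1 / (k.factorial : ℝ) + 2 * b / (k + 1).factorial + 2 * b ^ 2 / (k + 2).factorial with hA
  set E := Real.exp (2 * k / D) with hE
  have hκ := growth_constant_nonneg k D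
  have herr := eventually_abs_le_sieveUnit (k := k) (D := D) hβ
    (weightBound_error_isLittleO k (3 * k) b (sieveDensity D * E) C β 0 (by linarith))
    (half_pos hδ)
  have hlim : Tendsto (fun N : ℕ => E ^ k * (1 + k * C / (β * Real.log N)) ^ (k + 2) * A) atTop
      (nhds (E ^ k * 1 ^ (k + 2) * A)) :=
    (((tendsto_one_add_const_div_log hβ (k * C)).pow (k + 2)).const_mul (E ^ k)).mul_const A
  rw [one_pow, mul_one] at hlim
  filter_upwards [herr, hlim.eventually_lt_const (by linarith : E ^ k * A < E ^ k * A + δ / 2),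
    eventually_log_rpow_gt hβ 0, eventually_gt_atTop 0] with N h1 h2 h3 hN
  have hR := one_lt_rpow_of_log_pos (β := β) hN h3
  have hlR : Real.log ((N : ℝ) ^ β) = β * Real.log N := Real.log_rpow (by exact_mod_cast hN) β
  have hmain := (abs_le.1 (abs_sum_sieveWeight_sub_le (v := v) (N := N) hinj hhD (by linarith)
    (abs_selbergWeight_le_weightBound hk hD hκ hC hG hb hN hR))).2
  have hform := selbergForm_natural_le hk hD hκ hC (hG _) hb hR
  have hcard := sum_pow_card_le hD hκ hC (hG ((N : ℝ) ^ β)) (3 * k) hR.le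
  rw [hlR] at hform hcard
  have hcard' := mul_le_mul_of_nonneg_left hcard (sq_nonneg (weightBound k b (sieveDensity D * E) C β N))
  rw [Real.rpow_zero, one_mul] at h1
  have h1' := (le_abs_self _).trans h1
  have hform' := mul_le_mul_of_nonneg_left hform
    (by positivity : 0 ≤ (N : ℝ) / smallModulus D)
  have e1 : (N : ℝ) / smallModulus D * ((sieveDensity D * E) ^ k * (β * Real.log N) ^ k *
      (1 + k * C / (β * Real.log N)) ^ (k + 2) * A) =
      sieveUnit k D β N * (E ^ k * (1 + k * C / (β * Real.log N)) ^ (k + 2) * A) := by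
    rw [sieveUnit, mul_pow]; ring
  rw [e1] at hform'
  have h4 := mul_le_mul_of_nonneg_left h2.le (sieveUnit_nonneg k D hβ.le N)
  linarith

theorem eventually_le_sum_prime_sieveWeight (hk : 2 ≤ k) (hD : 2 * k ≤ D)
    (hinj : Function.Injective h) (hhD : ∀ i, h i ≤ D) (hb : 0 ≤ b) (hC : 0 ≤ C)
    (hG : ∀ R, HasLogGrowth (sievePrimes D R) k (sieveDensity D * Real.exp (2 * k / D)) C)
    (hβ : 0 < β) (hβ2 : 2 * β < 1) {ϑ : ℝ} (hβϑ : 2 * β < ϑ) (hϑ : IsPrimeLevel ϑ) {v : ℕ}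
    (hv : ∀ i, Nat.Coprime (v + h i) (smallModulus D)) (m : Fin k) {δ : ℝ} (hδ : 0 < δ) :
    ∀ᶠ N : ℕ in atTop, sieveUnit k D β N * (β * Real.log N) *
      ((2 / (k + 1).factorial + 6 * b / (k + 2).factorial + 6 * b ^ 2 / (k + 3).factorial) - δ) ≤
      ∑ n ∈ sieveRange D v N, (if (n + h m).Prime then Real.log (n + h m : ℕ) else 0) *
        sieveWeight h D b ((N : ℝ) ^ β) n := by
  set B := 2 / ((k + 1).factorial : ℝ) + 6 * b / (k + 2).factorial + 6 * b ^ 2 / (k + 3).factorial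
  have hκ := growth_constant_nonneg k D
  have htriv : ∀ M q : ℕ, 2 ≤ M → 1 ≤ q → q ≤ M →
      maxPrimeError M q ≤ 4 * Real.log M * ((M : ℝ) / q.totient) := by
    intro M q hM hq hqM
    refine (maxPrimeError_le M q hq (by omega)).trans ?_
    have hM' : (2 : ℝ) ≤ M := by exact_mod_cast hM
    have hq' : (0 : ℝ) < q := by exact_mod_cast hq
    have hl : 1 / 2 ≤ Real.log M := by
      have h1 := Real.log_le_log two_pos hM'
      have := Real.log_two_gt_d9
      linarith
    have h1 : 1 ≤ (M : ℝ) / q := (one_le_div hq').2 (by exact_mod_cast hqM)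
    have htp : (0 : ℝ) < q.totient := by exact_mod_cast Nat.totient_pos.2 hq
    have h2 : (M : ℝ) / q ≤ M / q.totient :=
      div_le_div_of_nonneg_left (by linarith) htp (by exact_mod_cast Nat.totient_le q)
    nlinarith
  have herr : ∀ f : ℕ → ℕ, (∀ N, N ≤ f N) → (∀ᶠ N in atTop, f N ≤ 4 * N) → _ := fun f hf1 hf2 =>
    eventually_abs_le_sieveUnit (k := k) (D := D) hβ
    (level_error_isLittleO (b := b) hD hκ hC hG (by omega) hβ hβ2 hβϑ maxPrimeError maxPrimeError_nonneg
      htriv hϑ f hf1 hf2 (3 * k)) (half_pos hδ)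
  have herr1 := herr (fun N => 2 * N + h m) (fun N => by omega) (by
    filter_upwards [eventually_ge_atTop (h m)] with N hN; omega)
  have herr2 := herr (fun N => N + h m) (fun N => by omega) (by
    filter_upwards [eventually_ge_atTop (h m)] with N hN; omega)
  have hDR : ∀ᶠ N : ℕ in atTop, (D : ℝ) ≤ (N : ℝ) ^ β :=
    ((tendsto_rpow_atTop hβ).comp tendsto_natCast_atTop_atTop).eventually_ge_atTop (D : ℝ)
  filter_upwards [herr1, herr2, hDR, eventually_log_rpow_gt hβ 1, eventually_gt_atTop 0] with
    N h1 h2 hDN h3 hN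
  have hR := one_lt_rpow_of_log_pos (β := β) hN (by linarith)
  have hlR : Real.log ((N : ℝ) ^ β) = β * Real.log N := Real.log_rpow (by exact_mod_cast hN) β
  have hN1 : (1 : ℝ) ≤ N := by exact_mod_cast hN
  have hRN : (N : ℝ) ^ β ≤ N := by
    calc (N : ℝ) ^ β ≤ (N : ℝ) ^ (1 : ℝ) := Real.rpow_le_rpow_of_exponent_le hN1 (by linarith)
      _ = N := Real.rpow_one _
  have hmain := (abs_le.1 (abs_sum_prime_sieveWeight_sub_le (v := v) (N := N) hinj hhD (by linarith)
    hRN (abs_selbergWeight_le_weightBound (by omega) hD hκ hC hG hb hN hR) m (hv m))).1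
  have hform := le_selbergForm_prime hk hD hDN hb hR
  rw [hlR] at hform
  have hform' := mul_le_mul_of_nonneg_left hform
    (by positivity : 0 ≤ (N : ℝ) / (smallModulus D).totient)
  -- Since φ(W) is W times the sieve density, one of the k + 1 density factors of the prime form
  -- cancels, and the result is comparable with the mass.
  have e1 : (N : ℝ) / (smallModulus D).totient * (sieveDensity D ^ (k + 1) *
      (β * Real.log N) ^ (k + 1) * B) = sieveUnit k D β N * (β * Real.log N) * B := by
    have hκ0 := sieveDensity_pos D
    have hW : (0 : ℝ) < smallModulus D := by exact_mod_cast smallModulus_pos D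
    rw [sieveUnit, totient_smallModulus]
    field_simp
    ring
  rw [e1] at hform'
  have h1' := (le_abs_self _).trans h1
  have h2' := (le_abs_self _).trans h2
  have e2 : ∀ X Y : Finset ℕ → ℝ, ∑ S ∈ (sievePrimes D ((N : ℝ) ^ β)).powerset with
      (primeProd S : ℝ) ≤ ((N : ℝ) ^ β) ^ 2, ((3 * k : ℕ) : ℝ) ^ S.card * (X S + Y S) =
      ∑ S ∈ (sievePrimes D ((N : ℝ) ^ β)).powerset with
      (primeProd S : ℝ) ≤ ((N : ℝ) ^ β) ^ 2, ((3 * k : ℕ) : ℝ) ^ S.card * X S +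
      ∑ S ∈ (sievePrimes D ((N : ℝ) ^ β)).powerset with
      (primeProd S : ℝ) ≤ ((N : ℝ) ^ β) ^ 2, ((3 * k : ℕ) : ℝ) ^ S.card * Y S := by
    intro X Y
    rw [← Finset.sum_add_distrib]
    exact Finset.sum_congr rfl fun S _ => by ring
  rw [e2, mul_add] at hmain
  have hU := sieveUnit_nonneg k D hβ.le N
  have h4 : δ * sieveUnit k D β N ≤ sieveUnit k D β N * (β * Real.log N) * δ := by
    have := mul_le_mul_of_nonneg_left h3.le (mul_nonneg hU hδ.le)
    linarith
  linarith

theorem eventually_abs_sum_liouville_sieveWeight_le (hk : 1 ≤ k) (hD : 2 * k ≤ D)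
    (hinj : Function.Injective h) (hhD : ∀ i, h i ≤ D) (hb : 0 ≤ b) (hC : 0 ≤ C)
    (hG : ∀ R, HasLogGrowth (sievePrimes D R) k (sieveDensity D * Real.exp (2 * k / D)) C)
    (hβ : 0 < β) (hβ2 : 2 * β < 1) {ϑ : ℝ} (hβϑ : 2 * β < ϑ) (hϑ : IsLiouvilleLevel ϑ) (v : ℕ)
    (m : Fin k) {δ : ℝ} (hδ : 0 < δ) :
    ∀ᶠ N : ℕ in atTop, |∑ n ∈ sieveRange D v N, (ArithmeticFunction.liouville (n + h m) : ℝ) *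
        sieveWeight h D b ((N : ℝ) ^ β) n| ≤ δ * sieveUnit k D β N := by
  have hκ := growth_constant_nonneg k D
  have htriv : ∀ M q : ℕ, 2 ≤ M → 1 ≤ q → q ≤ M →
      maxLiouvilleSum M q ≤ 4 * Real.log M * ((M : ℝ) / q.totient) := by
    intro M q hM hq hqM
    refine (maxLiouvilleSum_le M q hq).trans ?_
    have hM' : (2 : ℝ) ≤ M := by exact_mod_cast hM
    have hq' : (0 : ℝ) < q := by exact_mod_cast hq
    have hl : 1 / 2 ≤ Real.log M := by
      have h1 := Real.log_le_log two_pos hM'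
      have := Real.log_two_gt_d9
      linarith
    have h1 : 1 ≤ (M : ℝ) / q := (one_le_div hq').2 (by exact_mod_cast hqM)
    have htp : (0 : ℝ) < q.totient := by exact_mod_cast Nat.totient_pos.2 hq
    have h2 : (M : ℝ) / q ≤ M / q.totient :=
      div_le_div_of_nonneg_left (by linarith) htp (by exact_mod_cast Nat.totient_le q)
    nlinarith
  have herr := eventually_abs_le_sieveUnit (k := k) (D := D) hβ
    (level_error_isLittleO (b := b) hD hκ hC hG hk hβ hβ2 hβϑ maxLiouvilleSum maxLiouvilleSum_nonneg
      htriv hϑ (fun N => 2 * N + h m) (fun N => by omega) (by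
        filter_upwards [eventually_ge_atTop (h m)] with N hN; omega) (3 * k)) (half_pos hδ)
  filter_upwards [herr, eventually_log_rpow_gt hβ 0, eventually_gt_atTop 0] with N h1 h3 hN
  have hR := one_lt_rpow_of_log_pos (β := β) hN h3
  refine (abs_sum_liouville_sieveWeight_le (v := v) (N := N) hinj hhD (by linarith)
    (abs_selbergWeight_le_weightBound hk hD hκ hC hG hb hN hR) m).trans ?_
  have h1' := (le_abs_self _).trans h1
  have e : ∑ S ∈ (sievePrimes D ((N : ℝ) ^ β)).powerset with
      (primeProd S : ℝ) ≤ ((N : ℝ) ^ β) ^ 2, ((3 * k : ℕ) : ℝ) ^ S.card *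
        (2 * maxLiouvilleSum (2 * N + h m) (smallModulus D * primeProd S)) =
      2 * ∑ S ∈ (sievePrimes D ((N : ℝ) ^ β)).powerset with
      (primeProd S : ℝ) ≤ ((N : ℝ) ^ β) ^ 2, ((3 * k : ℕ) : ℝ) ^ S.card *
        maxLiouvilleSum (2 * N + h m) (smallModulus D * primeProd S) := by
    rw [Finset.mul_sum]
    exact Finset.sum_congr rfl fun S _ => by ring
  rw [e]
  linarith

/-- The contribution of the `n` for which `n + h m` has a prime factor in `(D, (2N)^c]`. -/
theorem eventually_sum_small_factor_le (hk : 1 ≤ k) (hD : 2 * k ≤ D)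
    (hinj : Function.Injective h) (hhD : ∀ i, h i ≤ D) (hb : 0 ≤ b) (hC : 0 ≤ C)
    (hG : ∀ R, HasLogGrowth (sievePrimes D R) k (sieveDensity D * Real.exp (2 * k / D)) C)
    (hβ : 0 < β) {c : ℝ} (hc : 0 < c) (hβc : 2 * β + c < 1) (v : ℕ) (m : Fin k) :
    ∀ᶠ N : ℕ in atTop, ∑ q ∈ (sievePrimes D ((N : ℝ) ^ β)).filter (fun q : ℕ => (q : ℝ) ≤ (2 * N : ℝ) ^ c),
      ∑ n ∈ sieveRange D v N, (if q ∣ n + h m then (1 : ℝ) else 0) *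
        sieveWeight h D b ((N : ℝ) ^ β) n ≤
      sieveUnit k D β N * (Real.exp (2 * k / D) ^ k * ((1 + b) ^ 2 * (8 * c / β))) := by
  set E := Real.exp (2 * k / D) with hE
  have hE0 : 0 < E := Real.exp_pos _
  have hκ := growth_constant_nonneg k D
  set C' := C * (Real.exp C + 1) with hC'
  have hδ : 0 < E ^ k * ((1 + b) ^ 2 * (c / β)) := by positivity
  have herr := eventually_abs_le_sieveUnit (k := k) (D := D) hβ
    (weightBound_error_isLittleO k (3 * k) b (sieveDensity D * E) C β c hβc) (half_pos hδ)
  have hlim : Tendsto (fun N : ℕ => (1 + k * C / (β * Real.log N)) ^ k *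
      (6 * c / β * (1 + (Real.log 2 + C' / (6 * c)) / (1 * Real.log N)))) atTop
      (nhds (1 ^ k * (6 * c / β * 1))) :=
    ((tendsto_one_add_const_div_log hβ (k * C)).pow k).mul
      ((tendsto_one_add_const_div_log one_pos _).const_mul _)
  rw [one_pow, mul_one, one_mul] at hlim
  -- The prime sum gives 6c/β in the limit; one further c/β absorbs the convergence, and the eighth
  -- is reserved for the accumulated counting errors.
  have hlt : 6 * c / β < 7 * c / β := by
    rw [div_lt_div_iff_of_pos_right hβ]; linarith
  filter_upwards [herr, hlim.eventually_lt_const hlt, eventually_log_rpow_gt hβ 0,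
    eventually_gt_atTop 0] with N h1 h2 h3 hN
  have hN0 : (0 : ℝ) < N := by exact_mod_cast hN
  have hR := one_lt_rpow_of_log_pos (β := β) hN h3
  have hlR : Real.log ((N : ℝ) ^ β) = β * Real.log N := Real.log_rpow hN0 β
  set R := (N : ℝ) ^ β with hRdef
  set L := β * Real.log N with hL
  set Λ := weightBound k b (sieveDensity D * E) C β N with hΛ
  set err := Λ ^ 2 * (R ^ 2 * ((sieveDensity D * E) ^ (3 * k) * (2 * L + (3 * k : ℕ) * C) ^ (3 * k))) with herrdef
  have herr0 : 0 ≤ err := by positivity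
  set z := (2 * N : ℝ) ^ c with hz
  have hz1 : 1 ≤ z := by
    refine Real.one_le_rpow ?_ hc.le
    have : (1 : ℝ) ≤ N := by exact_mod_cast hN
    linarith
  set F := (sieveDensity D * E) ^ k * (L + k * C) ^ k * ((1 + b) ^ 2 / L) * (N / smallModulus D) with hF
  have hF0 : 0 ≤ F := by positivity
  have hterm : ∀ q ∈ (sievePrimes D R).filter (fun q : ℕ => (q : ℝ) ≤ z),
      ∑ n ∈ sieveRange D v N, (if q ∣ n + h m then (1 : ℝ) else 0) * sieveWeight h D b R n ≤
      F * ((2 * Real.log q + C) / q) + err := by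
    intro q hq
    rw [Finset.mem_filter] at hq
    have hmain := (abs_le.1 (abs_sum_dvd_sieveWeight_sub_le (v := v) (N := N) hinj hhD (by linarith)
      (abs_selbergWeight_le_weightBound hk hD hκ hC hG hb hN hR) m hq.1)).2
    have hform := selbergForm_update_le hk hD hκ hC (hG _) hb hR hq.1
    have hcard := mul_le_mul_of_nonneg_left (sum_pow_card_le hD hκ hC (hG R) (3 * k) hR.le)
      (sq_nonneg Λ)
    rw [hlR] at hform hcard
    have hform' := mul_le_mul_of_nonneg_left hform
      (by positivity : 0 ≤ (N : ℝ) / (smallModulus D * q))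
    have e : (N : ℝ) / (smallModulus D * q) * ((sieveDensity D * E) ^ k * (L + k * C) ^ k *
        ((1 + b) ^ 2 * ((2 * Real.log q + C) / L))) = F * ((2 * Real.log q + C) / q) := by
      rw [hF, ← div_div]; ring
    rw [e] at hform'
    linarith
  refine (Finset.sum_le_sum hterm).trans ?_
  rw [Finset.sum_add_distrib, ← Finset.mul_sum, Finset.sum_const, nsmul_eq_mul]
  have hsub : (sievePrimes D R).filter (fun q : ℕ => (q : ℝ) ≤ z) ⊆ smallPrimes ⌊z⌋₊ := by
    intro q hq
    rw [Finset.mem_filter] at hq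
    exact mem_smallPrimes.2 ⟨(mem_sievePrimes.1 hq.1).1, Nat.le_floor hq.2⟩
  have hcardz : (((sievePrimes D R).filter (fun q : ℕ => (q : ℝ) ≤ z)).card : ℝ) ≤ z := by
    have h4 : ((sievePrimes D R).filter (fun q : ℕ => (q : ℝ) ≤ z)).card ≤ ⌊z⌋₊ := by
      refine (Finset.card_le_card (hsub.trans (Finset.filter_subset _ _))).trans ?_
      rw [Nat.card_Icc, Nat.add_sub_cancel]
    have h5 := Nat.floor_le (by linarith : 0 ≤ z)
    have h6 : (((sievePrimes D R).filter (fun q : ℕ => (q : ℝ) ≤ z)).card : ℝ) ≤ (⌊z⌋₊ : ℝ) := by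
      exact_mod_cast h4
    linarith
  have hz2 : z ≤ 2 * (N : ℝ) ^ c := by
    rw [hz, Real.mul_rpow two_pos.le hN0.le]
    refine mul_le_mul_of_nonneg_right ?_ (by positivity)
    calc (2 : ℝ) ^ c ≤ 2 ^ (1 : ℝ) := Real.rpow_le_rpow_of_exponent_le one_le_two (by linarith)
      _ = 2 := Real.rpow_one 2
  have hlogz : Real.log ⌊z⌋₊ ≤ c * (Real.log N + Real.log 2) := by
    have h4 : (1 : ℝ) ≤ (⌊z⌋₊ : ℝ) := by
      exact_mod_cast (Nat.one_le_floor_iff z).2 hz1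
    refine (Real.log_le_log (by linarith) (Nat.floor_le (by linarith))).trans (le_of_eq ?_)
    rw [hz, Real.log_rpow (by linarith), Real.log_mul two_ne_zero hN0.ne']; ring
  have hsum : ∑ q ∈ (sievePrimes D R).filter (fun q : ℕ => (q : ℝ) ≤ z), (2 * Real.log q + C) / q ≤
      6 * (c * (Real.log N + Real.log 2)) + C' := by
    refine (Finset.sum_le_sum_of_subset_of_nonneg hsub fun q _ _ => ?_).trans
      ((sum_log_add_const_div_primes_le hC ⌊z⌋₊).trans ?_)
    · have := Real.log_natCast_nonneg q
      positivity
    · linarith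
  have h5 := mul_le_mul_of_nonneg_left hsum hF0
  have h6 : (((sievePrimes D R).filter (fun q : ℕ => (q : ℝ) ≤ z)).card : ℝ) * err ≤
      2 * ((N : ℝ) ^ c * err) := by
    have := mul_le_mul_of_nonneg_right (hcardz.trans hz2) herr0
    linarith
  have h1' := (le_abs_self _).trans h1
  have hU := sieveUnit_nonneg k D hβ.le N
  have e2 : F * (6 * (c * (Real.log N + Real.log 2)) + C') = sieveUnit k D β N * (E ^ k * (1 + b) ^ 2 *
      ((1 + k * C / L) ^ k * (6 * c / β * (1 + (Real.log 2 + C' / (6 * c)) / (1 * Real.log N))))) := by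
    have hlN : 0 < Real.log N := by
      by_contra hneg
      have : β * Real.log N ≤ 0 := mul_nonpos_of_nonneg_of_nonpos hβ.le (not_lt.1 hneg)
      linarith
    have hx : (L + k * C) ^ k = L ^ k * (1 + k * C / L) ^ k := by
      rw [← mul_pow]; congr 1; field_simp
    have hy : (1 / L) * (6 * (c * (Real.log N + Real.log 2)) + C') =
        6 * c / β * (1 + (Real.log 2 + C' / (6 * c)) / (1 * Real.log N)) := by
      rw [hL]; field_simp; ring
    rw [← hy, hF, hx, sieveUnit, mul_pow]
    ring
  have h7 := mul_le_mul_of_nonneg_left (mul_le_mul_of_nonneg_left h2.le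
    (by positivity : 0 ≤ E ^ k * (1 + b) ^ 2)) hU
  rw [← e2] at h7
  have e3 : sieveUnit k D β N * (E ^ k * ((1 + b) ^ 2 * (8 * c / β))) =
      sieveUnit k D β N * (E ^ k * (1 + b) ^ 2 * (7 * c / β)) +
      2 * (E ^ k * ((1 + b) ^ 2 * (c / β)) / 2 * sieveUnit k D β N) := by ring
  rw [e3]
  linarith

end asymptotics

/-! ### The sieve inequality and existence of sieve points. -/

/-- Admissibility leaves a free class r modulo each prime; n ≡ −r avoids that prime, and the Chinese
remainder theorem combines the choices. -/
theorem exists_forall_coprime_smallModulus {k : ℕ} {h : Fin k → ℕ} (hh : IsAdmissibleTuple h)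
    (D : ℕ) : ∃ v : ℕ, ∀ i, Nat.Coprime (v + h i) (smallModulus D) := by
  have hr : ∀ p : ℕ, ∃ a : ℕ, p.Prime → ∀ i, ¬ p ∣ a + h i := by
    intro p
    by_cases hp : p.Prime
    · have : NeZero p := ⟨hp.ne_zero⟩
      obtain ⟨r, hr⟩ := hh.2 p hp
      refine ⟨(-r).val, fun _ i hd => hr i ?_⟩
      have := (ZMod.natCast_eq_zero_iff _ _).2 hd
      rw [Nat.cast_add, ZMod.natCast_zmod_val] at this
      linear_combination this
    · exact ⟨0, fun h => absurd h hp⟩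
  choose a ha using hr
  obtain ⟨v, hv⟩ := Nat.chineseRemainderOfFinset a id (smallPrimes D)
    (fun p hp => (mem_smallPrimes.1 hp).1.ne_zero)
    (fun p hp q hq hpq => (Nat.coprime_primes (mem_smallPrimes.1 (mem_coe.1 hp)).1
      (mem_smallPrimes.1 (mem_coe.1 hq)).1).2 hpq)
  refine ⟨v, fun i => Nat.Coprime.symm ?_⟩
  by_contra hc
  obtain ⟨p, hp, h1, h2⟩ := Nat.Prime.not_coprime_iff_dvd.1 hc
  have hpD := (prime_dvd_smallModulus_iff hp).1 h1
  have hmod := hv p (mem_smallPrimes.2 ⟨hp, hpD⟩)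
  exact ha p hp i (((hmod.add_right (h i)).dvd_iff dvd_rfl).1 h2)

/-- All components `n + h i` have smallest prime factor above `n ^ c`, and either two components
other than `n + h j` are prime, or `n + h j` has an odd number of prime factors and another
component is prime. -/
def IsSievePoint {k : ℕ} (h : Fin k → ℕ) (c : ℝ) (j : Fin k) (n : ℕ) : Prop :=
  (∀ i, (n : ℝ) ^ c < ((n + h i).minFac : ℝ)) ∧
    ((∃ μ ν : Fin k, μ ≠ j ∧ ν ≠ j ∧ μ ≠ ν ∧ (n + h μ).Prime ∧ (n + h ν).Prime) ∨
      (Odd (ArithmeticFunction.cardFactors (n + h j)) ∧ ∃ ν : Fin k, ν ≠ j ∧ (n + h ν).Prime))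

/-- If n is rough, failing to be a sieve point leaves at most one prime off j, and if there is one
then λ(n + h_j) = 1 and the first term equals 1. If n is not rough, some smallest prime factor lies
in `Q`, and the last term is at least k, which exceeds any count of primes. -/
theorem sum_prime_indicator_le {k : ℕ} {h : Fin k → ℕ} {c : ℝ} {j : Fin k} {n : ℕ} (hn : 0 < n)
    (hbad : ¬ IsSievePoint h c j n) {Q : Finset ℕ}
    (hQ : ∀ i, ((n + h i).minFac : ℝ) ≤ (n : ℝ) ^ c → (n + h i).minFac ∈ Q) :
    ∑ ν ∈ univ.erase j, (if (n + h ν).Prime then (1 : ℝ) else 0) ≤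
      (1 + (ArithmeticFunction.liouville (n + h j) : ℝ)) / 2 +
        k * ∑ i, ∑ q ∈ Q, (if q ∣ n + h i then (1 : ℝ) else 0) := by
  classical
  have hl : (ArithmeticFunction.liouville (n + h j) : ℝ) =
      (-1) ^ ArithmeticFunction.cardFactors (n + h j) := by
    rw [ArithmeticFunction.liouville_apply (by omega)]; push_cast; rfl
  have hl1 : 0 ≤ (1 + (ArithmeticFunction.liouville (n + h j) : ℝ)) / 2 := by
    rw [hl]
    rcases neg_one_pow_eq_or ℝ (ArithmeticFunction.cardFactors (n + h j)) with e | e <;>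
      rw [e] <;> norm_num
  have hs0 : ∀ i, 0 ≤ ∑ q ∈ Q, (if q ∣ n + h i then (1 : ℝ) else 0) := fun i =>
    sum_nonneg fun q _ => by split_ifs <;> norm_num
  have hs : 0 ≤ ∑ i, ∑ q ∈ Q, (if q ∣ n + h i then (1 : ℝ) else 0) := sum_nonneg fun i _ => hs0 i
  rw [sum_boole]
  by_cases hrough : ∀ i, (n : ℝ) ^ c < ((n + h i).minFac : ℝ)
  · have hno : ¬ _ := fun hx => hbad ⟨hrough, hx⟩
    push Not at hno
    have hcard : (#{ν ∈ univ.erase j | (n + h ν).Prime} : ℝ) ≤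
        (1 + (ArithmeticFunction.liouville (n + h j) : ℝ)) / 2 := by
      rcases Finset.eq_empty_or_nonempty {ν ∈ univ.erase j | (n + h ν).Prime} with he | ⟨ν, hν⟩
      · rw [he]; simpa using hl1
      · have h1 : #{ν ∈ univ.erase j | (n + h ν).Prime} ≤ 1 := by
          refine card_le_one.2 fun μ hμ ν hν => ?_
          rw [mem_filter, mem_erase] at hμ hν
          by_contra hne
          exact hno.1 μ ν hμ.1.1 hν.1.1 hne hμ.2 hν.2
        rw [mem_filter, mem_erase] at hν
        have heven : Even (ArithmeticFunction.cardFactors (n + h j)) := by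
          rw [← Nat.not_odd_iff_even]
          exact fun ho => hno.2 ho ν hν.1.1 hν.2
        rw [hl, heven.neg_one_pow]
        norm_num
        exact_mod_cast h1
    have := mul_nonneg (Nat.cast_nonneg k : (0 : ℝ) ≤ k) hs
    linarith
  · push Not at hrough
    obtain ⟨i, hi⟩ := hrough
    have h1 : (1 : ℝ) ≤ ∑ i, ∑ q ∈ Q, (if q ∣ n + h i then (1 : ℝ) else 0) := by
      refine le_trans ?_ (single_le_sum (fun i _ => hs0 i) (mem_univ i))
      refine le_trans ?_ (single_le_sum (f := fun q => if q ∣ n + h i then (1 : ℝ) else 0)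
        (fun q _ => by split_ifs <;> norm_num) (hQ i hi))
      rw [if_pos (Nat.minFac_dvd _)]
    have h2 : (#{ν ∈ univ.erase j | (n + h ν).Prime} : ℝ) ≤ k := by
      have : #{ν ∈ univ.erase j | (n + h ν).Prime} ≤ #(univ : Finset (Fin k)) :=
        card_le_card (subset_univ _)
      rw [card_univ, Fintype.card_fin] at this
      exact_mod_cast this
    have := mul_le_mul_of_nonneg_left h1 (Nat.cast_nonneg k : (0 : ℝ) ≤ k)
    linarith

/-- The constant of the total sieve mass. -/
noncomputable def massConstant (k : ℕ) (b : ℝ) : ℝ :=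
  1 / k.factorial + 2 * b / (k + 1).factorial + 2 * b ^ 2 / (k + 2).factorial

/-- The constant of the sieve mass over the primes. -/
noncomputable def primeConstant (k : ℕ) (b : ℝ) : ℝ :=
  2 / (k + 1).factorial + 6 * b / (k + 2).factorial + 6 * b ^ 2 / (k + 3).factorial

theorem rpow_two_mul_le {c β : ℝ} (hc : 0 ≤ c) (hcβ : 2 * c ≤ β) {N : ℕ} (hN : 2 ≤ N) :
    (2 * N : ℝ) ^ c ≤ (N : ℝ) ^ β := by
  have h2 : (2 : ℝ) ≤ N := by exact_mod_cast hN
  calc (2 * N : ℝ) ^ c ≤ ((N : ℝ) ^ (2 : ℝ)) ^ c := by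
        refine Real.rpow_le_rpow (by positivity) ?_ hc
        rw [Real.rpow_two]; nlinarith
    _ = (N : ℝ) ^ (2 * c) := (Real.rpow_mul (by linarith) _ _).symm
    _ ≤ _ := Real.rpow_le_rpow_of_exponent_le (by linarith) hcβ

/-- The presieved class makes n + h_i coprime to all primes up to `D`, so a small prime factor is
automatically a sieving prime. -/
theorem minFac_mem_sievePrimes {k D v N n : ℕ} {h : Fin k → ℕ} {c β : ℝ} (hc : 0 ≤ c)
    (hcβ : 2 * c ≤ β) (hN : 2 ≤ N) (hv : ∀ i, Nat.Coprime (v + h i) (smallModulus D))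
    (hn : n ∈ sieveRange D v N) (i : Fin k) (hi : ((n + h i).minFac : ℝ) ≤ (n : ℝ) ^ c) :
    (n + h i).minFac ∈ (sievePrimes D ((N : ℝ) ^ β)).filter
      (fun q : ℕ => (q : ℝ) ≤ (2 * N : ℝ) ^ c) := by
  rw [sieveRange, mem_filter, mem_Ioc] at hn
  have hle : ((n + h i).minFac : ℝ) ≤ (2 * N : ℝ) ^ c := by
    refine hi.trans (Real.rpow_le_rpow (by positivity) ?_ hc)
    exact_mod_cast hn.1.2
  have hp : (n + h i).minFac.Prime := Nat.minFac_prime (by omega)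
  rw [mem_filter, mem_sievePrimes]
  refine ⟨⟨hp, ?_, Nat.le_floor (hle.trans (rpow_two_mul_le hc hcβ hN))⟩, hle⟩
  by_contra hD
  have hW := (prime_dvd_smallModulus_iff hp).2 (not_lt.1 hD)
  have h1 : (n + h i).minFac ∣ v + h i :=
    ((hn.2.add_right (h i)).dvd_iff hW).1 (Nat.minFac_dvd _)
  exact Nat.Prime.not_coprime_iff_dvd.2 ⟨_, hp, h1, hW⟩ (hv i)

theorem log_mul_sum_erase_le {k D v N : ℕ} {h : Fin k → ℕ} {b c β : ℝ} {j : Fin k} (hc : 0 ≤ c)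
    (hcβ : 2 * c ≤ β) (hN : 2 ≤ N) (hhN : ∀ i, h i ≤ N)
    (hv : ∀ i, Nat.Coprime (v + h i) (smallModulus D))
    (hbad : ∀ n, N < n → ¬ IsSievePoint h c j n) :
    ∑ ν ∈ univ.erase j, ∑ n ∈ sieveRange D v N,
        (if (n + h ν).Prime then Real.log (n + h ν : ℕ) else 0) *
          sieveWeight h D b ((N : ℝ) ^ β) n ≤
      Real.log (3 * N) * ((∑ n ∈ sieveRange D v N, sieveWeight h D b ((N : ℝ) ^ β) n +
        ∑ n ∈ sieveRange D v N, (ArithmeticFunction.liouville (n + h j) : ℝ) *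
          sieveWeight h D b ((N : ℝ) ^ β) n) / 2 +
        k * ∑ i, ∑ q ∈ (sievePrimes D ((N : ℝ) ^ β)).filter
          (fun q : ℕ => (q : ℝ) ≤ (2 * N : ℝ) ^ c), ∑ n ∈ sieveRange D v N,
            (if q ∣ n + h i then (1 : ℝ) else 0) * sieveWeight h D b ((N : ℝ) ^ β) n) := by
  set w := sieveWeight h D b ((N : ℝ) ^ β) with hw
  set Q := (sievePrimes D ((N : ℝ) ^ β)).filter (fun q : ℕ => (q : ℝ) ≤ (2 * N : ℝ) ^ c)
  have hw0 : ∀ n, 0 ≤ w n := fun n => sieveWeight_nonneg h D b _ n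
  have hN2 : (2 : ℝ) ≤ N := by exact_mod_cast hN
  have hlog : 0 ≤ Real.log (3 * N) := Real.log_nonneg (by linarith)
  have hR : (∑ n ∈ sieveRange D v N, w n + ∑ n ∈ sieveRange D v N,
      (ArithmeticFunction.liouville (n + h j) : ℝ) * w n) / 2 +
      k * ∑ i, ∑ q ∈ Q, ∑ n ∈ sieveRange D v N, (if q ∣ n + h i then (1 : ℝ) else 0) * w n =
      ∑ n ∈ sieveRange D v N, ((1 + (ArithmeticFunction.liouville (n + h j) : ℝ)) / 2 +
        k * ∑ i, ∑ q ∈ Q, (if q ∣ n + h i then (1 : ℝ) else 0)) * w n := by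
    have e1 : ∑ i, ∑ q ∈ Q, ∑ n ∈ sieveRange D v N,
        (if q ∣ n + h i then (1 : ℝ) else 0) * w n =
        ∑ n ∈ sieveRange D v N, (∑ i, ∑ q ∈ Q, (if q ∣ n + h i then (1 : ℝ) else 0)) * w n := by
      simp_rw [sum_mul]
      rw [sum_congr rfl fun i _ => sum_comm]
      exact sum_comm
    rw [e1, ← sum_add_distrib, sum_div, mul_sum, ← sum_add_distrib]
    exact sum_congr rfl fun n _ => by ring
  rw [hR, mul_sum, sum_comm]
  refine sum_le_sum fun n hn => ?_
  have hn' := hn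
  rw [sieveRange, mem_filter, mem_Ioc] at hn'
  rw [← sum_mul, ← mul_assoc]
  refine mul_le_mul_of_nonneg_right ?_ (hw0 n)
  refine le_trans ?_ (mul_le_mul_of_nonneg_left (sum_prime_indicator_le (by omega)
    (hbad n hn'.1.1) (minFac_mem_sievePrimes hc hcβ hN hv hn)) hlog)
  rw [mul_sum]
  refine sum_le_sum fun ν _ => ?_
  split_ifs with hp
  · rw [mul_one]
    refine Real.log_le_log (by exact_mod_cast hp.pos) ?_
    have := hhN ν
    exact_mod_cast (by omega : n + h ν ≤ 3 * N)
  · rw [mul_zero]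

/-- The sieve inequality which forces sieve points to exist, with all the losses measured
by `t`. -/
theorem eventually_gain_lt {k : ℕ} {b β : ℝ} (hgain : massConstant k b / 2 <
    (k - 1) * (β * primeConstant k b)) :
    ∀ᶠ t : ℝ in nhdsWithin 0 (Set.Ioi 0), (1 + t) * (((1 + t) * massConstant k b + t + t) / 2 +
      k * (k * ((1 + t) * ((1 + b) ^ 2 * (8 * t / β))))) < (k - 1) * (β * (primeConstant k b - t)) := by
  -- Both sides are continuous and at t = 0 the claim is the hypothesis, so every small loss is
  -- affordable.
  have h1 : Continuous fun t : ℝ => (1 + t) * (((1 + t) * massConstant k b + t + t) / 2 +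
      k * (k * ((1 + t) * ((1 + b) ^ 2 * (8 * t / β))))) := by fun_prop
  have h2 : Continuous fun t : ℝ => (k - 1) * (β * (primeConstant k b - t)) := by fun_prop
  refine (Filter.Tendsto.eventually_lt (h1.tendsto 0) (h2.tendsto 0) ?_).filter_mono
    nhdsWithin_le_nhds
  simpa using hgain

theorem exists_isSievePoint {k : ℕ} {b β t : ℝ} (hk : 2 ≤ k) (hb : 0 ≤ b) (hβ : 0 < β)
    (ht : 0 < t) (htβ : 2 * t ≤ β) (hβt : 2 * β + t < 1)
    (hgain : (1 + t) * (((1 + t) * massConstant k b + t + t) / 2 +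
      k * (k * ((1 + t) * ((1 + b) ^ 2 * (8 * t / β))))) < (k - 1) * (β * (primeConstant k b - t)))
    {ϑ : ℝ} (hβϑ : 2 * β < ϑ) (hp : IsPrimeLevel ϑ) (hl : IsLiouvilleLevel ϑ)
    {h : Fin k → ℕ} (hh : IsAdmissibleTuple h) (j : Fin k) (M : ℕ) :
    ∃ n, M < n ∧ IsSievePoint h t j n := by
  by_contra hno
  push Not at hno
  -- The tuple enters only here and in the size of N; the exponent t is already fixed, which makes
  -- it independent of the tuple.
  obtain ⟨D, hD, hhD, hE⟩ : ∃ D : ℕ, 2 * k ≤ D ∧ (∀ i, h i ≤ D) ∧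
      Real.exp (2 * k / D) ^ k ≤ 1 + t := by
    have h1 : Tendsto (fun D : ℕ => Real.exp (2 * k / D) ^ k) atTop (nhds 1) := by
      have := ((Real.continuous_exp.tendsto 0).comp
        (tendsto_const_div_atTop_nhds_zero_nat (2 * k : ℝ))).pow k
      simpa using this
    have h2 := h1.eventually (eventually_le_nhds (by linarith : 1 < 1 + t))
    obtain ⟨D, h3, h4, h5⟩ := (h2.and ((eventually_ge_atTop (2 * k)).and
      (eventually_all.2 fun i => eventually_ge_atTop (h i)))).exists
    exact ⟨D, h4, h5, h3⟩
  obtain ⟨v, hv⟩ := exists_forall_coprime_smallModulus hh D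
  have hinj := hh.1.injective
  obtain ⟨C, hC, hG⟩ := exists_hasLogGrowth (by omega : 1 ≤ k) hD
  have hβ2 : 2 * β < 1 := by linarith
  have e1 := eventually_sum_sieveWeight_le (by omega) hD hinj hhD hb hC hG hβ hβ2 v ht
  have e2 := eventually_all.2 fun m =>
    eventually_le_sum_prime_sieveWeight hk hD hinj hhD hb hC hG hβ hβ2 hβϑ hp hv m ht
  have e3 := eventually_abs_sum_liouville_sieveWeight_le (by omega) hD hinj hhD hb hC hG hβ hβ2
    hβϑ hl v j ht
  have e4 := eventually_all.2 fun m =>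
    eventually_sum_small_factor_le (by omega) hD hinj hhD hb hC hG hβ ht hβt v m
  have e5 : ∀ᶠ N : ℕ in atTop, Real.log (3 * N) ≤ (1 + t) * Real.log N := by
    filter_upwards [tendsto_log_natCast.eventually_ge_atTop (Real.log 3 / t),
      eventually_gt_atTop 0] with N hN hN0
    rw [Real.log_mul (by norm_num) (by exact_mod_cast hN0.ne')]
    rw [div_le_iff₀' ht] at hN
    linarith
  obtain ⟨N, h1, h2, h3, h4, h5, h6, h7⟩ := (e1.and (e2.and (e3.and (e4.and (e5.and
    ((eventually_log_rpow_gt hβ 1).and (eventually_ge_atTop (max 2 (max M D))))))))).exists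
  have hN2 : 2 ≤ N := (le_max_left _ _).trans h7
  have hNM : M ≤ N := ((le_max_left _ _).trans (le_max_right _ _)).trans h7
  have hND : D ≤ N := ((le_max_right _ _).trans (le_max_right _ _)).trans h7
  have hmain := log_mul_sum_erase_le (b := b) ht.le htβ hN2 (fun i => (hhD i).trans hND) hv
    (fun n hn => hno n (hNM.trans_lt hn))
  rw [← massConstant] at h1
  change ∀ m, _ * (primeConstant k b - t) ≤ _ at h2
  have hNR : (2 : ℝ) ≤ N := by exact_mod_cast hN2
  have hlogN : 0 < Real.log N := Real.log_pos (by linarith)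
  have hA : 0 ≤ massConstant k b := by rw [massConstant]; positivity
  have hU : 0 < sieveUnit k D β N := by
    have := sieveDensity_pos D
    have hW : (0 : ℝ) < smallModulus D := by exact_mod_cast smallModulus_pos D
    rw [sieveUnit]; positivity
  have hlow : ((k : ℝ) - 1) * (sieveUnit k D β N * (β * Real.log N) * (primeConstant k b - t)) ≤
      ∑ ν ∈ univ.erase j, ∑ n ∈ sieveRange D v N,
        (if (n + h ν).Prime then Real.log (n + h ν : ℕ) else 0) *
          sieveWeight h D b ((N : ℝ) ^ β) n := by
    have := card_nsmul_le_sum (univ.erase j) _ _ (fun ν _ => h2 ν)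
    rwa [card_erase_of_mem (mem_univ j), card_univ, Fintype.card_fin, nsmul_eq_mul,
      Nat.cast_sub (by omega), Nat.cast_one] at this
  have hsmall := sum_le_card_nsmul univ _ _ (fun i _ => h4 i)
  rw [card_univ, Fintype.card_fin, nsmul_eq_mul] at hsmall
  have h3' := (le_abs_self _).trans h3
  set U := sieveUnit k D β N
  set F := (1 + b) ^ 2 * (8 * t / β) with hF
  have hF0 : 0 ≤ F := by positivity
  have hk0 : (0 : ℝ) ≤ k := Nat.cast_nonneg k
  set X := ((1 + t) * massConstant k b + t + t) / 2 + k * (k * ((1 + t) * F)) with hX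
  have hX0 : 0 ≤ X := by positivity
  have hup : (∑ n ∈ sieveRange D v N, sieveWeight h D b ((N : ℝ) ^ β) n +
        ∑ n ∈ sieveRange D v N, (ArithmeticFunction.liouville (n + h j) : ℝ) *
          sieveWeight h D b ((N : ℝ) ^ β) n) / 2 +
        k * ∑ i, ∑ q ∈ (sievePrimes D ((N : ℝ) ^ β)).filter
          (fun q : ℕ => (q : ℝ) ≤ (2 * N : ℝ) ^ t), ∑ n ∈ sieveRange D v N,
            (if q ∣ n + h i then (1 : ℝ) else 0) * sieveWeight h D b ((N : ℝ) ^ β) n ≤ U * X := by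
    have g1 : U * (Real.exp (2 * k / D) ^ k * massConstant k b + t) ≤
        U * ((1 + t) * massConstant k b + t) := by gcongr
    have g2 : (k : ℝ) * (k * (U * (Real.exp (2 * k / D) ^ k * F))) ≤
        k * (k * (U * ((1 + t) * F))) := by gcongr
    have g3 := mul_le_mul_of_nonneg_left hsmall hk0
    have g4 : U * X = (U * ((1 + t) * massConstant k b + t) + t * U) / 2 +
        k * (k * (U * ((1 + t) * F))) := by rw [hX]; ring
    linarith
  have hlog3 : 0 ≤ Real.log (3 * N) := Real.log_nonneg (by linarith)
  have hfin := ((hlow.trans hmain).trans (mul_le_mul_of_nonneg_left hup hlog3)).trans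
    (mul_le_mul_of_nonneg_right h5 (mul_nonneg hU.le hX0))
  have hcontra := mul_lt_mul_of_pos_right hgain (mul_pos hU hlogN)
  linarith

/-- If `ϑ₀` is large enough for the constants of the sieve, then all small exponents are
admissible. -/
theorem eventually_forall_exists_isSievePoint {k : ℕ} {b ϑ₀ : ℝ} (hk : 2 ≤ k) (hb : 0 ≤ b)
    (hϑ₀ : ϑ₀ < 1) (hgain : massConstant k b < ϑ₀ * ((k - 1) * primeConstant k b)) :
    ∀ᶠ c : ℝ in nhdsWithin 0 (Set.Ioi 0), ∀ ϑ : ℝ, ϑ₀ ≤ ϑ → IsPrimeLevel ϑ → IsLiouvilleLevel ϑ →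
      ∀ h : Fin k → ℕ, IsAdmissibleTuple h → ∀ (j : Fin k) (M : ℕ),
        ∃ n, M < n ∧ IsSievePoint h c j n := by
  have hk' : (2 : ℝ) ≤ k := by exact_mod_cast hk
  have hB : 0 < primeConstant k b := by rw [primeConstant]; positivity
  have hA : 0 < massConstant k b := by rw [massConstant]; positivity
  have hkB : 0 < ((k : ℝ) - 1) * primeConstant k b := mul_pos (by linarith) hB
  -- With β = τ/2, the left inequality is the strict gain and the right one gives 2β < ϑ₀ ≤ ϑ.
  obtain ⟨τ, h1, h2⟩ := exists_between ((div_lt_iff₀ hkB).2 hgain)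
  have hτ : 0 < τ := (div_pos hA hkB).trans h1
  have hβ : 0 < τ / 2 := by linarith
  have hgain' : massConstant k b / 2 < (k - 1) * (τ / 2 * primeConstant k b) := by
    rw [div_lt_iff₀ hkB] at h1; linarith
  have e1 : ∀ᶠ c : ℝ in nhdsWithin 0 (Set.Ioi 0), c < min (τ / 4) (1 - τ) :=
    (eventually_lt_nhds (lt_min (by linarith) (by linarith))).filter_mono nhdsWithin_le_nhds
  filter_upwards [eventually_gain_lt hgain', e1, self_mem_nhdsWithin] with
    c hc hc1 hc0 ϑ hϑ hp hl h hh j M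
  have := lt_min_iff.1 hc1
  exact exists_isSievePoint hk hb hβ hc0 (by linarith) (by linarith) hc (by linarith) hp hl hh j M

/-! ### Bounded numbers of prime factors, the table, and the pigeonhole. -/

theorem minFac_pow_cardFactors_le {m : ℕ} (hm : m ≠ 0) :
    m.minFac ^ ArithmeticFunction.cardFactors m ≤ m := by
  conv_rhs => rw [← Nat.prod_primeFactorsList hm]
  rw [ArithmeticFunction.cardFactors_apply]
  exact List.pow_card_le_prod _ _ fun p hp => Nat.minFac_le_of_dvd
    (Nat.prime_of_mem_primeFactorsList hp).two_le (Nat.dvd_of_mem_primeFactorsList hp)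

/-- All prime factors exceed n^c and their product is at most n², so there are at most 2/c of them.
-/
theorem cardFactors_le_of_rpow_lt_minFac {c : ℝ} (hc : 0 < c) {n m : ℕ} (hn : 2 ≤ n)
    (hm0 : m ≠ 0) (hm : m ≤ n ^ 2) (h : (n : ℝ) ^ c < m.minFac) :
    ArithmeticFunction.cardFactors m ≤ ⌈2 / c⌉₊ := by
  have hn1 : (1 : ℝ) < n := by exact_mod_cast hn
  set r := ArithmeticFunction.cardFactors m with hr
  have h1 : (n : ℝ) ^ (c * r) ≤ (n : ℝ) ^ (2 : ℝ) := by
    calc (n : ℝ) ^ (c * r) = ((n : ℝ) ^ c) ^ r := by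
          rw [Real.rpow_mul (by linarith), Real.rpow_natCast]
      _ ≤ (m.minFac : ℝ) ^ r := by gcongr
      _ ≤ (n : ℝ) ^ 2 := by exact_mod_cast (minFac_pow_cardFactors_le hm0).trans hm
      _ = _ := (Real.rpow_two _).symm
  have h2 := (Real.rpow_le_rpow_left_iff hn1).1 h1
  have h3 : (r : ℝ) ≤ ⌈2 / c⌉₊ := by
    refine le_trans ?_ (Nat.le_ceil _)
    rw [le_div_iff₀ hc]; linarith
  exact_mod_cast h3

theorem almostPrimeComponents_of_rpow_lt_minFac {k : ℕ} {h : Fin k → ℕ} {c : ℝ} (hc : 0 < c)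
    {n : ℕ} (hn : 2 ≤ n) (hhn : ∀ i, h i ≤ n) (hrough : ∀ i, (n : ℝ) ^ c < ((n + h i).minFac : ℝ)) :
    AlmostPrimeComponents h c (⌈2 / c⌉₊ + 1) n := by
  refine fun i => ⟨hrough i, (cardFactors_le_of_rpow_lt_minFac hc hn (by omega) ?_
    (hrough i)).trans (Nat.le_succ _)⟩
  have := hhn i
  nlinarith

/-- The table is finite, so one exponent c serves all entries. For each entry the slope b of the
profile is picked so that the rational inequality between the two constants holds. -/
theorem eventually_levelTable : ∀ᶠ c : ℝ in nhdsWithin 0 (Set.Ioi 0), ∀ x ∈ levelTable,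
    2 ≤ x.2 ∧ ∀ ϑ : ℝ, x.1 ≤ ϑ → IsPrimeLevel ϑ → IsLiouvilleLevel ϑ →
      ∀ h : Fin x.2 → ℕ, IsAdmissibleTuple h → ∀ (j : Fin x.2) (M : ℕ),
        ∃ n, M < n ∧ IsSievePoint h c j n := by
  have key : ∀ (ϑ₀ : ℝ) (k : ℕ) (b : ℝ), 2 ≤ k → 0 ≤ b → ϑ₀ < 1 →
      massConstant k b < ϑ₀ * ((k - 1) * primeConstant k b) →
      ∀ᶠ c : ℝ in nhdsWithin 0 (Set.Ioi 0), 2 ≤ k ∧ ∀ ϑ : ℝ, ϑ₀ ≤ ϑ → IsPrimeLevel ϑ →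
        IsLiouvilleLevel ϑ → ∀ h : Fin k → ℕ, IsAdmissibleTuple h → ∀ (j : Fin k) (M : ℕ),
        ∃ n, M < n ∧ IsSievePoint h c j n := fun ϑ₀ k b hk hb hϑ hg =>
    (eventually_forall_exists_isSievePoint hk hb hϑ hg).mono fun c hc => ⟨hk, hc⟩
  rw [eventually_all_finite (by simp [levelTable])]
  rintro x hx
  simp only [levelTable, Set.mem_insert_iff, Set.mem_singleton_iff] at hx
  rcases hx with rfl | rfl | rfl | rfl | rfl | rfl
  · refine key _ _ 3 (by norm_num) (by norm_num) (by norm_num) ?_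
    norm_num [massConstant, primeConstant, Nat.factorial]
  · refine key _ _ 6 (by norm_num) (by norm_num) (by norm_num) ?_
    norm_num [massConstant, primeConstant, Nat.factorial]
  · refine key _ _ 9 (by norm_num) (by norm_num) (by norm_num) ?_
    norm_num [massConstant, primeConstant, Nat.factorial]
  · refine key _ _ 13 (by norm_num) (by norm_num) (by norm_num) ?_
    norm_num [massConstant, primeConstant, Nat.factorial]
  · refine key _ _ 17 (by norm_num) (by norm_num) (by norm_num) ?_
    norm_num [massConstant, primeConstant, Nat.factorial]
  · refine key _ _ 22 (by norm_num) (by norm_num) (by norm_num) ?_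
    norm_num [massConstant, primeConstant, Nat.factorial]

/-- The alternatives for the prime components of the tuple, with a prescribed number of prime
factors of `n + h j`. -/
theorem exists_odd_infinite_of_isSievePoint {k : ℕ} {h : Fin k → ℕ} {c : ℝ} (hc : 0 < c)
    {j : Fin k} (H : ∀ M : ℕ, ∃ n, M < n ∧ IsSievePoint h c j n) :
    ∃ b : ℕ, Odd b ∧ b ≤ ⌈2 / c⌉₊ + 1 ∧
      {n : ℕ | AlmostPrimeComponents h c (⌈2 / c⌉₊ + 1) n ∧
        ((∃ μ ν : Fin k, μ ≠ j ∧ ν ≠ j ∧ μ ≠ ν ∧ (n + h μ).Prime ∧ (n + h ν).Prime) ∨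
          (ArithmeticFunction.cardFactors (n + h j) = b ∧
            ∃ ν : Fin k, ν ≠ j ∧ (n + h ν).Prime))}.Infinite := by
  set C := ⌈2 / c⌉₊ + 1 with hC
  by_contra hno
  push Not at hno
  -- If every odd b ≤ C gave a finite set, so would their finite union; a sieve point beyond its
  -- bound is the contradiction.
  have hfin : (⋃ b ∈ (range (C + 1)).filter Odd, {n : ℕ | AlmostPrimeComponents h c C n ∧
        ((∃ μ ν : Fin k, μ ≠ j ∧ ν ≠ j ∧ μ ≠ ν ∧ (n + h μ).Prime ∧ (n + h ν).Prime) ∨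
          (ArithmeticFunction.cardFactors (n + h j) = b ∧
            ∃ ν : Fin k, ν ≠ j ∧ (n + h ν).Prime))}).Finite := by
    refine Set.Finite.biUnion (finite_toSet _) fun b hb => ?_
    rw [mem_coe, mem_filter, mem_range] at hb
    exact hno b hb.2 (by omega)
  obtain ⟨M, hM⟩ := hfin.bddAbove
  obtain ⟨n, hn, hrough, hcase⟩ := H (max M (2 + ∑ i, h i))
  have hn1 : M < n := (le_max_left _ _).trans_lt hn
  have hn2 : 2 + ∑ i, h i < n := (le_max_right _ _).trans_lt hn
  have hhn : ∀ i, h i ≤ n := fun i => by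
    have := single_le_sum (f := h) (fun _ _ => Nat.zero_le _) (mem_univ i)
    omega
  have hA : AlmostPrimeComponents h c C n :=
    almostPrimeComponents_of_rpow_lt_minFac hc (by omega) hhn hrough
  refine absurd (hM ?_) (not_le.2 hn1)
  simp only [Set.mem_iUnion]
  rcases hcase with htwo | ⟨hodd, hone⟩
  -- The two-prime alternative does not involve b, so b = 1 is a default; it is in range because C
  -- exceeds ⌈2/c⌉ by 1.
  · exact ⟨1, mem_filter.2 ⟨mem_range.2 (by omega), odd_one⟩, hA, Or.inl htwo⟩
  · exact ⟨_, mem_filter.2 ⟨mem_range.2 (Nat.lt_succ_of_le (hA j).2), hodd⟩, hA, Or.inr ⟨rfl, hone⟩⟩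

/-- Either alternative for the prime components yields infinitely many `n` of the second kind for
a suitable component. -/
theorem exists_component_infinite {k C : ℕ} (hC : 1 ≤ C) {h : Fin k → ℕ} {c : ℝ} {j : Fin k}
    {b : ℕ} (hb : Odd b) (hbC : b ≤ C)
    (H : {n : ℕ | AlmostPrimeComponents h c C n ∧
        ((∃ μ ν : Fin k, μ ≠ j ∧ ν ≠ j ∧ μ ≠ ν ∧ (n + h μ).Prime ∧ (n + h ν).Prime) ∨
          (ArithmeticFunction.cardFactors (n + h j) = b ∧
            ∃ ν : Fin k, ν ≠ j ∧ (n + h ν).Prime))}.Infinite) :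
    ∃ j : Fin k, ∃ b : ℕ, Odd b ∧ b ≤ C ∧
      {n : ℕ | AlmostPrimeComponents h c C n ∧ ArithmeticFunction.cardFactors (n + h j) = b ∧
        ∃ ν : Fin k, ν ≠ j ∧ (n + h ν).Prime}.Infinite := by
  by_contra hno
  push Not at hno
  -- When two components μ and ν are prime, the index μ with b = 1 qualifies, and ν supplies the
  -- other prime.
  refine H (((Set.finite_iUnion fun μ : Fin k => hno μ 1 odd_one hC).union
    (hno j b hb hbC)).subset ?_)
  rintro n ⟨hA, ⟨μ, ν, -, -, hμν, hμ, hν⟩ | ⟨h1, h2⟩⟩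
  · exact Or.inl (Set.mem_iUnion.2 ⟨μ, hA,
      ArithmeticFunction.cardFactors_apply_prime hμ, ν, hμν.symm, hν⟩)
  · exact Or.inr ⟨hA, h1, h2⟩

end sieve

theorem theorem6 :
    ∃ (C : ℕ) (c : ℝ), 0 < c ∧
      ∀ (ϑ₀ : ℝ) (k : ℕ), (ϑ₀, k) ∈ levelTable →
      ∀ ϑ : ℝ, ϑ₀ ≤ ϑ → IsPrimeLevel ϑ → IsLiouvilleLevel ϑ →
      ∀ h : Fin k → ℕ, IsAdmissibleTuple h →
        (∀ j : Fin k, ∃ b : ℕ, Odd b ∧ b ≤ C ∧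
          {n : ℕ | AlmostPrimeComponents h c C n ∧
            ((∃ μ ν : Fin k, μ ≠ j ∧ ν ≠ j ∧ μ ≠ ν ∧ (n + h μ).Prime ∧ (n + h ν).Prime) ∨
              (ArithmeticFunction.cardFactors (n + h j) = b ∧
                ∃ ν : Fin k, ν ≠ j ∧ (n + h ν).Prime))}.Infinite) ∧
        (∃ j : Fin k, ∃ b : ℕ, Odd b ∧ b ≤ C ∧
          {n : ℕ | AlmostPrimeComponents h c C n ∧
            ArithmeticFunction.cardFactors (n + h j) = b ∧
            ∃ ν : Fin k, ν ≠ j ∧ (n + h ν).Prime}.Infinite) := by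
  obtain ⟨c, hc, hc0⟩ := (eventually_levelTable.and self_mem_nhdsWithin).exists
  refine ⟨⌈2 / c⌉₊ + 1, c, hc0, fun ϑ₀ k hx ϑ hϑ hp hl h hh => ?_⟩
  obtain ⟨hk, H⟩ := hc _ hx
  have ha := fun j => exists_odd_infinite_of_isSievePoint hc0 (H ϑ hϑ hp hl h hh j)
  refine ⟨ha, ?_⟩
  -- Any starting index would do; k ≥ 2 guarantees that one exists.
  obtain ⟨b, hb, hbC, hinf⟩ := ha ⟨0, by simp only at hk; omega⟩
  exact exists_component_infinite (by omega) hb hbC hinf
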